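/- Let $n\ge 2$ and let $\bar M=M\cup\partial M$ be a compact Hermitian manifold of complex dimension $n$ with smooth (possibly empty) boundary: a compact smooth real $2n$-manifold with boundary, with an almost complex structure $J$, smooth up to the boundary and induced by holomorphic coordinates in the interior $M$, and a smooth Riemannian metric $g$ with $g(J\cdot,J\cdot)=g$. In local holomorphic coordinates write $g_{j\bar k}=g(\partial_{z_j},\partial_{\bar z_k})$ and $\omega=\frac{\sqrt{-1}}{2}g_{j\bar k}\,dz_j\wedge d\bar z_k$. Let $\nabla$ be the Chern connection, with torsion $T$ and curvature $R_{i\bar jk\bar l}=-\partial_i\partial_{\bar j}g_{k\bar l}+g^{p\bar q}\partial_i g_{k\bar q}\,\partial_{\bar j}g_{p\bar l}$, and for a function $f$ let $|\nabla f|^2=g^{k\bar l}f_kf_{\bar l}$ (one half of the squared $g$-length of $df$). Let $\chi(\cdot,s)=\frac{\sqrt{-1}}{2}\chi_{j\bar k}(\cdot,s)\,dz_j\wedge d\bar z_k$, $s\in\mathbb R$, be real $(1,1)$-forms on $\bar M$ depending smoothly on $(z,s)\in\bar M\times\mathbb R$, and let $\psi\in C^\infty(\bar M\times\mathbb R)$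 with $\psi>0$. Let $u\in C^4(\bar M)$ be an admissible solution of the complex Monge–Ampère equation, that is, in $M$, $$\Big(\chi_{j\bar k}(z,u)+\frac{\partial^2u}{\partial z_j\partial\bar z_k}\Big)>0,\qquad \det\Big(\chi_{j\bar k}(z,u)+\frac{\partial^2u}{\partial z_j\partial\bar z_k}\Big)=\psi(z,u)\,\det(g_{j\bar k}).$$ Suppose that $\chi(\cdot,u)\ge\epsilon\,\omega$ on $M$ for some $\epsilon>0$. Then $$\max_{\bar M}|\nabla u|\le C_1\Big(1+\max_{\partial M}|\nabla u|\Big)$$ (the maximum over $\partial M$ being $0$ if $\partial M=\emptyset$), where $C_1>0$ depends only on $n$, on a positive lower bound for $\epsilon$ and on upper bounds for $$\sup_M|u|,\quad |\psi^{1/n}|_{C^1},\quad \sup_M|\chi|,\quad \sup_M|\nabla\chi|,\quad \sup_M D_u\chi,\quad \sup_M|T|,\quad -\inf_M R,$$ and in particular not on $\inf\psi$. Here $\chi$, $\psi^{1/n}$ and their derivatives are evaluated only at the points $(z,u(z))$; $|\psi^{1/n}|_{C^1}$ is the supremum of $\psi^{1/n}+|\nabla_z\psi^{1/n}|+|D_u\psi^{1/n}|$;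 $\nabla\chi$ is the covariant derivative in $z$ with $s$ fixed; $D_u\chi=\partial\chi/\partial s$; $|\chi|,|\nabla\chi|,|T|$ are norms as multilinear maps with respect to $g$; $\sup_M D_u\chi$ is the least $K$ with $D_u\chi\le K\omega$ on $M$; and $\inf_M R$ is the largest $\kappa$ with $R(X,\bar X,Y,\bar Y)\ge\kappa|X|^2|Y|^2$ for all $X,Y\in T^{1,0}M$ (a lower bound for the bisectional curvature). -/

import Mathlib

open scoped Manifold ContDiff Bundle ComplexOrder
open Bundle

noncomputable section

namespace HermitianMA

/-! ### Calculus in an open subset of `ℂⁿ` -/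

/-- `∂f/∂z_j = (∂f/∂x_j - i ∂f/∂y_j) / 2`. -/
def dz {n : ℕ} (j : Fin n) (f : (Fin n → ℂ) → ℂ) (w : Fin n → ℂ) : ℂ :=
  (fderiv ℝ f w (Pi.single j 1) - Complex.I * fderiv ℝ f w (Pi.single j Complex.I)) / 2

/-- `∂f/∂z̄_j = (∂f/∂x_j + i ∂f/∂y_j) / 2`. -/
def dzbar {n : ℕ} (j : Fin n) (f : (Fin n → ℂ) → ℂ) (w : Fin n → ℂ) : ℂ :=
  (fderiv ℝ f w (Pi.single j 1) + Complex.I * fderiv ℝ f w (Pi.single j Complex.I)) / 2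

/-- The complex Hessian `u_{j k̄} = ∂²u / ∂z_j ∂z̄_k`. -/
def complexHessian {n : ℕ} (u : (Fin n → ℂ) → ℂ) (w : Fin n → ℂ) : Matrix (Fin n) (Fin n) ℂ :=
  Matrix.of fun j k => dz j (dzbar k u) w

/-- The inverse metric `g^{l m̄}`, normalized by `∑ₘ g^{l m̄} g_{k m̄} = δ_{lk}`. -/
def inverseMetric {n : ℕ} (G : (Fin n → ℂ) → Matrix (Fin n) (Fin n) ℂ) (w : Fin n → ℂ)
    (l m : Fin n) : ℂ :=
  (G w)⁻¹ m l

/-- Christoffel symbols of the Chern connection: `Γ^l_{jk} = g^{l m̄} ∂g_{k m̄}/∂z_j`. -/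
def christoffel {n : ℕ} (G : (Fin n → ℂ) → Matrix (Fin n) (Fin n) ℂ) (w : Fin n → ℂ)
    (l j k : Fin n) : ℂ :=
  ∑ m, inverseMetric G w l m * dz j (fun v => G v k m) w

/-- The torsion `T^k_{ij} = Γ^k_{ij} - Γ^k_{ji}` of the Chern connection. -/
def torsion {n : ℕ} (G : (Fin n → ℂ) → Matrix (Fin n) (Fin n) ℂ) (w : Fin n → ℂ)
    (k i j : Fin n) : ℂ :=
  christoffel G w k i j - christoffel G w k j i

/-- The curvature of the Chern connection,
`R_{i j̄ k l̄} = -∂²g_{k l̄}/∂z_i∂z̄_j + g^{p q̄} (∂g_{k q̄}/∂z_i) (∂g_{p l̄}/∂z̄_j)`. -/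
def curvature {n : ℕ} (G : (Fin n → ℂ) → Matrix (Fin n) (Fin n) ℂ) (w : Fin n → ℂ)
    (i j k l : Fin n) : ℂ :=
  -dz i (dzbar j fun v => G v k l) w
    + ∑ p, ∑ q, inverseMetric G w p q * dz i (fun v => G v k q) w * dzbar j (fun v => G v p l) w

/-- The Chern covariant derivative `∇_k A_{i j̄} = ∂A_{i j̄}/∂z_k - Γ^l_{ki} A_{l j̄}` of the
components of a `(1,1)`-form. -/
def covDeriv {n : ℕ} (G A : (Fin n → ℂ) → Matrix (Fin n) (Fin n) ℂ) (w : Fin n → ℂ)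
    (k i j : Fin n) : ℂ :=
  dz k (fun v => A v i j) w - ∑ l, christoffel G w l k i * A w l j

/-- The length `|X| = (g_{i j̄} Xⁱ X̄ʲ)^{1/2}` of `X = Xⁱ ∂/∂z_i`, for `g = (g_{i j̄})`. -/
def vecNorm {n : ℕ} (g : Matrix (Fin n) (Fin n) ℂ) (X : Fin n → ℂ) : ℝ :=
  Real.sqrt (∑ i, ∑ j, g i j * X i * star (X j)).re

/-- `|A| ≤ K` for `A = (A_{i j̄})`, where `|A|` is the supremum of `|A(X, Ȳ)|` over `g`-unit `X, Y`. -/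
def FormBound {n : ℕ} (g A : Matrix (Fin n) (Fin n) ℂ) (K : ℝ) : Prop :=
  ∀ X Y : Fin n → ℂ,
    ‖∑ i, ∑ j, A i j * X i * star (Y j)‖ ≤ K * vecNorm g X * vecNorm g Y

/-- `|∇A| ≤ K` at `w`: a bound for `|(∇_Z A)(X, Ȳ)|` over `g`-unit `X, Y, Z` of type `(1,0)`.
(For real `A`, the components `∇_{k̄} A_{i j̄}` are the conjugates of the components
`∇_k A_{j ī}`.) -/
def CovDerivBound {n : ℕ} (G A : (Fin n → ℂ) → Matrix (Fin n) (Fin n) ℂ) (w : Fin n → ℂ)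
    (K : ℝ) : Prop :=
  ∀ X Y Z : Fin n → ℂ,
    ‖∑ k, ∑ i, ∑ j, covDeriv G A w k i j * Z k * X i * star (Y j)‖
      ≤ K * vecNorm (G w) X * vecNorm (G w) Y * vecNorm (G w) Z

/-- `|T| ≤ K` at `w`: a bound for `|T(X, Y)|` over `g`-unit `X, Y` of type `(1,0)`. -/
def TorsionBound {n : ℕ} (G : (Fin n → ℂ) → Matrix (Fin n) (Fin n) ℂ) (w : Fin n → ℂ)
    (K : ℝ) : Prop :=
  ∀ X Y : Fin n → ℂ,
    vecNorm (G w) (fun k => ∑ i, ∑ j, torsion G w k i j * X i * Y j)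
      ≤ K * vecNorm (G w) X * vecNorm (G w) Y

/-- The bisectional curvature is at least `-K` at `w`: `R(X, X̄, Y, Ȳ) ≥ -K |X|² |Y|²`
(the left-hand side is real for the Chern connection). -/
def BisectionalLowerBound {n : ℕ} (G : (Fin n → ℂ) → Matrix (Fin n) (Fin n) ℂ)
    (w : Fin n → ℂ) (K : ℝ) : Prop :=
  ∀ X Y : Fin n → ℂ,
    -K * vecNorm (G w) X ^ 2 * vecNorm (G w) Y ^ 2
      ≤ (∑ i, ∑ j, ∑ k, ∑ l,
          curvature G w i j k l * X i * star (X j) * Y k * star (Y l)).re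

/-! ### Hermitian manifolds with boundary -/

section Manifold

variable {E : Type*} [NormedAddCommGroup E] [NormedSpace ℝ E] {H : Type*} [TopologicalSpace H]
  (I : ModelWithCorners ℝ E H) {M : Type*} [TopologicalSpace M] [ChartedSpace H M]

/-- `e` is a holomorphic chart for the almost complex structure `J`: a smooth chart of the interior
of `M` with values in `ℂⁿ` whose differential carries `J` to multiplication by `i`. -/
structure IsHolomorphicChart (J : ∀ p : M, TangentSpace I p →L[ℝ] TangentSpace I p) {n : ℕ}
    (e : OpenPartialHomeomorph M (Fin n → ℂ)) : Prop where
  source_subset : e.source ⊆ I.interior M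
  contMDiffOn : ContMDiffOn I 𝓘(ℝ, Fin n → ℂ) ∞ e e.source
  contMDiffOn_symm : ContMDiffOn 𝓘(ℝ, Fin n → ℂ) I ∞ e.symm e.target
  holomorphic : ∀ p ∈ e.source, ∀ (v : TangentSpace I p) (j : Fin n),
    (mfderiv I 𝓘(ℝ, Fin n → ℂ) e p (J p v) : Fin n → ℂ) j
      = Complex.I * (mfderiv I 𝓘(ℝ, Fin n → ℂ) e p v : Fin n → ℂ) j

variable (M) in
/-- The structure of a Hermitian manifold of complex dimension `n` on the smooth manifold `M`
(which may have a boundary): an almost complex structure `J`, smooth up to the boundary and induced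
by holomorphic charts in the interior, and a smooth Riemannian metric `g` with
`g(Jv, Jw) = g(v, w)`. -/
structure HermitianStructure (n : ℕ) [IsManifold I ∞ M] where
  J : ∀ p : M, TangentSpace I p →L[ℝ] TangentSpace I p
  smooth_J : ContMDiff I (I.prod 𝓘(ℝ, E →L[ℝ] E)) ∞
    (fun p : M => TotalSpace.mk' (E →L[ℝ] E)
      (E := fun p : M => TangentSpace I p →L[ℝ] TangentSpace I p) p (J p))
  J_J : ∀ (p : M) (v : TangentSpace I p), J p (J p v) = -v
  integrable : ∀ p ∈ I.interior M, ∃ e : OpenPartialHomeomorph M (Fin n → ℂ),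
    p ∈ e.source ∧ IsHolomorphicChart I J e
  g : ContMDiffRiemannianMetric I ∞ E (fun p : M => TangentSpace I p)
  hermitian : ∀ (p : M) (v w : TangentSpace I p), g.inner p (J p v) (J p w) = g.inner p v w

/-- The component `B_{j k̄} = B(∂/∂z_j, ∂/∂z̄_k)` of the complex bilinear extension of a real
bilinear form `B`, in the coordinates with inverse chart `φ`; here `∂/∂z_j = (X_j - i Y_j) / 2` and
`∂/∂z̄_k = (X_k + i Y_k) / 2` with `X_j = ∂/∂x_j` and `Y_j = ∂/∂y_j`. -/
def mixedComponent {n : ℕ} (φ : (Fin n → ℂ) → M)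
    (B : ∀ p : M, TangentSpace I p →L[ℝ] TangentSpace I p →L[ℝ] ℝ) (w : Fin n → ℂ)
    (j k : Fin n) : ℂ :=
  let X : Fin n → TangentSpace I (φ w) := fun a =>
    mfderiv 𝓘(ℝ, Fin n → ℂ) I φ w (Pi.single a 1 : Fin n → ℂ)
  let Y : Fin n → TangentSpace I (φ w) := fun a =>
    mfderiv 𝓘(ℝ, Fin n → ℂ) I φ w (Pi.single a Complex.I : Fin n → ℂ)
  (((B (φ w) (X j) (X k) + B (φ w) (Y j) (Y k) : ℝ) : ℂ)
    + Complex.I * ((B (φ w) (X j) (Y k) - B (φ w) (Y j) (X k) : ℝ) : ℂ)) / 4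

variable {I} {n : ℕ} [IsManifold I ∞ M]

/-- A smooth family `χ(·, s)`, `s ∈ ℝ`, of real `(1,1)`-forms on `M`. A real 2-form is of type
`(1,1)` exactly when it is `J`-invariant. -/
structure OneOneFormFamily (S : HermitianStructure I M n) where
  form : ℝ → ∀ p : M, TangentSpace I p →L[ℝ] TangentSpace I p →L[ℝ] ℝ
  alternating : ∀ (s : ℝ) (p : M) (v : TangentSpace I p), form s p v v = 0
  J_invariant : ∀ (s : ℝ) (p : M) (v w : TangentSpace I p),
    form s p (S.J p v) (S.J p w) = form s p v w
  smooth : ContMDiff (I.prod 𝓘(ℝ, ℝ)) (I.prod 𝓘(ℝ, E →L[ℝ] E →L[ℝ] ℝ)) ∞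
    (fun q : M × ℝ => TotalSpace.mk' (E →L[ℝ] E →L[ℝ] ℝ)
      (E := fun p : M => TangentSpace I p →L[ℝ] TangentSpace I p →L[ℝ] ℝ) q.1 (form q.2 q.1))

/-- The matrix `g_{j k̄} = g(∂/∂z_j, ∂/∂z̄_k)` of the metric in the chart `e`. -/
def HermitianStructure.metricMatrix (S : HermitianStructure I M n)
    (e : OpenPartialHomeomorph M (Fin n → ℂ)) (w : Fin n → ℂ) : Matrix (Fin n) (Fin n) ℂ :=
  Matrix.of fun j k => mixedComponent I e.symm S.g.inner w j k

/-- The matrix `χ_{j k̄}` in the chart `e`, where `χ = (i/2) χ_{j k̄} dz_j ∧ dz̄_k`, that is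
`χ_{j k̄} = -2 i χ(∂/∂z_j, ∂/∂z̄_k)`. -/
def OneOneFormFamily.matrix {S : HermitianStructure I M n} (χ : OneOneFormFamily S) (s : ℝ)
    (e : OpenPartialHomeomorph M (Fin n → ℂ)) (w : Fin n → ℂ) : Matrix (Fin n) (Fin n) ℂ :=
  Matrix.of fun j k => -2 * Complex.I * mixedComponent I e.symm (χ.form s) w j k

/-- The matrix `D_u χ_{j k̄}` of the derivative of `χ` in the parameter `s`. -/
def OneOneFormFamily.paramDerivMatrix {S : HermitianStructure I M n} (χ : OneOneFormFamily S)
    (s : ℝ) (e : OpenPartialHomeomorph M (Fin n → ℂ)) (w : Fin n → ℂ) :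
    Matrix (Fin n) (Fin n) ℂ :=
  Matrix.of fun j k => deriv (fun t : ℝ => χ.matrix t e w j k) s

/-- The matrix `χ_{j k̄}(z, u(z)) + u_{j k̄}` of `χ_u = χ(·, u) + (i/2) ∂∂̄u` in the chart `e`. -/
def OneOneFormFamily.perturbedMatrix {S : HermitianStructure I M n} (χ : OneOneFormFamily S)
    (u : M → ℝ) (e : OpenPartialHomeomorph M (Fin n → ℂ)) (w : Fin n → ℂ) :
    Matrix (Fin n) (Fin n) ℂ :=
  χ.matrix (u (e.symm w)) e w + complexHessian (fun v => (u (e.symm v) : ℂ)) w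

/-- The length `|∇f|` of the gradient at `p`, in the normalization `|∇f|² = g^{k l̄} f_k f_{l̄}`,
which is one half of the square of the `g`-norm of the real differential `df`. It makes sense at
boundary points too. -/
def HermitianStructure.gradNorm (S : HermitianStructure I M n) (f : M → ℝ) (p : M) : ℝ :=
  (Real.sqrt 2)⁻¹ * sSup {r : ℝ | ∃ v : TangentSpace I p, S.g.inner p v v ≤ 1 ∧
    r = (mfderiv I 𝓘(ℝ, ℝ) f p v : ℝ)}

/-- `u` is admissible, `χ_u > 0`, and solves `(χ_u)ⁿ = ψ(z, u) ωⁿ`, which in local holomorphic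
coordinates reads `det (χ_{j k̄} + u_{j k̄}) = ψ(z, u) det (g_{j k̄})`. -/
def IsAdmissibleSolution {S : HermitianStructure I M n} (χ : OneOneFormFamily S)
    (ψ : M → ℝ → ℝ) (u : M → ℝ) : Prop :=
  ∀ e : OpenPartialHomeomorph M (Fin n → ℂ), IsHolomorphicChart I S.J e → ∀ w ∈ e.target,
    (χ.perturbedMatrix u e w).PosDef ∧
    (χ.perturbedMatrix u e w).det
      = (ψ (e.symm w) (u (e.symm w)) : ℂ) * (S.metricMatrix e w).det

/-- Bounds on the geometry of the interior of `M`: the torsion is at most `KT` and the bisectional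
curvature at least `-KR`. -/
def HermitianStructure.GeometryBound (S : HermitianStructure I M n) (KT KR : ℝ) : Prop :=
  ∀ e : OpenPartialHomeomorph M (Fin n → ℂ), IsHolomorphicChart I S.J e → ∀ w ∈ e.target,
    TorsionBound (S.metricMatrix e) w KT ∧ BisectionalLowerBound (S.metricMatrix e) w KR

/-- Bounds on `χ` along the graph of `u`: at each interior point `z`, with `s = u(z)`, one has
`χ ≥ ε ω`, `|χ| ≤ K₀`, `|∇χ| ≤ K₁` (with `s` fixed in the covariant derivative) and
`D_u χ ≤ K₂ ω`. -/
def OneOneFormFamily.BoundAlong {S : HermitianStructure I M n} (χ : OneOneFormFamily S)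
    (u : M → ℝ) (ε K₀ K₁ K₂ : ℝ) : Prop :=
  ∀ e : OpenPartialHomeomorph M (Fin n → ℂ), IsHolomorphicChart I S.J e → ∀ w ∈ e.target,
    (χ.matrix (u (e.symm w)) e w - (ε : ℂ) • S.metricMatrix e w).PosSemidef ∧
    FormBound (S.metricMatrix e w) (χ.matrix (u (e.symm w)) e w) K₀ ∧
    CovDerivBound (S.metricMatrix e) (χ.matrix (u (e.symm w)) e) w K₁ ∧
    ((K₂ : ℂ) • S.metricMatrix e w - χ.paramDerivMatrix (u (e.symm w)) e w).PosSemidef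

/-- The `C¹` bound on `ψ^{1/n}` along the graph of `u`:
`ψ^{1/n} + |∇_z ψ^{1/n}| + |D_u ψ^{1/n}| ≤ K` at every `(z, u(z))`. -/
def HermitianStructure.RootBoundAlong (S : HermitianStructure I M n) (ψ : M → ℝ → ℝ)
    (u : M → ℝ) (K : ℝ) : Prop :=
  ∀ p : M, ψ p (u p) ^ ((1 : ℝ) / n)
    + S.gradNorm (fun q => ψ q (u p) ^ ((1 : ℝ) / n)) p
    + |deriv (fun s => ψ p s ^ ((1 : ℝ) / n)) (u p)| ≤ K

end Manifold

end HermitianMA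

end

open HermitianMA

noncomputable section

namespace HermitianMA

open Filter Topology

variable {n : ℕ}

/-! ### Wirtinger calculus -/

section Wirtinger

variable {f h : (Fin n → ℂ) → ℂ} {w : Fin n → ℂ} {j k : Fin n}

/-! The maximum principle is applied to `|∇u|² E(u)` with the double exponential weight `E(s) = exp
(A exp (-s))`, where `A` is large. If the maximum lies on the boundary, comparing values of the
weight, which is bounded above and below through `sup |u|`, finishes the proof. So the task is to
bound `W = |∇u|²` at an interior maximum (`gradNorm_sq_le_interiorBound`).

A complex linear change of a holomorphic chart makes the metric the identity and `χ_u` diagonal,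
with entries `d i`, at that point. The first derivatives of the metric are not normalized there.
Instead, `|∇u|²` is replaced by `|X u|² / |X|²` for a holomorphic field `X` that equals the
conjugate of `∂u` at the point and has vanishing Chern derivative there. By Cauchy–Schwarz, `|X u|²
E(u) - c |X|²` has a local maximum with value zero at the point. Its derivatives are easy to
compute: `X` is holomorphic, the first derivatives of `|X|²` vanish, and its second derivatives are
minus the curvature. With `t = A exp (-u)` one has `E' = -t E` and `E'' = (t + t²) E`. The
first-order condition cancels every `t²`, and a positive term `t W² |∂_i u|²` survives
(`second_order_inequality`).

Dividing by `d i` and summing gives a trace inequality. Its third derivatives of `u` are removed by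
differentiating the equation (`dz_dzbar_adaptedField_deriv`, `sum_inv_mul_dz_eq`), at the cost of
torsion, `∇χ`, `D_u χ` and `dρ/ρ` with `ρ = ψ^{1/n}`. The factor `n/ρ` is at most `∑ 1/d i` by the
inequality of arithmetic and geometric means (`inv_le_sum_inv_div`); hence no lower bound on `ψ`
enters. All terms proportional to `∑ 1/d i` are absorbed by `t ε W² ∑ 1/d i`, which comes from `χ ≥
ε ω`. What remains bounds both `∑ 1/d i` and `∑ |∂_i u|²/d i` (`trace_bounds_of_inequalities`).
Since `∏ d i = ρⁿ` is bounded above and every `1/d i` is bounded, every `d i` is bounded above, and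
the second sum then bounds `W` (`le_of_inv_sum_bounds`). -/

theorem dz_congr (hfh : f =ᶠ[𝓝 w] h) : dz j f w = dz j h w := by
  simp only [dz, hfh.fderiv_eq]

theorem dzbar_congr (hfh : f =ᶠ[𝓝 w] h) : dzbar j f w = dzbar j h w := by
  simp only [dzbar, hfh.fderiv_eq]

theorem eventuallyEq_dzbar (hfh : f =ᶠ[𝓝 w] h) : dzbar j f =ᶠ[𝓝 w] dzbar j h :=
  hfh.eventually_nhds.mono fun _ hv => dzbar_congr hv

theorem dz_add (hf : DifferentiableAt ℝ f w) (hh : DifferentiableAt ℝ h w) :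
    dz j (fun v => f v + h v) w = dz j f w + dz j h w := by
  simp only [dz, fderiv_fun_add hf hh, add_apply]; ring

theorem dzbar_add (hf : DifferentiableAt ℝ f w) (hh : DifferentiableAt ℝ h w) :
    dzbar j (fun v => f v + h v) w = dzbar j f w + dzbar j h w := by
  simp only [dzbar, fderiv_fun_add hf hh, add_apply]; ring

theorem dz_sub (hf : DifferentiableAt ℝ f w) (hh : DifferentiableAt ℝ h w) :
    dz j (fun v => f v - h v) w = dz j f w - dz j h w := by
  simp only [dz, fderiv_fun_sub hf hh, sub_apply]; ring

theorem dzbar_sub (hf : DifferentiableAt ℝ f w) (hh : DifferentiableAt ℝ h w) :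
    dzbar j (fun v => f v - h v) w = dzbar j f w - dzbar j h w := by
  simp only [dzbar, fderiv_fun_sub hf hh, sub_apply]; ring

theorem dz_mul (hf : DifferentiableAt ℝ f w) (hh : DifferentiableAt ℝ h w) :
    dz j (fun v => f v * h v) w = dz j f w * h w + f w * dz j h w := by
  simp only [dz, fderiv_fun_mul hf hh, add_apply,
    smul_apply, smul_eq_mul]; ring

theorem dzbar_mul (hf : DifferentiableAt ℝ f w) (hh : DifferentiableAt ℝ h w) :
    dzbar j (fun v => f v * h v) w = dzbar j f w * h w + f w * dzbar j h w := by
  simp only [dzbar, fderiv_fun_mul hf hh, add_apply,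
    smul_apply, smul_eq_mul]; ring

@[simp] theorem dz_const (c : ℂ) : dz j (fun _ => c) w = 0 := by simp [dz]

@[simp] theorem dzbar_const (c : ℂ) : dzbar j (fun _ => c) w = 0 := by simp [dzbar]

theorem dz_const_mul (c : ℂ) (hf : DifferentiableAt ℝ f w) :
    dz j (fun v => c * f v) w = c * dz j f w := by
  rw [dz_mul (differentiableAt_const c) hf]; simp

theorem dzbar_const_mul (c : ℂ) (hf : DifferentiableAt ℝ f w) :
    dzbar j (fun v => c * f v) w = c * dzbar j f w := by
  rw [dzbar_mul (differentiableAt_const c) hf]; simp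

theorem dz_sum {ι : Type*} (s : Finset ι) {F : ι → (Fin n → ℂ) → ℂ}
    (hF : ∀ i ∈ s, DifferentiableAt ℝ (F i) w) :
    dz j (fun v => ∑ i ∈ s, F i v) w = ∑ i ∈ s, dz j (F i) w := by
  simp only [dz, fderiv_fun_sum hF, sum_apply, Finset.mul_sum,
    ← Finset.sum_sub_distrib, Finset.sum_div]

theorem dzbar_sum {ι : Type*} (s : Finset ι) {F : ι → (Fin n → ℂ) → ℂ}
    (hF : ∀ i ∈ s, DifferentiableAt ℝ (F i) w) :
    dzbar j (fun v => ∑ i ∈ s, F i v) w = ∑ i ∈ s, dzbar j (F i) w := by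
  simp only [dzbar, fderiv_fun_sum hF, sum_apply, Finset.mul_sum,
    ← Finset.sum_add_distrib, Finset.sum_div]

theorem fderiv_star_comp (f : (Fin n → ℂ) → ℂ) (w v : Fin n → ℂ) :
    fderiv ℝ (fun v => star (f v)) w v = star (fderiv ℝ f w v) := by
  rw [fderiv_star]; rfl

theorem dz_star : dz j (fun v => star (f v)) w = star (dzbar j f w) := by
  simp only [dz, dzbar, fderiv_star_comp]
  simp [sub_eq_add_neg]

theorem dzbar_star : dzbar j (fun v => star (f v)) w = star (dz j f w) := by
  simp only [dz, dzbar, fderiv_star_comp]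
  simp

theorem fderiv_ofReal_comp {r : (Fin n → ℂ) → ℝ} (hr : DifferentiableAt ℝ r w) (v : Fin n → ℂ) :
    fderiv ℝ (fun v => (r v : ℂ)) w v = (fderiv ℝ r w v : ℝ) := by
  have := (Complex.ofRealCLM.hasFDerivAt.comp w hr.hasFDerivAt).fderiv
  simp only [Function.comp_def, Complex.ofRealCLM_apply] at this
  rw [this]; rfl

theorem dzbar_ofReal {r : (Fin n → ℂ) → ℝ} (hr : DifferentiableAt ℝ r w) :
    dzbar j (fun v => (r v : ℂ)) w = star (dz j (fun v => (r v : ℂ)) w) := by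
  simp [dzbar, dz, fderiv_ofReal_comp hr]

theorem dz_ofReal_comp {r : (Fin n → ℂ) → ℝ} {φ : ℝ → ℝ} {φ' : ℝ} (hr : DifferentiableAt ℝ r w)
    (hφ : HasDerivAt φ φ' (r w)) :
    dz j (fun v => (φ (r v) : ℂ)) w = φ' * dz j (fun v => (r v : ℂ)) w := by
  have h1 := hφ.comp_hasFDerivAt w hr.hasFDerivAt
  have h2 : ∀ v, fderiv ℝ (fun v => φ (r v)) w v = φ' * fderiv ℝ r w v := fun v => by
    have := h1.fderiv
    simp only [Function.comp_def] at this
    rw [this]; simp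
  have h3 : DifferentiableAt ℝ (fun v => φ (r v)) w := h1.differentiableAt
  simp only [dz, fderiv_ofReal_comp hr, fderiv_ofReal_comp h3, h2]
  push_cast; ring

theorem dzbar_ofReal_comp {r : (Fin n → ℂ) → ℝ} {φ : ℝ → ℝ} {φ' : ℝ} (hr : DifferentiableAt ℝ r w)
    (hφ : HasDerivAt φ φ' (r w)) :
    dzbar j (fun v => (φ (r v) : ℂ)) w = φ' * dzbar j (fun v => (r v : ℂ)) w := by
  have h : DifferentiableAt ℝ (fun v => φ (r v)) w :=
    (hφ.comp_hasFDerivAt w hr.hasFDerivAt).differentiableAt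
  rw [dzbar_ofReal hr, dzbar_ofReal h, dz_ofReal_comp hr hφ]
  simp

/-- The real differential in terms of the complex one. -/
theorem sum_mul_dz (f : (Fin n → ℂ) → ℂ) (w ξ : Fin n → ℂ) :
    ∑ k, ξ k * dz k f w
      = (fderiv ℝ f w ξ - Complex.I * fderiv ℝ f w (Complex.I • ξ)) / 2 := by
  have expand : ∀ ζ : Fin n → ℂ, ζ = ∑ k, ((ζ k).re • (Pi.single k 1 : Fin n → ℂ)
      + (ζ k).im • (Pi.single k Complex.I : Fin n → ℂ)) := fun ζ => by
    ext i
    simp only [Finset.sum_apply, Pi.add_apply, Pi.smul_apply, Pi.single_apply]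
    simp only [smul_ite, smul_zero, Finset.sum_add_distrib, Finset.sum_ite_eq, Finset.mem_univ,
      if_true, Complex.real_smul, mul_one, Complex.re_add_im]
  rw [expand (Complex.I • ξ), expand ξ]
  simp only [map_sum, map_add, map_smul]
  rw [← expand ξ]
  simp only [Finset.mul_sum, ← Finset.sum_sub_distrib, Finset.sum_div]
  refine Finset.sum_congr rfl fun k _ => ?_
  simp only [dz, Pi.smul_apply, smul_eq_mul, Complex.mul_re, Complex.mul_im, Complex.I_re,
    Complex.I_im, Complex.real_smul]
  conv_lhs => rw [← Complex.re_add_im (ξ k)]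
  push_cast
  linear_combination (((ξ k).im : ℂ) * fderiv ℝ f w (Pi.single k Complex.I) / 2) * (- Complex.I_sq)

theorem contDiffAt_fderiv_apply {m : ℕ∞ω} (hf : ContDiffAt ℝ (m + 1) f w) (v : Fin n → ℂ) :
    ContDiffAt ℝ m (fun x => fderiv ℝ f x v) w :=
  (hf.fderiv_right le_rfl).clm_apply contDiffAt_const

theorem contDiffAt_dz {m : ℕ∞ω} (hf : ContDiffAt ℝ (m + 1) f w) : ContDiffAt ℝ m (dz j f) w := by
  have h1 := contDiffAt_fderiv_apply hf (Pi.single j 1)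
  have h2 := contDiffAt_fderiv_apply hf (Pi.single j Complex.I)
  exact (h1.sub (contDiffAt_const.mul h2)).div_const 2

theorem contDiffAt_dzbar {m : ℕ∞ω} (hf : ContDiffAt ℝ (m + 1) f w) :
    ContDiffAt ℝ m (dzbar j f) w := by
  have h1 := contDiffAt_fderiv_apply hf (Pi.single j 1)
  have h2 := contDiffAt_fderiv_apply hf (Pi.single j Complex.I)
  exact (h1.add (contDiffAt_const.mul h2)).div_const 2

theorem fderiv_fderiv_apply (hf : ContDiffAt ℝ 2 f w) (v v' : Fin n → ℂ) :
    fderiv ℝ (fun x => fderiv ℝ f x v) w v' = fderiv ℝ (fderiv ℝ f) w v' v := by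
  have h : DifferentiableAt ℝ (fderiv ℝ f) w :=
    (hf.fderiv_right (m := 1) (by norm_num)).differentiableAt (by norm_num)
  rw [fderiv_clm_apply h (differentiableAt_const v)]
  simp

theorem fderiv_dz (hf : ContDiffAt ℝ 2 f w) (v : Fin n → ℂ) :
    fderiv ℝ (dz j f) w v = (fderiv ℝ (fderiv ℝ f) w v (Pi.single j 1)
      - Complex.I * fderiv ℝ (fderiv ℝ f) w v (Pi.single j Complex.I)) / 2 := by
  have h1 : DifferentiableAt ℝ (fun x => fderiv ℝ f x (Pi.single j 1)) w :=
    (contDiffAt_fderiv_apply (m := 1) hf _).differentiableAt (by norm_num)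
  have h2 : DifferentiableAt ℝ (fun x => fderiv ℝ f x (Pi.single j Complex.I)) w :=
    (contDiffAt_fderiv_apply (m := 1) hf _).differentiableAt (by norm_num)
  have h3 : dz j f = fun x => (2 : ℂ)⁻¹ * (fderiv ℝ f x (Pi.single j 1)
      - Complex.I * fderiv ℝ f x (Pi.single j Complex.I)) := by
    ext x; simp [dz]; ring
  rw [h3, fderiv_const_mul (by fun_prop), fderiv_fun_sub h1 (h2.const_mul _),
    fderiv_const_mul h2]
  simp [fderiv_fderiv_apply hf]; ring

theorem fderiv_dzbar (hf : ContDiffAt ℝ 2 f w) (v : Fin n → ℂ) :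
    fderiv ℝ (dzbar j f) w v = (fderiv ℝ (fderiv ℝ f) w v (Pi.single j 1)
      + Complex.I * fderiv ℝ (fderiv ℝ f) w v (Pi.single j Complex.I)) / 2 := by
  have h1 : DifferentiableAt ℝ (fun x => fderiv ℝ f x (Pi.single j 1)) w :=
    (contDiffAt_fderiv_apply (m := 1) hf _).differentiableAt (by norm_num)
  have h2 : DifferentiableAt ℝ (fun x => fderiv ℝ f x (Pi.single j Complex.I)) w :=
    (contDiffAt_fderiv_apply (m := 1) hf _).differentiableAt (by norm_num)
  have h3 : dzbar j f = fun x => (2 : ℂ)⁻¹ * (fderiv ℝ f x (Pi.single j 1)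
      + Complex.I * fderiv ℝ f x (Pi.single j Complex.I)) := by
    ext x; simp [dzbar]; ring
  rw [h3, fderiv_const_mul (by fun_prop), fderiv_fun_add h1 (h2.const_mul _),
    fderiv_const_mul h2]
  simp [fderiv_fderiv_apply hf]; ring

theorem dz_dzbar_comm (hf : ContDiffAt ℝ 2 f w) :
    dz j (dzbar k f) w = dzbar k (dz j f) w := by
  have hs := hf.isSymmSndFDerivAt (by simp)
  rw [dz, dzbar, fderiv_dzbar hf, fderiv_dzbar hf, fderiv_dz hf, fderiv_dz hf,
    hs.eq (Pi.single j 1), hs.eq (Pi.single j 1), hs.eq (Pi.single j Complex.I),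
    hs.eq (Pi.single j Complex.I)]
  ring

theorem dz_dz_comm (hf : ContDiffAt ℝ 2 f w) :
    dz j (dz k f) w = dz k (dz j f) w := by
  have hs := hf.isSymmSndFDerivAt (by simp)
  rw [dz, dz, fderiv_dz hf, fderiv_dz hf, fderiv_dz hf, fderiv_dz hf,
    hs.eq (Pi.single j 1), hs.eq (Pi.single j 1), hs.eq (Pi.single j Complex.I),
    hs.eq (Pi.single j Complex.I)]
  ring

theorem fderiv_eval (v : Fin n → ℂ) : fderiv ℝ (fun x : Fin n → ℂ => x k) w v = v k := by
  have := (ContinuousLinearMap.proj (R := ℝ) (φ := fun _ : Fin n => ℂ) k).hasFDerivAt (x := w)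
  have h3 : (fun x : Fin n → ℂ => x k) =
      ⇑(ContinuousLinearMap.proj (R := ℝ) (φ := fun _ : Fin n => ℂ) k) := rfl
  rw [h3, this.fderiv]; rfl

theorem dz_coord : dz j (fun x : Fin n → ℂ => x k) w = if k = j then 1 else 0 := by
  simp only [dz, fderiv_eval, Pi.single_apply]
  split_ifs <;> simp

theorem dzbar_coord : dzbar j (fun x : Fin n → ℂ => x k) w = 0 := by
  simp only [dzbar, fderiv_eval, Pi.single_apply]
  split_ifs <;> simp

end Wirtinger

/-! ### Second-order Wirtinger derivatives of sums, products and compositions -/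

section SecondOrder

variable {f h : (Fin n → ℂ) → ℂ} {w : Fin n → ℂ} {i : Fin n}

theorem dz_dzbar_add (hf : ContDiffAt ℝ 2 f w) (hh : ContDiffAt ℝ 2 h w) :
    dz i (dzbar i fun v => f v + h v) w = dz i (dzbar i f) w + dz i (dzbar i h) w := by
  have he : (dzbar i fun v => f v + h v) =ᶠ[𝓝 w] fun v => dzbar i f v + dzbar i h v := by
    filter_upwards [hf.eventually (by simp), hh.eventually (by simp)] with v h1 h2
    exact dzbar_add (h1.differentiableAt (by norm_num)) (h2.differentiableAt (by norm_num))
  rw [dz_congr he, dz_add ((contDiffAt_dzbar (m := 1) hf).differentiableAt (by norm_num))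
    ((contDiffAt_dzbar (m := 1) hh).differentiableAt (by norm_num))]

theorem dz_dzbar_mul (hf : ContDiffAt ℝ 2 f w) (hh : ContDiffAt ℝ 2 h w) :
    dz i (dzbar i fun v => f v * h v) w = dz i (dzbar i f) w * h w + dzbar i f w * dz i h w
      + dz i f w * dzbar i h w + f w * dz i (dzbar i h) w := by
  have he : (dzbar i fun v => f v * h v) =ᶠ[𝓝 w]
      fun v => dzbar i f v * h v + f v * dzbar i h v := by
    filter_upwards [hf.eventually (by simp), hh.eventually (by simp)] with v h1 h2
    exact dzbar_mul (h1.differentiableAt (by norm_num)) (h2.differentiableAt (by norm_num))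
  have f1 := hf.differentiableAt (by norm_num)
  have h1 := hh.differentiableAt (by norm_num)
  have f2 : DifferentiableAt ℝ (dzbar i f) w :=
    (contDiffAt_dzbar (m := 1) hf).differentiableAt (by norm_num)
  have h2 : DifferentiableAt ℝ (dzbar i h) w :=
    (contDiffAt_dzbar (m := 1) hh).differentiableAt (by norm_num)
  rw [dz_congr he, dz_add (by fun_prop) (by fun_prop), dz_mul f2 h1, dz_mul f1 h2]
  ring

theorem dz_dzbar_const_mul (c : ℂ) (hf : ContDiffAt ℝ 2 f w) :
    dz i (dzbar i fun v => c * f v) w = c * dz i (dzbar i f) w := by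
  have : dzbar i (fun _ : Fin n → ℂ => c) = fun _ => 0 := funext fun _ => dzbar_const c
  rw [dz_dzbar_mul contDiffAt_const hf, this]
  simp

theorem dz_dzbar_sum {ι : Type*} (s : Finset ι) {F : ι → (Fin n → ℂ) → ℂ}
    (hF : ∀ a ∈ s, ContDiffAt ℝ 2 (F a) w) :
    dz i (dzbar i fun v => ∑ a ∈ s, F a v) w = ∑ a ∈ s, dz i (dzbar i (F a)) w := by
  have he : (dzbar i fun v => ∑ a ∈ s, F a v) =ᶠ[𝓝 w] fun v => ∑ a ∈ s, dzbar i (F a) v := by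
    have : ∀ᶠ v in 𝓝 w, ∀ a ∈ s, ContDiffAt ℝ 2 (F a) v :=
      (Finset.eventually_all s).2 fun a ha => (hF a ha).eventually (by simp)
    filter_upwards [this] with v hv
    exact dzbar_sum s fun a ha => (hv a ha).differentiableAt (by norm_num)
  rw [dz_congr he, dz_sum s fun a ha =>
    (contDiffAt_dzbar (m := 1) (hF a ha)).differentiableAt (by norm_num)]

theorem dz_dzbar_star (hf : ContDiffAt ℝ 2 f w) :
    dz i (dzbar i fun v => star (f v)) w = star (dz i (dzbar i f) w) := by
  have : dzbar i (fun v => star (f v)) = fun v => star (dz i f v) := funext fun _ => dzbar_star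
  rw [this, dz_star, dz_dzbar_comm hf]

theorem dz_dzbar_ofReal_comp {r : (Fin n → ℂ) → ℝ} {φ φ' : ℝ → ℝ} {φ'' : ℝ}
    (hr : ContDiffAt ℝ 2 r w) (hφ : ∀ s, HasDerivAt φ (φ' s) s)
    (hφ' : HasDerivAt φ' φ'' (r w)) :
    dz i (dzbar i fun v => (φ (r v) : ℂ)) w
      = φ'' * dz i (fun v => (r v : ℂ)) w * dzbar i (fun v => (r v : ℂ)) w
        + φ' (r w) * dz i (dzbar i fun v => (r v : ℂ)) w := by
  have hrc : ContDiffAt ℝ 2 (fun v => (r v : ℂ)) w :=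
    Complex.ofRealCLM.contDiff.contDiffAt.comp w hr
  have he : (dzbar i fun v => (φ (r v) : ℂ)) =ᶠ[𝓝 w]
      fun v => (φ' (r v) : ℂ) * dzbar i (fun v => (r v : ℂ)) v := by
    filter_upwards [hr.eventually (by simp)] with v hv
    exact dzbar_ofReal_comp (hv.differentiableAt (by norm_num)) (hφ _)
  have hr1 := hr.differentiableAt (by norm_num)
  have h1 : DifferentiableAt ℝ (fun v => (φ' (r v) : ℂ)) w :=
    Complex.ofRealCLM.differentiableAt.comp w (hφ'.comp_hasFDerivAt w hr1.hasFDerivAt).differentiableAt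
  rw [dz_congr he, dz_mul h1 ((contDiffAt_dzbar (m := 1) hrc).differentiableAt (by norm_num)),
    dz_ofReal_comp hr1 hφ']

end SecondOrder

/-! ### The maximum principle -/

/-- A positive second derivative would make `x` a local minimum as well, so `q` would be constant
near `x` and its second derivative zero. -/
theorem deriv_deriv_nonpos_of_isLocalMax {q : ℝ → ℝ} {x : ℝ} (h : IsLocalMax q x)
    (hc : ContinuousAt q x) : deriv (deriv q) x ≤ 0 := by
  by_contra! hpos
  have hmin := isLocalMin_of_deriv_deriv_pos hpos h.deriv_eq_zero hc
  have hconst : q =ᶠ[𝓝 x] fun _ => q x := by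
    filter_upwards [h, hmin] with y h1 h2 using le_antisymm h1 h2
  have := hconst.deriv.deriv_eq
  simp at this
  linarith

theorem snd_fderiv_nonpos_of_isLocalMax {q : (Fin n → ℂ) → ℝ} {w : Fin n → ℂ}
    (h : IsLocalMax q w) (hq : ContDiffAt ℝ 2 q w) (v : Fin n → ℂ) :
    fderiv ℝ (fderiv ℝ q) w v v ≤ 0 := by
  let γ : ℝ → (Fin n → ℂ) := fun t => w + t • v
  have hγ0 : γ 0 = w := by simp [γ]
  have hγ : ∀ t, HasDerivAt γ v t := fun t => by
    have := ((hasDerivAt_id t).smul_const v).const_add w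
    rw [one_smul] at this
    exact this
  have hγc : Tendsto γ (𝓝 0) (𝓝 w) := by
    have := (hγ 0).continuousAt.tendsto; rwa [hγ0] at this
  have hmax : IsLocalMax (q ∘ γ) 0 := by
    have : ∀ᶠ t in 𝓝 (0 : ℝ), q (γ t) ≤ q w := hγc.eventually h
    filter_upwards [this] with t ht
    simpa [hγ0] using ht
  have hdiff : ∀ᶠ t in 𝓝 (0 : ℝ), DifferentiableAt ℝ q (γ t) :=
    hγc.eventually ((hq.eventually (by simp)).mono fun y hy => hy.differentiableAt (by norm_num))
  have hd1 : deriv (q ∘ γ) =ᶠ[𝓝 0] fun t => fderiv ℝ q (γ t) v := by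
    filter_upwards [hdiff] with t ht
    exact (ht.hasFDerivAt.comp_hasDerivAt t (hγ t)).deriv
  have hd2 : deriv (deriv (q ∘ γ)) 0 = fderiv ℝ (fderiv ℝ q) w v v := by
    rw [hd1.deriv_eq]
    have h2 : HasFDerivAt (fderiv ℝ q) (fderiv ℝ (fderiv ℝ q) w) (γ 0) := by
      rw [hγ0]
      exact ((hq.fderiv_right (m := 1) (by norm_num)).differentiableAt (by norm_num)).hasFDerivAt
    have h3 := (h2.comp_hasDerivAt 0 (hγ 0)).clm_apply (hasDerivAt_const (0 : ℝ) v)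
    simpa using h3.deriv
  rw [← hd2]
  refine deriv_deriv_nonpos_of_isLocalMax hmax ?_
  have hq' : ContinuousAt q (γ 0) := by rw [hγ0]; exact hq.continuousAt
  exact hq'.comp (hγ 0).continuousAt

theorem dz_eq_zero_of_isLocalMax {q : (Fin n → ℂ) → ℝ} {w : Fin n → ℂ}
    (h : IsLocalMax q w) (hq : DifferentiableAt ℝ q w) (i : Fin n) :
    dz i (fun v => (q v : ℂ)) w = 0 := by
  simp [dz, fderiv_ofReal_comp hq, h.fderiv_eq_zero]

/-- `∂²/∂z_i∂z̄_i` is one quarter of the sum of the second derivatives in the two real directions of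
the `z_i`-plane, each nonpositive at a maximum. -/
theorem re_dz_dzbar_nonpos_of_isLocalMax {q : (Fin n → ℂ) → ℝ} {w : Fin n → ℂ}
    (h : IsLocalMax q w) (hq : ContDiffAt ℝ 2 q w) (i : Fin n) :
    (dz i (dzbar i (fun v => (q v : ℂ))) w).re ≤ 0 := by
  have hqc : ContDiffAt ℝ 2 (fun v => (q v : ℂ)) w :=
    Complex.ofRealCLM.contDiff.contDiffAt.comp w hq
  have h2 : ∀ v v', fderiv ℝ (fderiv ℝ (fun v => (q v : ℂ))) w v v'
      = (fderiv ℝ (fderiv ℝ q) w v v' : ℝ) := fun v v' => by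
    rw [← fderiv_fderiv_apply hqc]
    have he : (fun x => fderiv ℝ (fun v => (q v : ℂ)) x v') =ᶠ[𝓝 w]
        fun x => ((fderiv ℝ q x v' : ℝ) : ℂ) := by
      filter_upwards [hq.eventually (by simp)] with y hy
      exact fderiv_ofReal_comp (hy.differentiableAt (by norm_num)) v'
    have hd : DifferentiableAt ℝ (fderiv ℝ q) w :=
      (hq.fderiv_right (m := 1) (by norm_num)).differentiableAt (by norm_num)
    rw [he.fderiv_eq, fderiv_ofReal_comp (hd.clm_apply (differentiableAt_const _)),
      fderiv_clm_apply hd (differentiableAt_const _)]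
    simp
  have h3 := snd_fderiv_nonpos_of_isLocalMax h hq (Pi.single i 1)
  have h4 := snd_fderiv_nonpos_of_isLocalMax h hq (Pi.single i Complex.I)
  rw [dz, fderiv_dzbar hqc, fderiv_dzbar hqc]
  simp only [h2]
  simp
  linarith

/-! ### The derivative of a determinant -/

theorem dz_prod {ι : Type*} [DecidableEq ι] (s : Finset ι) {F : ι → (Fin n → ℂ) → ℂ}
    {w : Fin n → ℂ} {j : Fin n} (hF : ∀ i ∈ s, DifferentiableAt ℝ (F i) w) :
    dz j (fun v => ∏ i ∈ s, F i v) w = ∑ i ∈ s, (∏ l ∈ s.erase i, F l w) * dz j (F i) w := by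
  have h : fderiv ℝ (fun v => ∏ i ∈ s, F i v) w
      = ∑ i ∈ s, (∏ l ∈ s.erase i, F l w) • fderiv ℝ (F i) w := fderiv_finsetProd hF
  simp only [dz, h, sum_apply, smul_apply, smul_eq_mul,
    Finset.mul_sum, ← Finset.sum_sub_distrib, Finset.sum_div]
  exact Finset.sum_congr rfl fun i _ => by ring

/-- Jacobi's formula at a point where the matrix is diagonal. -/
theorem dz_det_of_eq_diagonal {m : ℕ} {A : (Fin n → ℂ) → Matrix (Fin m) (Fin m) ℂ}
    {w : Fin n → ℂ} {k : Fin n} {d : Fin m → ℂ} (hA : A w = Matrix.diagonal d)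
    (hd : ∀ i, d i ≠ 0) (hdiff : ∀ i j, DifferentiableAt ℝ (fun v => A v i j) w) :
    dz k (fun v => (A v).det) w = (∏ i, d i) * ∑ i, (d i)⁻¹ * dz k (fun v => A v i i) w := by
  have hprod : ∀ σ : Equiv.Perm (Fin m), DifferentiableAt ℝ (fun v => ∏ i, A v (σ i) i) w :=
    fun σ =>
    (HasFDerivAt.finsetProd fun i _ => (hdiff (σ i) i).hasFDerivAt).differentiableAt
  simp only [Matrix.det_apply']
  rw [dz_sum _ fun σ _ => (hprod σ).const_mul _]
  rw [Finset.sum_eq_single 1]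
  · rw [dz_const_mul _ (hprod 1), dz_prod _ fun i _ => hdiff _ _]
    simp only [Finset.mul_sum, Equiv.Perm.sign_one, Units.val_one, Int.cast_one, one_mul, Equiv.Perm.one_apply]
    refine Finset.sum_congr rfl fun i _ => ?_
    rw [← Finset.mul_prod_erase Finset.univ d (Finset.mem_univ i)]
    simp only [hA, Matrix.diagonal_apply_eq]
    field_simp [hd i]
  · intro σ _ hσ
    rw [dz_const_mul _ (hprod σ), dz_prod _ fun i _ => hdiff _ _]
    refine mul_eq_zero_of_right _ (Finset.sum_eq_zero fun i _ => ?_)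
    -- A permutation other than the identity moves at least two indices. When one factor is
    -- differentiated, an off-diagonal entry remains among the others, and it vanishes at `w`.
    obtain ⟨a, ha⟩ : ∃ a, σ a ≠ a := by
      by_contra! hc; exact hσ (Equiv.ext hc)
    obtain ⟨l, hl, hli⟩ : ∃ l, σ l ≠ l ∧ l ≠ i := by
      by_cases hai : a = i
      · refine ⟨σ a, fun h => ha (σ.injective h), hai ▸ ha⟩
      · exact ⟨a, ha, hai⟩
    rw [Finset.prod_eq_zero (Finset.mem_erase.2 ⟨hli, Finset.mem_univ l⟩), zero_mul]
    rw [hA, Matrix.diagonal_apply_ne _ hl]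
  · simp

variable {n : ℕ}

/-! ### The test function -/

section TestFunction

/-- The holomorphic vector field with affine coefficients that equals the conjugate of `∂u` at `w₀`
and whose Chern derivative vanishes there, if the metric is the identity at `w₀`. -/
def adaptedField (G : (Fin n → ℂ) → Matrix (Fin n) (Fin n) ℂ) (b w₀ : Fin n → ℂ) (k : Fin n)
    (v : Fin n → ℂ) : ℂ :=
  star (b k) - ∑ i, (∑ l, dz i (fun v => G v l k) w₀ * star (b l)) * (v i - w₀ i)

variable {G : (Fin n → ℂ) → Matrix (Fin n) (Fin n) ℂ} {b w₀ : Fin n → ℂ}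

theorem contDiff_adaptedField (k : Fin n) : ContDiff ℝ ω (adaptedField G b w₀ k) := by
  unfold adaptedField
  refine contDiff_const.sub (ContDiff.sum fun i _ => contDiff_const.mul (ContDiff.sub ?_
    contDiff_const))
  exact contDiff_apply ℝ ℂ i

theorem adaptedField_self (k : Fin n) : adaptedField G b w₀ k w₀ = star (b k) := by
  simp [adaptedField]

theorem differentiableAt_coord_sub (i : Fin n) (v : Fin n → ℂ) :
    DifferentiableAt ℝ (fun x : Fin n → ℂ => x i - w₀ i) v :=
  ((contDiff_apply ℝ ℂ i).contDiffAt.differentiableAt (n := 1) (by norm_num)).sub_const _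

theorem dz_adaptedField (i k : Fin n) (v : Fin n → ℂ) :
    dz i (adaptedField G b w₀ k) v = -∑ l, dz i (fun v => G v l k) w₀ * star (b l) := by
  have h : ∀ j : Fin n, DifferentiableAt ℝ (fun x : Fin n → ℂ => x j) v := fun j =>
    (contDiff_apply ℝ ℂ j).contDiffAt.differentiableAt (n := 1) (by norm_num)
  unfold adaptedField
  rw [dz_sub (differentiableAt_const _) (DifferentiableAt.fun_sum fun j _ =>
    (differentiableAt_coord_sub j v).const_mul _), dz_const,
    dz_sum _ fun j _ => (differentiableAt_coord_sub j v).const_mul _]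
  simp only [dz_const_mul _ (differentiableAt_coord_sub _ v), dz_sub (h _) (differentiableAt_const _),
    dz_coord, dz_const]
  simp

theorem dzbar_adaptedField (i k : Fin n) (v : Fin n → ℂ) :
    dzbar i (adaptedField G b w₀ k) v = 0 := by
  have h : ∀ j : Fin n, DifferentiableAt ℝ (fun x : Fin n → ℂ => x j) v := fun j =>
    (contDiff_apply ℝ ℂ j).contDiffAt.differentiableAt (n := 1) (by norm_num)
  unfold adaptedField
  rw [dzbar_sub (differentiableAt_const _) (DifferentiableAt.fun_sum fun j _ =>
    (differentiableAt_coord_sub j v).const_mul _), dzbar_const,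
    dzbar_sum _ fun j _ => (differentiableAt_coord_sub j v).const_mul _]
  simp only [dzbar_const_mul _ (differentiableAt_coord_sub _ v),
    dzbar_sub (h _) (differentiableAt_const _), dzbar_coord, dzbar_const]
  simp

theorem dz_dzbar_adaptedField (i k : Fin n) (v : Fin n → ℂ) :
    dz i (dzbar i (adaptedField G b w₀ k)) v = 0 := by
  have : dzbar i (adaptedField G b w₀ k) = fun _ => 0 := funext fun v => dzbar_adaptedField i k v
  rw [this, dz_const]

/-- The squared length of the adapted field. -/
def adaptedNormSq (G : (Fin n → ℂ) → Matrix (Fin n) (Fin n) ℂ) (b w₀ v : Fin n → ℂ) : ℂ :=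
  ∑ k, ∑ l, G v k l * (adaptedField G b w₀ k v * star (adaptedField G b w₀ l v))

theorem inverseMetric_of_eq_one (hG1 : G w₀ = 1) (l m : Fin n) :
    inverseMetric G w₀ l m = if m = l then 1 else 0 := by
  simp [inverseMetric, hG1, Matrix.one_apply]

theorem christoffel_of_eq_one (hG1 : G w₀ = 1) (l j k : Fin n) :
    christoffel G w₀ l j k = dz j (fun v => G v k l) w₀ := by
  simp [christoffel, inverseMetric_of_eq_one hG1]

theorem curvature_of_eq_one (hG1 : G w₀ = 1) (i j k l : Fin n) :
    curvature G w₀ i j k l = -dz i (dzbar j fun v => G v k l) w₀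
      + ∑ p, dz i (fun v => G v k p) w₀ * dzbar j (fun v => G v p l) w₀ := by
  simp [curvature, inverseMetric_of_eq_one hG1]

theorem contDiffAt_star {m : ℕ∞ω} {f : (Fin n → ℂ) → ℂ} (hf : ContDiffAt ℝ m f w₀) :
    ContDiffAt ℝ m (fun v => star (f v)) w₀ :=
  Complex.conjCLE.contDiff.contDiffAt.comp w₀ hf

section

variable (hG : ∀ k l, ContDiffAt ℝ 2 (fun v => G v k l) w₀) (hG1 : G w₀ = 1)

include hG in
theorem contDiffAt_adaptedNormSq : ContDiffAt ℝ 2 (adaptedNormSq G b w₀) w₀ := by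
  unfold adaptedNormSq
  have h := fun k => ((contDiff_adaptedField (G := G) (b := b) (w₀ := w₀) k).contDiffAt
    (x := w₀)).of_le (m := 2) le_top
  exact ContDiffAt.sum fun k _ => ContDiffAt.sum fun l _ => (hG k l).mul
    ((h k).mul (contDiffAt_star (h l)))

-- The derivative of the metric coefficients cancels against that of the field, whose affine part
-- was chosen for this purpose. The conjugate field is antiholomorphic and contributes nothing.
include hG hG1 in
theorem dz_adaptedNormSq (i : Fin n) : dz i (adaptedNormSq G b w₀) w₀ = 0 := by
  have h := fun k => ((contDiff_adaptedField (G := G) (b := b) (w₀ := w₀) k).contDiffAt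
    (x := w₀)).differentiableAt (by simp)
  have hs : ∀ l, DifferentiableAt ℝ (fun v => star (adaptedField G b w₀ l v)) w₀ :=
    fun l => (h l).star
  have hg := fun k l => (hG k l).differentiableAt (by norm_num)
  unfold adaptedNormSq
  rw [dz_sum _ fun k _ => DifferentiableAt.fun_sum fun l _ => (hg k l).fun_mul ((h k).fun_mul (hs l))]
  simp only [dz_sum _ fun l _ => (hg _ l).fun_mul ((h _).fun_mul (hs l)), dz_mul (hg _ _) ((h _).fun_mul (hs _)),
    dz_mul (h _) (hs _), dz_star, dzbar_adaptedField, dz_adaptedField, adaptedField_self, hG1,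
    star_zero, mul_zero, add_zero, star_star, Finset.sum_add_distrib, Matrix.one_apply, ite_mul,
    one_mul, zero_mul, Finset.sum_ite_eq, Finset.mem_univ, if_true]
  rw [Finset.sum_comm, ← Finset.sum_add_distrib]
  refine Finset.sum_eq_zero fun l _ => ?_
  rw [neg_mul, Finset.sum_mul]
  simp only [mul_assoc]
  exact add_neg_cancel _

-- For a holomorphic field with vanishing Chern derivative at a point, the complex Hessian of its
-- squared length there is minus the curvature term alone.
include hG hG1 in
theorem dz_dzbar_adaptedNormSq (hherm : ∀ᶠ v in 𝓝 w₀, ∀ k l, star (G v k l) = G v l k)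
    (i : Fin n) : dz i (dzbar i (adaptedNormSq G b w₀)) w₀
      = -∑ k, ∑ l, curvature G w₀ i i k l * star (b k) * b l := by
  have h := fun k => ((contDiff_adaptedField (G := G) (b := b) (w₀ := w₀) k).contDiffAt
    (x := w₀)).of_le (m := 2) le_top
  have hs : ∀ l, ContDiffAt ℝ 2 (fun v => star (adaptedField G b w₀ l v)) w₀ :=
    fun l => contDiffAt_star (h l)
  have hd := fun l => (h l).differentiableAt (by norm_num)
  have hsd := fun l => (hs l).differentiableAt (by norm_num)
  have hbar : ∀ k l, dzbar i (fun v => G v k l) w₀ = star (dz i (fun v => G v l k) w₀) :=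
    fun k l => by
      rw [← dzbar_star]
      exact dzbar_congr (hherm.mono fun v hv => (hv l k).symm)
  unfold adaptedNormSq
  rw [dz_dzbar_sum _ fun k _ => ContDiffAt.sum fun l _ => (hG k l).mul ((h k).mul (hs l))]
  simp only [dz_dzbar_sum _ fun l _ => (hG _ l).mul ((h _).mul (hs l)),
    dz_dzbar_mul (hG _ _) ((h _).mul (hs _)), dz_dzbar_mul (h _) (hs _),
    dz_mul (hd _) (hsd _), dzbar_mul (hd _) (hsd _), dz_star, dzbar_star, dzbar_adaptedField,
    dz_adaptedField, adaptedField_self, dz_dzbar_adaptedField, dz_dzbar_star (h _), hG1,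
    star_zero, mul_zero, add_zero, zero_add, zero_mul, star_star]
  simp only [curvature_of_eq_one hG1, hbar]
  -- Here `D` stands for the derivatives `∂_i g_{k l̄}` and `a` for minus the derivative of the
  -- field. Each of the two mixed terms contributes `-|a|²`, and differentiating both copies of the
  -- field contributes `+|a|²`. The total `-|a|²` is the quadratic part of the curvature.
  generalize hD : (fun k l => dz i (fun v => G v k l) w₀) = D
  have hD' : ∀ k l, dz i (fun v => G v k l) w₀ = D k l := fun k l => congrFun₂ hD k l
  simp only [hD']
  generalize ha : (fun l => ∑ k, D k l * star (b k)) = a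
  have ha' : ∀ l, ∑ k, D k l * star (b k) = a l := fun l => congrFun ha l
  simp only [ha']
  have hsa : ∀ l, star (a l) = ∑ k, star (D k l) * b k := fun l => by
    rw [← ha' l]; simp
  have e1 : ∑ x, ∑ y, star (D y x) * a x * b y = ∑ x, a x * star (a x) := by
    refine Finset.sum_congr rfl fun x _ => ?_
    rw [hsa, Finset.mul_sum]
    exact Finset.sum_congr rfl fun y _ => by ring
  have e2 : ∑ x, ∑ y, D x y * star (b x) * star (a y) = ∑ x, a x * star (a x) := by
    rw [Finset.sum_comm]
    exact Finset.sum_congr rfl fun y _ => by rw [← Finset.sum_mul, ha']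
  have e3 : ∑ z, a z * star (a z) = ∑ x, ∑ y, (∑ z, D x z * star (D y z)) * star (b x) * b y := by
    have h1 : ∀ z, a z * star (a z)
        = ∑ x, ∑ y, D x z * star (b x) * (star (D y z) * b y) := fun z => by
      rw [hsa, ← ha', Finset.sum_mul_sum]
    simp only [h1, Finset.sum_mul]
    rw [Finset.sum_comm, Finset.sum_congr rfl fun x _ => Finset.sum_comm]
    exact Finset.sum_congr rfl fun x _ => Finset.sum_congr rfl fun y _ =>
      Finset.sum_congr rfl fun z _ => by ring
  have hl : ∀ (L : Fin n → Fin n → ℂ) (x y : Fin n),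
      L x y * (star (b x) * b y) + star (D y x) * (-a x * b y)
        + D x y * (star (b x) * star (-a y)) + (1 : Matrix (Fin n) (Fin n) ℂ) x y * (-a x * star (-a y))
      = L x y * star (b x) * b y - star (D y x) * a x * b y - D x y * star (b x) * star (a y)
        + (1 : Matrix (Fin n) (Fin n) ℂ) x y * (a x * star (a y)) := fun L x y => by
    rw [star_neg]; ring
  rw [Finset.sum_congr rfl fun x _ => Finset.sum_congr rfl fun y _ =>
    hl (fun k l => dz i (dzbar i fun v => G v k l) w₀) x y]
  simp only [Finset.sum_add_distrib, Finset.sum_sub_distrib, add_mul, neg_mul, e1, e2, ← e3,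
    Finset.sum_neg_distrib, Matrix.one_apply, ite_mul, one_mul, zero_mul, Finset.sum_ite_eq,
    Finset.mem_univ, if_true]
  ring

end

/-- The derivatives at its zero maximum `w₀` of `|X u|² E(u) - c |X|²`, where `X` is the adapted
field and `E` satisfies `E'(u) = -t E(u)`, `E''(u) = (t + t²) E(u)` at `w₀`. -/
theorem second_order_inequality {u : (Fin n → ℂ) → ℝ} {E E' : ℝ → ℝ} {t W : ℝ}
    (hG : ∀ k l, ContDiffAt ℝ 2 (fun v => G v k l) w₀) (hG1 : G w₀ = 1)
    (hherm : ∀ᶠ v in 𝓝 w₀, ∀ k l, star (G v k l) = G v l k)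
    (hu : ContDiffAt ℝ 3 u w₀) (hEpos : 0 < E (u w₀)) (hEc : ContDiff ℝ 2 E)
    (hE : ∀ s, HasDerivAt E (E' s) s) (hE1 : E' (u w₀) = -t * E (u w₀))
    (hE2 : HasDerivAt E' ((t + t ^ 2) * E (u w₀)) (u w₀))
    (hb : ∀ k, dz k (fun v => (u v : ℂ)) w₀ = b k)
    (hW : ∑ k, star (b k) * b k = W) (hWpos : 0 < W)
    (hmax : ∀ᶠ v in 𝓝 w₀, ∀ ξ : Fin n → ℂ,
      ‖∑ k, ξ k * dz k (fun v => (u v : ℂ)) v‖ ^ 2 * E (u v)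
        ≤ E (u w₀) * W * (∑ k, ∑ l, G v k l * (ξ k * star (ξ l))).re) (i : Fin n) :
    let f := fun v => ∑ k, adaptedField G b w₀ k v * dz k (fun v => (u v : ℂ)) v
    2 * (dz i (dzbar i f) w₀).re * W + 2 * ‖dzbar i f w₀‖ ^ 2
      - 2 * t * W * (dzbar i f w₀ * b i).re + t * W ^ 2 * ‖b i‖ ^ 2
      - t * W ^ 2 * (dz i (dzbar i (fun v => (u v : ℂ))) w₀).re
      + W * (∑ k, ∑ l, curvature G w₀ i i k l * star (b k) * b l).re ≤ 0 := by
  intro f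
  set U : (Fin n → ℂ) → ℂ := fun v => (u v : ℂ) with hU
  have hUc : ContDiffAt ℝ 3 U w₀ := Complex.ofRealCLM.contDiff.contDiffAt.comp w₀ hu
  have hf : ContDiffAt ℝ 2 f w₀ := ContDiffAt.sum fun k _ =>
    (((contDiff_adaptedField k).contDiffAt).of_le le_top).mul (contDiffAt_dz (m := 2) hUc)
  have hfs : ContDiffAt ℝ 2 (fun v => star (f v)) w₀ := contDiffAt_star hf
  have hff : ContDiffAt ℝ 2 (fun v => f v * star (f v)) w₀ := hf.mul hfs
  have hu2 : ContDiffAt ℝ 2 u w₀ := hu.of_le (by norm_num)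
  have hEu : ContDiffAt ℝ 2 (fun v => E (u v)) w₀ := hEc.contDiffAt.comp w₀ hu2
  have hEuc : ContDiffAt ℝ 2 (fun v => (E (u v) : ℂ)) w₀ :=
    Complex.ofRealCLM.contDiff.contDiffAt.comp w₀ hEu
  have hN := contDiffAt_adaptedNormSq (b := b) hG
  have hNre : ContDiffAt ℝ 2 (fun v => (adaptedNormSq G b w₀ v).re) w₀ :=
    Complex.reCLM.contDiff.contDiffAt.comp w₀ hN
  have hf0 : f w₀ = W := by
    simp only [f, adaptedField_self, ← hU, hb, hW]
  have hN0 : adaptedNormSq G b w₀ w₀ = W := by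
    simp [adaptedNormSq, adaptedField_self, hG1, Matrix.one_apply, ← hW]
  let c : ℝ := E (u w₀) * W
  -- Since the field equals the conjugate of `∂u` at `w₀`, Cauchy–Schwarz is an equality there: `Q`
  -- vanishes at `w₀` and is nonpositive nearby.
  let Q : (Fin n → ℂ) → ℝ := fun v => ‖f v‖ ^ 2 * E (u v) - c * (adaptedNormSq G b w₀ v).re
  have hnorm : ∀ v, ((‖f v‖ ^ 2 : ℝ) : ℂ) = f v * star (f v) := fun v => by
    rw [← Complex.normSq_eq_norm_sq, Complex.normSq_eq_conj_mul_self, mul_comm]; rfl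
  have hnormre : ∀ v, ‖f v‖ ^ 2 = (f v * star (f v)).re := fun v => by
    rw [← hnorm, Complex.ofReal_re]
  have hQc : ContDiffAt ℝ 2 Q w₀ := by
    have h1 : ContDiffAt ℝ 2 (fun v => (f v * star (f v)).re) w₀ :=
      Complex.reCLM.contDiff.contDiffAt.comp w₀ hff
    simp only [Q, hnormre]
    exact (h1.mul hEu).sub (contDiffAt_const.mul hNre)
  have hQ0 : Q w₀ = 0 := by
    simp only [Q, hf0, hN0, c, Complex.norm_real, Complex.ofReal_re, Real.norm_eq_abs, sq_abs]
    ring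
  have hQmax : IsLocalMax Q w₀ := by
    filter_upwards [hmax] with v hv
    rw [hQ0]
    exact sub_nonpos.2 (hv fun k => adaptedField G b w₀ k v)
  -- The squared length is real because the metric is Hermitian, so the real part can be dropped and
  -- `Q` differentiated as a complex expression.
  have hQe : (fun v => (Q v : ℂ)) =ᶠ[𝓝 w₀]
      fun v => f v * star (f v) * (E (u v) : ℂ) + (-c : ℂ) * adaptedNormSq G b w₀ v := by
    filter_upwards [hherm] with v hv
    have hreal : ((adaptedNormSq G b w₀ v).re : ℂ) = adaptedNormSq G b w₀ v := by
      rw [← Complex.conj_eq_iff_re]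
      change star _ = _
      unfold adaptedNormSq
      simp only [star_sum, star_mul', hv, star_star]
      rw [Finset.sum_comm]
      exact Finset.sum_congr rfl fun _ _ => Finset.sum_congr rfl fun _ _ => by ring
    simp only [Q, Complex.ofReal_sub, Complex.ofReal_mul, hreal, hnorm]
    ring
  have hd {g : (Fin n → ℂ) → ℂ} (hg : ContDiffAt ℝ 2 g w₀) : DifferentiableAt ℝ g w₀ :=
    hg.differentiableAt (by norm_num)
  have hur := hu2.differentiableAt (by norm_num)
  have hb' : dzbar i U w₀ = star (b i) := by rw [hU, dzbar_ofReal hur, hb]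
  have hdE : dz i (fun v => (E (u v) : ℂ)) w₀ = -t * E (u w₀) * b i := by
    rw [dz_ofReal_comp hur (hE _), hb, hE1]; push_cast; ring
  have hdbarE : dzbar i (fun v => (E (u v) : ℂ)) w₀ = -t * E (u w₀) * star (b i) := by
    rw [dzbar_ofReal_comp hur (hE _), ← hU, hb', hE1]; push_cast; ring
  have hlapE : dz i (dzbar i fun v => (E (u v) : ℂ)) w₀
      = E (u w₀) * ((t + t ^ 2) * b i * star (b i) - t * dz i (dzbar i U) w₀) := by
    rw [dz_dzbar_ofReal_comp hu2 hE hE2, hb, ← hU, hb', hE1]; push_cast; ring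
  have hfirst := dz_eq_zero_of_isLocalMax hQmax (hQc.differentiableAt (by norm_num)) i
  have hsecond := re_dz_dzbar_nonpos_of_isLocalMax hQmax hQc i
  rw [dz_congr hQe, dz_add ((hd hff).fun_mul (hd hEuc)) ((hd hN).const_mul _),
    dz_const_mul _ (hd hN), dz_adaptedNormSq hG hG1, dz_mul (hd hff) (hd hEuc),
    dz_mul (hd hf) (hd hfs), dz_star, hdE, hf0] at hfirst
  rw [dz_congr (eventuallyEq_dzbar hQe), dz_dzbar_add (hff.mul hEuc) (contDiffAt_const.mul hN),
    dz_dzbar_const_mul _ hN, dz_dzbar_adaptedNormSq hG hG1 hherm, dz_dzbar_mul hff hEuc,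
    dz_dzbar_mul hf hfs, dz_dzbar_star hf, dz_mul (hd hf) (hd hfs), dzbar_mul (hd hf) (hd hfs),
    dz_star, dzbar_star, hdE, hdbarE, hlapE, hf0] at hsecond
  generalize hF : dz i (dzbar i f) w₀ = F at *
  generalize hfz : dz i f w₀ = p at *
  generalize hfb : dzbar i f w₀ = q at *
  generalize hUi : dz i (dzbar i U) w₀ = Ui at *
  generalize hR : ∑ k, ∑ l, curvature G w₀ i i k l * star (b k) * b l = R at *
  have hWC : (W : ℂ) ≠ 0 := by exact_mod_cast hWpos.ne'
  have hEC : (E (u w₀) : ℂ) ≠ 0 := by exact_mod_cast hEpos.ne'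
  have hstarW : star (W : ℂ) = W := Complex.conj_ofReal W
  rw [hstarW] at hfirst hsecond
  -- The first-order condition, after division by `W E(u)`.
  have hp : p = t * W * b i - star q := by
    have : (W * E (u w₀) : ℂ) * (p + star q - t * W * b i) = 0 := by linear_combination hfirst
    rcases mul_eq_zero.1 this with h | h
    · exact absurd h (mul_ne_zero hWC hEC)
    · linear_combination h
  rw [hp] at hsecond
  -- In multiples of `W² |b i|²`, the term `|p|²` contributes `t²`, the products of first
  -- derivatives of `|f|²` and of `E(u)` contribute `-2 t²`, and `E''` contributes `t + t²`. Only
  -- `t` is left.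
  refine nonpos_of_mul_nonpos_right (a := E (u w₀)) (le_of_eq_of_le ?_ hsecond) hEpos
  simp only [c, ← Complex.normSq_eq_norm_sq, Complex.normSq_apply, star_sub, star_mul',
    Complex.star_def, Complex.conj_ofReal, Complex.ofReal_mul, ← Complex.ofReal_pow,
    Complex.add_re, Complex.sub_re, Complex.mul_re, Complex.neg_re, Complex.conj_re, Complex.conj_im,
    Complex.ofReal_re, Complex.ofReal_im, Complex.add_im, Complex.sub_im, Complex.mul_im,
    Complex.neg_im]
  ring

end TestFunction

variable {n : ℕ}

/-! ### The differentiated equation -/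

section Equation

theorem differentiableAt_comp_graph {F' : Type*} [NormedAddCommGroup F'] [NormedSpace ℝ F']
    {F : ℝ × (Fin n → ℂ) → F'} {u : (Fin n → ℂ) → ℝ} {w : Fin n → ℂ}
    (hF : DifferentiableAt ℝ F (u w, w)) (hu : DifferentiableAt ℝ u w) :
    DifferentiableAt ℝ (fun v => F (u v, v)) w :=
  DifferentiableAt.comp (g := F) (f := fun v => (u v, v)) w hF (hu.prodMk differentiableAt_id)

/-- Separates the explicit dependence on `z`, which leads to `∇χ` and `∇_z ψ^{1/n}`, from the
dependence through `u`, which leads to `D_u χ` and `D_u ψ^{1/n}`. -/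
theorem dz_comp_graph {F : ℝ × (Fin n → ℂ) → ℂ} {u : (Fin n → ℂ) → ℝ} {w : Fin n → ℂ}
    (hF : DifferentiableAt ℝ F (u w, w)) (hu : DifferentiableAt ℝ u w) (k : Fin n) :
    dz k (fun v => F (u v, v)) w = dz k (fun v => F (u w, v)) w
      + deriv (fun s => F (s, w)) (u w) * dz k (fun v => (u v : ℂ)) w := by
  have h1 : HasFDerivAt (fun v => F (u v, v))
      ((fderiv ℝ F (u w, w)).comp ((fderiv ℝ u w).prod (ContinuousLinearMap.id ℝ _))) w :=
    HasFDerivAt.comp (g := F) (f := fun v => (u v, v)) w hF.hasFDerivAt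
      (hu.hasFDerivAt.prodMk (hasFDerivAt_id w))
  have h2 : HasFDerivAt (fun v => F (u w, v))
      ((fderiv ℝ F (u w, w)).comp (ContinuousLinearMap.inr ℝ ℝ (Fin n → ℂ))) w :=
    hF.hasFDerivAt.comp w (hasFDerivAt_prodMk_right (u w) w)
  have h3 : HasDerivAt (fun s => F (s, w)) (fderiv ℝ F (u w, w) (1, 0)) (u w) :=
    hF.hasFDerivAt.comp_hasDerivAt (u w) ((hasDerivAt_id (u w)).prodMk (hasDerivAt_const _ w))
  have h4 : ∀ v : Fin n → ℂ, fderiv ℝ F (u w, w) (fderiv ℝ u w v, v)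
      = fderiv ℝ F (u w, w) (0, v) + fderiv ℝ u w v * fderiv ℝ F (u w, w) (1, 0) := fun v => by
    have : (fderiv ℝ u w v, v) = ((0 : ℝ), v) + fderiv ℝ u w v • ((1 : ℝ), (0 : Fin n → ℂ)) := by
      ext <;> simp
    rw [this, map_add, map_smul, Complex.real_smul]
  simp only [dz, h1.fderiv, h2.fderiv, h3.deriv, fderiv_ofReal_comp hu, ContinuousLinearMap.comp_apply,
    ContinuousLinearMap.prod_apply, ContinuousLinearMap.id_apply, ContinuousLinearMap.inr_apply, h4]
  ring

variable {G : (Fin n → ℂ) → Matrix (Fin n) (Fin n) ℂ} {b w₀ : Fin n → ℂ}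
  {u : (Fin n → ℂ) → ℝ} {A : ℝ → (Fin n → ℂ) → Matrix (Fin n) (Fin n) ℂ} {d : Fin n → ℝ}

/-- The value at `w₀` of `∂f/∂z̄_i`, where `f = X u` for the adapted field `X`. -/
theorem dzbar_adaptedField_deriv (hu : ContDiffAt ℝ 3 u w₀)
    (hdiag : A (u w₀) w₀ + complexHessian (fun v => (u v : ℂ)) w₀
      = Matrix.diagonal fun i => (d i : ℂ)) (i : Fin n) :
    dzbar i (fun v => ∑ k, adaptedField G b w₀ k v * dz k (fun v => (u v : ℂ)) v) w₀
      = star (b i) * d i - ∑ k, star (b k) * A (u w₀) w₀ k i := by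
  set U : (Fin n → ℂ) → ℂ := fun v => (u v : ℂ)
  have hUc : ContDiffAt ℝ 3 U w₀ := Complex.ofRealCLM.contDiff.contDiffAt.comp w₀ hu
  have hX := fun k => ((contDiff_adaptedField (G := G) (b := b) (w₀ := w₀) k).contDiffAt
    (x := w₀)).differentiableAt (by simp)
  have hU1 : ∀ k, DifferentiableAt ℝ (dz k U) w₀ := fun k =>
    (contDiffAt_dz (m := 2) hUc).differentiableAt (by norm_num)
  have hH : ∀ k, dzbar i (dz k U) w₀
      = (if k = i then (d k : ℂ) else 0) - A (u w₀) w₀ k i := fun k => by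
    rw [← dz_dzbar_comm (hUc.of_le (by norm_num))]
    have := congrFun₂ hdiag k i
    rw [Matrix.add_apply, Matrix.diagonal_apply] at this
    rw [← this]
    simp [complexHessian]
  rw [dzbar_sum _ fun k _ => (hX k).fun_mul (hU1 k)]
  simp only [dzbar_mul (hX _) (hU1 _), dzbar_adaptedField, adaptedField_self, hH, zero_mul, zero_add,
    mul_sub, Finset.sum_sub_distrib, mul_ite, mul_zero, Finset.sum_ite_eq', Finset.mem_univ, if_true]

/-- The value at `w₀` of `∂²f/∂z_i∂z̄_i`, where `f = X u` for the adapted field `X`, in terms of the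
derivatives of `A + (u_{j k̄})`. -/
theorem dz_dzbar_adaptedField_deriv (hG1 : G w₀ = 1) (hu : ContDiffAt ℝ 4 u w₀)
    (hA : ∀ k l, DifferentiableAt ℝ (fun q : ℝ × (Fin n → ℂ) => A q.1 q.2 k l) (u w₀, w₀))
    (hdiag : A (u w₀) w₀ + complexHessian (fun v => (u v : ℂ)) w₀
      = Matrix.diagonal fun i => (d i : ℂ))
    (hb : ∀ k, dz k (fun v => (u v : ℂ)) w₀ = b k) (i : Fin n) :
    dz i (dzbar i fun v => ∑ k, adaptedField G b w₀ k v * dz k (fun v => (u v : ℂ)) v) w₀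
      = -(d i * ∑ l, dz i (fun v => G v l i) w₀ * star (b l))
        + ∑ k, (∑ l, torsion G w₀ k i l * star (b l)) * A (u w₀) w₀ k i
        + ∑ k, star (b k) * dz k
            (fun v => (A (u v) v + complexHessian (fun v => (u v : ℂ)) v) i i) w₀
        - ∑ k, covDeriv G (A (u w₀)) w₀ k i i * star (b k)
        - deriv (fun s => A s w₀ i i) (u w₀) * ∑ k, star (b k) * b k := by
  set U : (Fin n → ℂ) → ℂ := fun v => (u v : ℂ)
  have hUc : ContDiffAt ℝ 4 U w₀ := Complex.ofRealCLM.contDiff.contDiffAt.comp w₀ hu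
  have hX := fun k v => ((contDiff_adaptedField (G := G) (b := b) (w₀ := w₀) k).contDiffAt
    (x := v)).differentiableAt (by simp)
  have hUd : ∀ k, ContDiffAt ℝ 3 (dz k U) w₀ := fun k => contDiffAt_dz (m := 3) hUc
  have hUb : ∀ k, ContDiffAt ℝ 3 (dzbar k U) w₀ := fun k => contDiffAt_dzbar (m := 3) hUc
  have hUbd : ∀ k, ContDiffAt ℝ 2 (dzbar i (dz k U)) w₀ := fun k => contDiffAt_dzbar (m := 2) (hUd k)
  -- The field is holomorphic, so `∂/∂z̄_i` acts on the derivatives of `u` only.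
  have he : dzbar i (fun v => ∑ k, adaptedField G b w₀ k v * dz k U v) =ᶠ[𝓝 w₀]
      fun v => ∑ k, adaptedField G b w₀ k v * dzbar i (dz k U) v := by
    have : ∀ᶠ v in 𝓝 w₀, ∀ k, ContDiffAt ℝ 3 (dz k U) v :=
      eventually_all.2 fun k => (hUd k).eventually (by simp)
    filter_upwards [this] with v hv
    have hv1 := fun k => (hv k).differentiableAt (by norm_num)
    rw [dzbar_sum _ fun k _ => (hX k v).fun_mul (hv1 k)]
    exact Finset.sum_congr rfl fun k _ => by
      rw [dzbar_mul (hX k v) (hv1 k), dzbar_adaptedField]; ring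
  have hcomm : ∀ k, dzbar i (dz k U) =ᶠ[𝓝 w₀] dz k (dzbar i U) := fun k => by
    filter_upwards [hUc.eventually (by simp)] with v hv
    exact (dz_dzbar_comm (hv.of_le (by norm_num))).symm
  -- Coordinate derivatives commute, so the third derivative becomes the `z_k`-derivative of the
  -- diagonal entry `u_{i ī}`, which the differentiated equation controls.
  have hthird : ∀ k, dz i (dzbar i (dz k U)) w₀ = dz k (dz i (dzbar i U)) w₀ := fun k => by
    rw [dz_congr (hcomm k), dz_dz_comm ((hUb i).of_le (by norm_num))]
  have hH : ∀ k, dzbar i (dz k U) w₀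
      = (if k = i then (d k : ℂ) else 0) - A (u w₀) w₀ k i := fun k => by
    rw [(hcomm k).eq_of_nhds]
    have := congrFun₂ hdiag k i
    rw [Matrix.add_apply, Matrix.diagonal_apply] at this
    rw [← this]
    simp [complexHessian]
  have hud := hu.differentiableAt (by norm_num)
  have hAu : ∀ k l, DifferentiableAt ℝ (fun v => A (u v) v k l) w₀ := fun k l =>
    differentiableAt_comp_graph (hA k l) hud
  have hHd : DifferentiableAt ℝ (dz i (dzbar i U)) w₀ :=
    (contDiffAt_dz (m := 2) (hUb i)).differentiableAt (by norm_num)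
  have htotal : ∀ k, dz k (dz i (dzbar i U)) w₀
      = dz k (fun v => (A (u v) v + complexHessian U v) i i) w₀
        - (covDeriv G (A (u w₀)) w₀ k i i + ∑ l, dz k (fun v => G v i l) w₀ * A (u w₀) w₀ l i
          + deriv (fun s => A s w₀ i i) (u w₀) * b k) := fun k => by
    have h1 : dz k (fun v => (A (u v) v + complexHessian U v) i i) w₀
        = dz k (fun v => A (u v) v i i) w₀ + dz k (dz i (dzbar i U)) w₀ := by
      rw [← dz_add (hAu i i) hHd]; rfl
    have h2 := dz_comp_graph (hA i i) hud k
    rw [h1, h2, hb]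
    simp only [covDeriv, christoffel_of_eq_one hG1]
    ring
  rw [dz_congr he, dz_sum _ fun k _ =>
    (hX k w₀).fun_mul ((hUbd k).differentiableAt (by norm_num))]
  have hterm : ∀ k, dz i (fun v => adaptedField G b w₀ k v * dzbar i (dz k U) v) w₀
      = -((∑ l, dz i (fun v => G v l k) w₀ * star (b l)) * (if k = i then (d k : ℂ) else 0))
        + (∑ l, dz i (fun v => G v l k) w₀ * star (b l)) * A (u w₀) w₀ k i
        + star (b k) * dz k (fun v => (A (u v) v + complexHessian U v) i i) w₀
        - covDeriv G (A (u w₀)) w₀ k i i * star (b k)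
        - ∑ l, dz k (fun v => G v i l) w₀ * star (b k) * A (u w₀) w₀ l i
        - deriv (fun s => A s w₀ i i) (u w₀) * (star (b k) * b k) := fun k => by
    rw [dz_mul (hX k w₀) ((hUbd k).differentiableAt (by norm_num)), dz_adaptedField,
      adaptedField_self, hH, hthird, htotal]
    have : ∑ l, dz k (fun v => G v i l) w₀ * star (b k) * A (u w₀) w₀ l i
        = star (b k) * ∑ l, dz k (fun v => G v i l) w₀ * A (u w₀) w₀ l i := by
      rw [Finset.mul_sum]; exact Finset.sum_congr rfl fun l _ => by ring
    rw [this]; ring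
  -- The Christoffel symbols come from two sources, the derivative of the field and the passage from
  -- `∂χ` to `∇χ`. After the indices of the second double sum are exchanged, they combine into the
  -- torsion.
  have htors : ∑ k, (∑ l, torsion G w₀ k i l * star (b l)) * A (u w₀) w₀ k i
      = ∑ k, (∑ l, dz i (fun v => G v l k) w₀ * star (b l)) * A (u w₀) w₀ k i
        - ∑ k, ∑ l, dz k (fun v => G v i l) w₀ * star (b k) * A (u w₀) w₀ l i := by
    rw [Finset.sum_comm (f := fun k l => dz k (fun v => G v i l) w₀ * star (b k) * A (u w₀) w₀ l i),
      ← Finset.sum_sub_distrib]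
    refine Finset.sum_congr rfl fun k _ => ?_
    rw [← Finset.sum_mul, ← sub_mul, ← Finset.sum_sub_distrib]
    simp only [torsion, christoffel_of_eq_one hG1, sub_mul]
  rw [Finset.sum_congr rfl fun k _ => hterm k, htors]
  simp only [Finset.sum_add_distrib, Finset.sum_sub_distrib, Finset.sum_neg_distrib, mul_ite,
    mul_zero, Finset.sum_ite_eq', Finset.mem_univ, if_true, ← Finset.mul_sum]
  ring

/-- The logarithmic derivative of `det (A + (u_{j k̄})) = ρ(·, u)ⁿ det G`. -/
theorem sum_inv_mul_dz_eq {ρ : (Fin n → ℂ) → ℝ → ℝ} (hG1 : G w₀ = 1)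
    (hG : ∀ k l, DifferentiableAt ℝ (fun v => G v k l) w₀) (hu : ContDiffAt ℝ 4 u w₀)
    (hA : ∀ k l, DifferentiableAt ℝ (fun q : ℝ × (Fin n → ℂ) => A q.1 q.2 k l) (u w₀, w₀))
    (hdiag : A (u w₀) w₀ + complexHessian (fun v => (u v : ℂ)) w₀
      = Matrix.diagonal fun i => (d i : ℂ)) (hd : ∀ i, 0 < d i)
    (hb : ∀ k, dz k (fun v => (u v : ℂ)) w₀ = b k)
    (hρ : DifferentiableAt ℝ (fun q : ℝ × (Fin n → ℂ) => ρ q.2 q.1) (u w₀, w₀))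
    (hρpos : 0 < ρ w₀ (u w₀))
    (heq : ∀ᶠ v in 𝓝 w₀, (A (u v) v + complexHessian (fun v => (u v : ℂ)) v).det
      = (ρ v (u v) : ℂ) ^ n * (G v).det) (k : Fin n) :
    ∑ i, ((d i : ℂ))⁻¹ * dz k
        (fun v => (A (u v) v + complexHessian (fun v => (u v : ℂ)) v) i i) w₀
      = n * (ρ w₀ (u w₀) : ℂ)⁻¹ * (dz k (fun v => (ρ v (u w₀) : ℂ)) w₀
          + (deriv (ρ w₀) (u w₀) : ℝ) * b k)
        + ∑ i, dz k (fun v => G v i i) w₀ := by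
  set U : (Fin n → ℂ) → ℂ := fun v => (u v : ℂ)
  have hUc : ContDiffAt ℝ 4 U w₀ := Complex.ofRealCLM.contDiff.contDiffAt.comp w₀ hu
  have hud := hu.differentiableAt (by norm_num)
  have hHd : ∀ i j, DifferentiableAt ℝ (fun v => complexHessian U v i j) w₀ := fun i j =>
    (contDiffAt_dz (m := 2) (contDiffAt_dzbar (m := 3) hUc)).differentiableAt (by norm_num)
  have hsum : ∀ i j, DifferentiableAt ℝ (fun v => (A (u v) v + complexHessian U v) i j) w₀ :=
    fun i j => DifferentiableAt.fun_add (differentiableAt_comp_graph (hA i j) hud) (hHd i j)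
  have hd0 : ∀ i, (d i : ℂ) ≠ 0 := fun i => by exact_mod_cast (hd i).ne'
  have hρ0 : (ρ w₀ (u w₀) : ℂ) ≠ 0 := by exact_mod_cast hρpos.ne'
  -- At `w₀` both matrices are diagonal, so Jacobi's formula in its diagonal form applies to each
  -- side of the equation.
  have hL := dz_det_of_eq_diagonal (k := k) hdiag hd0 hsum
  have hR := dz_det_of_eq_diagonal (A := G) (w := w₀) (k := k) (d := fun _ => 1)
    (by rw [hG1, Matrix.diagonal_one]) (fun _ => one_ne_zero) hG
  have hprod : ∏ i, (d i : ℂ) = (ρ w₀ (u w₀) : ℂ) ^ n := by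
    have := heq.self_of_nhds
    rwa [hdiag, hG1, Matrix.det_diagonal, Matrix.det_one, mul_one] at this
  have hρu : DifferentiableAt ℝ (fun v => (ρ v (u v) : ℂ)) w₀ :=
    Complex.ofRealCLM.differentiableAt.comp w₀ (differentiableAt_comp_graph hρ hud)
  have hdet : DifferentiableAt ℝ (fun v => (G v).det) w₀ := by
    simp only [Matrix.det_apply']
    exact DifferentiableAt.fun_sum fun σ _ => DifferentiableAt.const_mul
      (HasFDerivAt.finsetProd fun i _ => (hG (σ i) i).hasFDerivAt).differentiableAt _
  have hpow : dz k (fun v => (ρ v (u v) : ℂ) ^ n) w₀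
      = n * (ρ w₀ (u w₀) : ℂ) ^ (n - 1) * dz k (fun v => (ρ v (u v) : ℂ)) w₀ := by
    simp only [dz, (hρu.hasFDerivAt.pow n).fderiv, smul_apply, smul_eq_mul, nsmul_eq_mul]
    ring
  have hchain : dz k (fun v => (ρ v (u v) : ℂ)) w₀ = dz k (fun v => (ρ v (u w₀) : ℂ)) w₀
      + (deriv (ρ w₀) (u w₀) : ℝ) * b k := by
    have hρc : DifferentiableAt ℝ (fun q : ℝ × (Fin n → ℂ) => (ρ q.2 q.1 : ℂ)) (u w₀, w₀) :=
      Complex.ofRealCLM.differentiableAt.comp _ hρ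
    have h1 := dz_comp_graph hρc hud k
    have h2 : HasDerivAt (ρ w₀) (deriv (ρ w₀) (u w₀)) (u w₀) :=
      (DifferentiableAt.comp (g := fun q : ℝ × (Fin n → ℂ) => ρ q.2 q.1) (f := fun s => (s, w₀)) (u w₀)
        hρ (differentiableAt_id.prodMk (differentiableAt_const w₀)) :
        DifferentiableAt ℝ (ρ w₀) (u w₀)).hasDerivAt
    rw [h1, hb, h2.ofReal_comp.deriv]
  have hmain := dz_congr (j := k) heq
  rw [hL, dz_mul (hρu.fun_pow n) hdet, hR, hpow, hchain, hG1, Matrix.det_one, hprod] at hmain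
  simp only [Finset.prod_const_one, inv_one, one_mul, mul_one] at hmain
  refine mul_left_cancel₀ (pow_ne_zero n hρ0) ?_
  rw [hmain]
  -- The exponent `n - 1` is a truncated subtraction, so `n = 0` is treated apart; all sums are then
  -- empty.
  rcases Nat.eq_zero_or_pos n with rfl | hn
  · simp
  · have : (ρ w₀ (u w₀) : ℂ) ^ n = (ρ w₀ (u w₀) : ℂ) ^ (n - 1) * (ρ w₀ (u w₀) : ℂ) := by
      rw [← pow_succ, Nat.sub_add_cancel hn]
    rw [this]
    field_simp

end Equation

variable {n : ℕ}

/-! ### The estimate at an interior maximum -/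

section Estimate

/-- An upper bound, in terms of `ε`, `KT`, for the trace of the metric and the squared gradient with
respect to `χ_u` at an interior maximum of the test function. -/
def traceBound (n : ℕ) (KT : ℝ) : ℝ := 4 * n * KT + 2 * (n + 2)

/-- The amplitude `A` of the weight `exp (A exp (-u))`. -/
def weightAmplitude (ε Ku Kρ K₀ K₁ K₂ KT KR : ℝ) : ℝ :=
  Real.exp Ku * (1 + 4 * (2 * (K₀ * KT + K₁ + K₂ + 2 * Kρ) + KR) / ε)

/-- The bound for the squared gradient at an interior maximum of the test function. -/
def interiorBound (n : ℕ) (ε Kρ K₀ KT : ℝ) : ℝ :=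
  max 1 (max (8 * K₀ ^ 2 / ε) (Kρ ^ n * (traceBound n KT / ε) ^ (n - 1) * traceBound n KT))

/-- The inequality of arithmetic and geometric means for the `1 / d i`. It lets the trace absorb the
factor `1/ρ` in the logarithmic derivative of the equation, which is unbounded as `ψ` tends to zero.
-/
theorem inv_le_sum_inv_div {ρ : ℝ} {d : Fin n → ℝ} (hn : 0 < n) (hρ : 0 < ρ) (hd : ∀ i, 0 < d i)
    (hprod : ∏ i, d i = ρ ^ n) : n * ρ⁻¹ ≤ ∑ i, (d i)⁻¹ := by
  have h := Real.geom_mean_le_arith_mean Finset.univ (fun _ : Fin n => (1 : ℝ))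
    (fun i => (d i)⁻¹) (fun _ _ => zero_le_one) (by simpa using hn)
    (fun i _ => (inv_pos.2 (hd i)).le)
  simp only [Real.rpow_one, Finset.prod_inv_distrib, hprod, Finset.sum_const, Finset.card_univ,
    Fintype.card_fin, nsmul_eq_mul, mul_one, one_mul] at h
  rw [← inv_pow, Real.pow_rpow_inv_natCast (inv_pos.2 hρ).le hn.ne'] at h
  rwa [le_div_iff₀ (by exact_mod_cast hn), mul_comm] at h

/-- Each `d i` equals `ρ ^ n` times the product of the other `n - 1` inverses, each at most `D / ε`.
This bounds `d i` from above using only an upper bound for `ρ`, and the weighted sum of the `y i`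
then controls the plain one. -/
theorem le_of_inv_sum_bounds {ρ Kρ S N D ε : ℝ} {d y : Fin n → ℝ} (hρ : 0 < ρ)
    (hρK : ρ ≤ Kρ) (hd : ∀ i, 0 < d i) (hprod : ∏ i, d i = ρ ^ n) (hy : ∀ i, 0 ≤ y i) (hε : 0 < ε)
    (hS : ∑ i, (d i)⁻¹ = S) (hN : ∑ i, (d i)⁻¹ * y i = N) (hSD : ε * S ≤ D) (hND : N ≤ D) :
    ∑ i, y i ≤ Kρ ^ n * (D / ε) ^ (n - 1) * D := by
  have hinv : ∀ i, 0 < (d i)⁻¹ := fun i => inv_pos.2 (hd i)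
  have hS0 : 0 ≤ S := hS ▸ Finset.sum_nonneg fun i _ => (hinv i).le
  have hN0 : 0 ≤ N := hN ▸ Finset.sum_nonneg fun i _ => mul_nonneg (hinv i).le (hy i)
  have hSD' : S ≤ D / ε := by rw [le_div_iff₀ hε]; linarith
  have hd_le : ∀ i, 1 ≤ Kρ ^ n * (D / ε) ^ (n - 1) * (d i)⁻¹ := fun i => by
    have h1 : ∏ j ∈ Finset.univ.erase i, (d j)⁻¹ ≤ S ^ (n - 1) := by
      calc ∏ j ∈ Finset.univ.erase i, (d j)⁻¹ ≤ ∏ j ∈ Finset.univ.erase i, S :=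
            Finset.prod_le_prod (fun j _ => (hinv j).le) fun j _ => hS ▸
              Finset.single_le_sum (f := fun j => (d j)⁻¹) (fun j _ => (hinv j).le)
                (Finset.mem_univ j)
        _ = S ^ (n - 1) := by simp [Finset.card_erase_of_mem]
    have h2 : (d i)⁻¹ * ∏ j ∈ Finset.univ.erase i, (d j)⁻¹ = (ρ ^ n)⁻¹ := by
      rw [Finset.mul_prod_erase Finset.univ (fun j => (d j)⁻¹) (Finset.mem_univ i),
        Finset.prod_inv_distrib, hprod]
    have h3 : 1 = ρ ^ n * ((d i)⁻¹ * ∏ j ∈ Finset.univ.erase i, (d j)⁻¹) := by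
      rw [h2, mul_inv_cancel₀ (pow_pos hρ n).ne']
    have h4 : ∏ j ∈ Finset.univ.erase i, (d j)⁻¹ ≤ (D / ε) ^ (n - 1) :=
      h1.trans (pow_le_pow_left₀ hS0 hSD' _)
    have h5 : ρ ^ n ≤ Kρ ^ n := pow_le_pow_left₀ hρ.le hρK n
    calc (1 : ℝ) = ρ ^ n * ((d i)⁻¹ * ∏ j ∈ Finset.univ.erase i, (d j)⁻¹) := h3
      _ ≤ Kρ ^ n * ((d i)⁻¹ * (D / ε) ^ (n - 1)) := by
        refine mul_le_mul h5 (mul_le_mul_of_nonneg_left h4 (hinv i).le) ?_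
          (pow_nonneg (hρ.le.trans hρK) n)
        exact mul_nonneg (hinv i).le (Finset.prod_nonneg fun j _ => (hinv j).le)
      _ = _ := by ring
  have hc : 0 ≤ Kρ ^ n * (D / ε) ^ (n - 1) :=
    mul_nonneg (pow_nonneg (hρ.le.trans hρK) _) (pow_nonneg (hS0.trans hSD') _)
  calc ∑ i, y i ≤ ∑ i, Kρ ^ n * (D / ε) ^ (n - 1) * ((d i)⁻¹ * y i) :=
        Finset.sum_le_sum fun i _ => by
          have := mul_le_mul_of_nonneg_right (hd_le i) (hy i)
          linarith
    _ = Kρ ^ n * (D / ε) ^ (n - 1) * N := by rw [← Finset.mul_sum, hN]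
    _ ≤ _ := mul_le_mul_of_nonneg_left hND hc

/-- The algebraic part of the estimate: `F`, `q`, `H`, `R` stand for the terms of
`second_order_inequality`. -/
theorem trace_bounds_of_inequalities {t W ε Kρ K₀ K₁ K₂ KT KR Z : ℝ} {d y F c x R : Fin n → ℝ}
    (hε : 0 < ε) (ht : 1 ≤ t) (htε : 4 * (2 * (K₀ * KT + K₁ + K₂ + 2 * Kρ) + KR) ≤ t * ε)
    (hW1 : 1 ≤ W) (hWK : 8 * K₀ ^ 2 ≤ ε * W) (hK₀ : 0 ≤ K₀) (hK₁ : 0 ≤ K₁)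
    (hKT : 0 ≤ KT) (hKρ : 0 ≤ Kρ)
    (hd : ∀ i, 0 < d i) (hy : ∀ i, 0 ≤ y i) (hysum : ∑ i, y i = W)
    (hineq : ∀ i, 2 * F i * W - 2 * t * W * (y i * d i - c i) + t * W ^ 2 * y i
      - t * W ^ 2 * (d i - x i) + W * R i ≤ 0)
    (hc : ∀ i, |c i| ≤ K₀ * √W * √(y i)) (hx : ∀ i, ε ≤ x i) (hR : ∀ i, -KR * W ≤ R i)
    (hF : ∑ i, (d i)⁻¹ * F i = Z)
    (hZ : -(n * KT * √W + (∑ i, (d i)⁻¹) * (K₀ * KT * √W + K₁ * √W + K₂ * W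
      + (Kρ * √W + Kρ * W))) ≤ Z) :
    ε * ∑ i, (d i)⁻¹ ≤ traceBound n KT ∧ ∑ i, (d i)⁻¹ * y i ≤ traceBound n KT := by
  have hinv : ∀ i, 0 < (d i)⁻¹ := fun i => inv_pos.2 (hd i)
  set S := ∑ i, (d i)⁻¹ with hS
  set N := ∑ i, (d i)⁻¹ * y i with hN
  have hS0 : 0 ≤ S := Finset.sum_nonneg fun i _ => (hinv i).le
  have hN0 : 0 ≤ N := Finset.sum_nonneg fun i _ => mul_nonneg (hinv i).le (hy i)
  have hW0 : 0 < W := by linarith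
  have hsW : √W ≤ W := by
    rw [Real.sqrt_le_left hW0.le]; nlinarith
  -- From `2 K₀ r ≤ r² / 2 + 2 K₀²` with `r² = W y i`. The first part uses up half of the good term
  -- `t W² y i`; the second is absorbed once `W` is large.
  have hcb : ∀ i, -(W * y i / 2 + 2 * K₀ ^ 2) ≤ 2 * c i := fun i => by
    have h1 := neg_le_of_abs_le (hc i)
    have h2 : (√W * √(y i)) ^ 2 = W * y i := by
      rw [mul_pow, Real.sq_sqrt hW0.le, Real.sq_sqrt (hy i)]
    nlinarith [sq_nonneg (√W * √(y i) - 2 * K₀)]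
  -- The inequality is divided by `W` and by `d i`. The bad terms `y i * d i` and `t W d i` lose
  -- their factor `d i`, so their sums over `i` are harmless.
  have hi : ∀ i, 2 * ((d i)⁻¹ * F i) - 2 * t * y i - t * (W * ((d i)⁻¹ * y i) / 2
      + 2 * K₀ ^ 2 * (d i)⁻¹) + t * W * ((d i)⁻¹ * y i) - t * W + t * W * ε * (d i)⁻¹
      - KR * W * (d i)⁻¹ ≤ 0 := fun i => by
    have e1 : (d i)⁻¹ * d i = 1 := inv_mul_cancel₀ (hd i).ne'
    have h1 : 2 * F i - 2 * t * (y i * d i - c i) + t * W * y i - t * W * (d i - x i) + R i ≤ 0 := by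
      have := hineq i
      refine nonpos_of_mul_nonpos_right (a := W) ?_ hW0
      linarith
    have h2 : 2 * F i - 2 * t * y i * d i - t * (W * y i / 2 + 2 * K₀ ^ 2) + t * W * y i - t * W * d i
        + t * W * ε - KR * W ≤ 0 := by
      have := mul_le_mul_of_nonneg_left (hcb i) (by linarith : 0 ≤ t)
      have := mul_le_mul_of_nonneg_left (hx i) (by positivity : 0 ≤ t * W)
      have := hR i
      linarith
    have h3 := mul_nonpos_of_nonneg_of_nonpos (hinv i).le h2
    refine le_of_eq_of_le ?_ h3
    linear_combination (2 * t * y i + t * W) * e1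
  have hsum := Finset.sum_nonpos fun i (_ : i ∈ Finset.univ) => hi i
  simp only [Finset.sum_add_distrib, Finset.sum_sub_distrib, ← Finset.mul_sum, ← Finset.sum_div,
    hF, hysum, ← hS, ← hN, Finset.sum_const, Finset.card_univ, Fintype.card_fin, nsmul_eq_mul] at hsum
  have hn0 : (0 : ℝ) ≤ n := Nat.cast_nonneg n
  have ht0 : 0 < t := by linarith
  have hZ' : -(n * KT * W + S * W * (K₀ * KT + K₁ + K₂ + 2 * Kρ)) ≤ Z := by
    refine le_trans (neg_le_neg ?_) hZ
    have h1 : K₀ * KT * √W + K₁ * √W + K₂ * W + (Kρ * √W + Kρ * W)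
        ≤ W * (K₀ * KT + K₁ + K₂ + 2 * Kρ) := by
      have := mul_le_mul_of_nonneg_left hsW (by positivity : 0 ≤ K₀ * KT + K₁ + Kρ)
      linarith
    have h2 := mul_le_mul_of_nonneg_left h1 hS0
    have h3 := mul_le_mul_of_nonneg_left hsW (by positivity : 0 ≤ n * KT)
    linarith
  -- `hK` and `hC` each use up a quarter of the good term `t W ε S`, and half of it remains in
  -- `key`. The constant `2 n KT + (n + 2)` there collects the trace of the torsion (through `hT`),
  -- the `n` terms `t W`, and `2 t ∑ y i = 2 t W`.
  have hK : t * S * (8 * K₀ ^ 2) ≤ t * S * (ε * W) := mul_le_mul_of_nonneg_left hWK (by positivity)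
  have hC : S * W * (4 * (2 * (K₀ * KT + K₁ + K₂ + 2 * Kρ) + KR)) ≤ S * W * (t * ε) :=
    mul_le_mul_of_nonneg_left htε (by positivity)
  have hT : W * (2 * n * KT) ≤ t * W * (2 * n * KT) :=
    mul_le_mul_of_nonneg_right (by nlinarith) (by positivity)
  have key : t * W * (N / 2 + ε * S / 2 - (2 * n * KT + (n + 2))) ≤ 0 := by linarith
  have key' := nonpos_of_mul_nonpos_right key (by positivity)
  have hεS : 0 ≤ ε * S := by positivity
  unfold traceBound
  constructor <;> linarith

end Estimate

variable {n : ℕ}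

/-! ### The weight and the gradient bound in adapted coordinates -/

section LocalEstimate

/-- The weight of the test function. -/
def weight (A s : ℝ) : ℝ := Real.exp (A * Real.exp (-s))

theorem weight_pos (A s : ℝ) : 0 < weight A s := Real.exp_pos _

theorem contDiff_weight (A : ℝ) {m : ℕ∞ω} : ContDiff ℝ m (weight A) := by
  unfold weight; fun_prop

theorem hasDerivAt_weight (A s : ℝ) :
    HasDerivAt (weight A) (-(A * Real.exp (-s)) * weight A s) s := by
  have := (((hasDerivAt_neg s).exp).const_mul A).exp
  refine this.congr_deriv ?_
  simp only [weight]; ring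

/-- The term linear in `A exp (-s)` comes from differentiating the inner exponential. A single
exponential would produce the square alone, which the first-order condition cancels. -/
theorem hasDerivAt_deriv_weight (A s : ℝ) :
    HasDerivAt (fun s => -(A * Real.exp (-s)) * weight A s)
      ((A * Real.exp (-s) + (A * Real.exp (-s)) ^ 2) * weight A s) s := by
  have := (((hasDerivAt_neg s).exp).const_mul A).fun_neg.fun_mul (hasDerivAt_weight A s)
  refine this.congr_deriv ?_
  ring

theorem vecNorm_one (X : Fin n → ℂ) : vecNorm 1 X = √(∑ i, ‖X i‖ ^ 2) := by
  simp only [vecNorm, Matrix.one_apply, ite_mul, one_mul, zero_mul, Finset.sum_ite_eq,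
    Finset.mem_univ, if_true, Complex.re_sum]
  congr 1
  refine Finset.sum_congr rfl fun i _ => ?_
  rw [← Complex.normSq_eq_norm_sq, Complex.star_def, Complex.mul_conj, Complex.ofReal_re]

theorem vecNorm_one_single (i : Fin n) : vecNorm 1 (Pi.single i (1 : ℂ)) = 1 := by
  rw [vecNorm_one, Finset.sum_eq_single i] <;> simp +contextual

theorem norm_le_vecNorm_one (X : Fin n → ℂ) (i : Fin n) : ‖X i‖ ≤ vecNorm 1 X := by
  rw [vecNorm_one]
  exact Real.le_sqrt_of_sq_le
    (Finset.single_le_sum (f := fun i => ‖X i‖ ^ 2) (fun _ _ => sq_nonneg _) (Finset.mem_univ i))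

/-- The gradient estimate at an interior maximum of the test function, in coordinates in which the
metric is the identity and `χ_u` is diagonal at that point. -/
theorem sum_norm_sq_dz_le_interiorBound {G : (Fin n → ℂ) → Matrix (Fin n) (Fin n) ℂ}
    {w₀ : Fin n → ℂ} {u : (Fin n → ℂ) → ℝ} {A : ℝ → (Fin n → ℂ) → Matrix (Fin n) (Fin n) ℂ}
    {d : Fin n → ℝ} {ρ : (Fin n → ℂ) → ℝ → ℝ} {ε Ku Kρ K₀ K₁ K₂ KT KR : ℝ} (hn : 0 < n)
    (hε : 0 < ε) (hK₀ : 0 ≤ K₀) (hK₁ : 0 ≤ K₁) (hK₂ : 0 ≤ K₂) (hKT : 0 ≤ KT)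
    (hKR : 0 ≤ KR)
    (hG : ∀ k l, ContDiffAt ℝ 2 (fun v => G v k l) w₀) (hG1 : G w₀ = 1)
    (hherm : ∀ᶠ v in 𝓝 w₀, ∀ k l, star (G v k l) = G v l k)
    (hu : ContDiffAt ℝ 4 u w₀) (huK : u w₀ ≤ Ku)
    (hA : ∀ k l, DifferentiableAt ℝ (fun q : ℝ × (Fin n → ℂ) => A q.1 q.2 k l) (u w₀, w₀))
    (hdiag : A (u w₀) w₀ + complexHessian (fun v => (u v : ℂ)) w₀
      = Matrix.diagonal fun i => (d i : ℂ)) (hd : ∀ i, 0 < d i)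
    (hρ : DifferentiableAt ℝ (fun q : ℝ × (Fin n → ℂ) => ρ q.2 q.1) (u w₀, w₀))
    (hρpos : 0 < ρ w₀ (u w₀))
    (heq : ∀ᶠ v in 𝓝 w₀, (A (u v) v + complexHessian (fun v => (u v : ℂ)) v).det
      = (ρ v (u v) : ℂ) ^ n * (G v).det)
    (hρK : ρ w₀ (u w₀) ≤ Kρ)
    (hρz : ∀ ξ : Fin n → ℂ, ‖∑ k, ξ k * dz k (fun v => (ρ v (u w₀) : ℂ)) w₀‖
      ≤ Kρ * vecNorm (G w₀) ξ)
    (hρs : |deriv (ρ w₀) (u w₀)| ≤ Kρ)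
    (hAε : (A (u w₀) w₀ - (ε : ℂ) • G w₀).PosSemidef)
    (hA₀ : FormBound (G w₀) (A (u w₀) w₀) K₀) (hA₁ : CovDerivBound G (A (u w₀)) w₀ K₁)
    (hA₂ : ((K₂ : ℂ) • G w₀
      - Matrix.of fun j k => deriv (fun s : ℝ => A s w₀ j k) (u w₀)).PosSemidef)
    (hT : TorsionBound G w₀ KT) (hR : BisectionalLowerBound G w₀ KR)
    (hmax : ∀ᶠ v in 𝓝 w₀, ∀ ξ : Fin n → ℂ,
      ‖∑ k, ξ k * dz k (fun v => (u v : ℂ)) v‖ ^ 2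
          * weight (weightAmplitude ε Ku Kρ K₀ K₁ K₂ KT KR) (u v)
        ≤ weight (weightAmplitude ε Ku Kρ K₀ K₁ K₂ KT KR) (u w₀)
          * (∑ k, ‖dz k (fun v => (u v : ℂ)) w₀‖ ^ 2)
          * (∑ k, ∑ l, G v k l * (ξ k * star (ξ l))).re) :
    ∑ k, ‖dz k (fun v => (u v : ℂ)) w₀‖ ^ 2 ≤ interiorBound n ε Kρ K₀ KT := by
  generalize hb' : (fun k => dz k (fun v => (u v : ℂ)) w₀) = b
  have hb : ∀ k, dz k (fun v => (u v : ℂ)) w₀ = b k := fun k => congrFun hb' k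
  simp only [hb] at hmax ⊢
  generalize hW' : ∑ k, ‖b k‖ ^ 2 = W at *
  have hW : ∑ k, star (b k) * b k = W := by
    rw [← hW']
    push_cast
    exact Finset.sum_congr rfl fun k _ => Complex.conj_mul' (b k)
  -- The entries of the maximum defining `interiorBound` play separate roles: `W > 1` gives `√W ≤
  -- W`, `W > 8 K₀² / ε` absorbs the error from `χ`, and the third entry is contradicted at the end.
  by_contra! hlt
  obtain ⟨hW1, hlt'⟩ := max_lt_iff.1 hlt
  obtain ⟨hWK, hWD⟩ := max_lt_iff.1 hlt'
  have hWpos : 0 < W := one_pos.trans hW1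
  set a := weightAmplitude ε Ku Kρ K₀ K₁ K₂ KT KR with ha
  set t := a * Real.exp (-u w₀) with ht
  have hKρ : 0 ≤ Kρ := hρpos.le.trans hρK
  have hC0 : 0 ≤ 4 * (2 * (K₀ * KT + K₁ + K₂ + 2 * Kρ) + KR) / ε := by positivity
  -- The factor `exp Ku` in the amplitude compensates `exp (-u)`, since `u ≤ Ku` at the point.
  have ht1 : 1 + 4 * (2 * (K₀ * KT + K₁ + K₂ + 2 * Kρ) + KR) / ε ≤ t := by
    have h1 : 1 ≤ Real.exp Ku * Real.exp (-u w₀) := by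
      rw [← Real.exp_add, Real.one_le_exp_iff]; linarith
    have h2 := mul_le_mul_of_nonneg_right h1 (add_nonneg zero_le_one hC0)
    rw [ht, ha, weightAmplitude]
    linarith
  have htε : 4 * (2 * (K₀ * KT + K₁ + K₂ + 2 * Kρ) + KR) ≤ t * ε := by
    rw [← div_le_iff₀ hε]; linarith
  set X : Fin n → ℂ := fun k => star (b k) with hX
  have hXn : vecNorm (G w₀) X = √W := by
    rw [hG1, vecNorm_one]; simp [hX, hW']
  have hsn : ∀ i : Fin n, vecNorm (G w₀) (Pi.single i (1 : ℂ)) = 1 := fun i => by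
    rw [hG1, vecNorm_one_single]
  set f : (Fin n → ℂ) → ℂ :=
    fun v => ∑ k, adaptedField G b w₀ k v * dz k (fun v => (u v : ℂ)) v with hf
  set c : Fin n → ℂ := fun i => ∑ k, star (b k) * A (u w₀) w₀ k i with hc
  set τ : Fin n → Fin n → ℂ := fun i k => ∑ l, torsion G w₀ k i l * star (b l) with hτ
  have hq : ∀ i, dzbar i f w₀ = star (b i) * d i - c i := fun i =>
    dzbar_adaptedField_deriv (hu.of_le (by norm_num)) hdiag i
  have hH : ∀ i, dz i (dzbar i fun v => (u v : ℂ)) w₀ = d i - A (u w₀) w₀ i i := fun i => by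
    have := congrFun₂ hdiag i i
    rw [Matrix.add_apply, Matrix.diagonal_apply_eq] at this
    rw [← this]; simp [complexHessian]
  have hineq := second_order_inequality hG hG1 hherm (hu.of_le (by norm_num))
    (weight_pos a (u w₀)) (contDiff_weight a) (hasDerivAt_weight a)
    rfl (hasDerivAt_deriv_weight a (u w₀)) hb hW hWpos hmax
  have hcn : ∀ i, ‖c i‖ ≤ K₀ * √W := fun i => by
    have := hA₀ X (Pi.single i 1)
    rw [hXn, hsn, mul_one] at this
    simpa [Pi.single_apply, hX, hc, mul_comm] using this
  have hτn : ∀ i, vecNorm (G w₀) (τ i) ≤ KT * √W := fun i => by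
    have := hT (Pi.single i 1) X
    rw [hXn, hsn, mul_one] at this
    simpa [Pi.single_apply, hX, hτ] using this
  have hτA : ∀ i, ‖∑ k, τ i k * A (u w₀) w₀ k i‖ ≤ K₀ * KT * √W := fun i => by
    have := hA₀ (τ i) (Pi.single i 1)
    rw [hsn, mul_one] at this
    have h2 := this.trans (mul_le_mul_of_nonneg_left (hτn i) hK₀)
    rw [← mul_assoc] at h2
    simpa [Pi.single_apply, mul_comm] using h2
  have hτi : ∀ i, ‖τ i i‖ ≤ KT * √W := fun i => by
    have := hτn i
    rw [hG1] at this
    exact (norm_le_vecNorm_one _ i).trans this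
  have hcov : ∀ i, ‖∑ k, covDeriv G (A (u w₀)) w₀ k i i * star (b k)‖ ≤ K₁ * √W := fun i => by
    have := hA₁ (Pi.single i 1) (Pi.single i 1) X
    rw [hXn, hsn, mul_one, mul_one] at this
    simpa [Pi.single_apply, hX] using this
  have hχε : ∀ i, ε ≤ (A (u w₀) w₀ i i).re := fun i => by
    have := (Complex.le_def.1 (hAε.diag_nonneg (i := i))).1
    simpa [hG1] using this
  have hχ₂ : ∀ i, (deriv (fun s : ℝ => A s w₀ i i) (u w₀)).re ≤ K₂ := fun i => by
    have := (Complex.le_def.1 (hA₂.diag_nonneg (i := i))).1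
    simpa [hG1] using this
  have hRi : ∀ i, -KR * W ≤ (∑ k, ∑ l, curvature G w₀ i i k l * star (b k) * b l).re := fun i => by
    have := hR (Pi.single i 1) X
    rw [hXn, hsn, Real.sq_sqrt hWpos.le] at this
    simpa [Pi.single_apply, hX] using this
  -- In the term with `∂_i g_{l ī}` the weight `1 / d i` cancels against `d i`. Together with the
  -- derivative of `log det g` from the equation it forms the trace of the torsion, which is bounded
  -- without the factor `∑ 1 / d i`.
  have hZc : ∑ i, ((d i)⁻¹ : ℂ) * dz i (dzbar i f) w₀
      = -∑ i, τ i i + ∑ i, ((d i)⁻¹ : ℂ) * (∑ k, τ i k * A (u w₀) w₀ k i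
          - ∑ k, covDeriv G (A (u w₀)) w₀ k i i * star (b k)
          - W * deriv (fun s => A s w₀ i i) (u w₀))
        + ((n * (ρ w₀ (u w₀))⁻¹ : ℝ) : ℂ) * (∑ k, X k * dz k (fun v => (ρ v (u w₀) : ℂ)) w₀
          + ((deriv (ρ w₀) (u w₀) * W : ℝ) : ℂ)) := by
    have h1 : ∀ i, ((d i)⁻¹ : ℂ) * dz i (dzbar i f) w₀
        = -(∑ l, dz i (fun v => G v l i) w₀ * star (b l))
          + ((d i)⁻¹ : ℂ) * (∑ k, τ i k * A (u w₀) w₀ k i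
          - ∑ k, covDeriv G (A (u w₀)) w₀ k i i * star (b k)
          - W * deriv (fun s => A s w₀ i i) (u w₀))
          + ∑ k, star (b k) * (((d i)⁻¹ : ℂ) * dz k
            (fun v => (A (u v) v + complexHessian (fun v => (u v : ℂ)) v) i i) w₀) := fun i => by
      have hdi : ((d i)⁻¹ : ℂ) * d i = 1 :=
        inv_mul_cancel₀ (by exact_mod_cast (hd i).ne')
      have h2 : ∑ k, star (b k) * (((d i)⁻¹ : ℂ) * dz k
            (fun v => (A (u v) v + complexHessian (fun v => (u v : ℂ)) v) i i) w₀)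
          = ((d i)⁻¹ : ℂ) * ∑ k, star (b k) * dz k
            (fun v => (A (u v) v + complexHessian (fun v => (u v : ℂ)) v) i i) w₀ := by
        rw [Finset.mul_sum]; exact Finset.sum_congr rfl fun k _ => by ring
      rw [hf, dz_dzbar_adaptedField_deriv hG1 hu hA hdiag hb, hW, h2]
      linear_combination (-∑ l, dz i (fun v => G v l i) w₀ * star (b l)) * hdi
    have h3 : ∑ i, ∑ k, star (b k) * (((d i)⁻¹ : ℂ) * dz k
            (fun v => (A (u v) v + complexHessian (fun v => (u v : ℂ)) v) i i) w₀)
        = ((n * (ρ w₀ (u w₀))⁻¹ : ℝ) : ℂ) * (∑ k, X k * dz k (fun v => (ρ v (u w₀) : ℂ)) w₀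
          + ((deriv (ρ w₀) (u w₀) * W : ℝ) : ℂ))
          + ∑ i, ∑ k, dz k (fun v => G v i i) w₀ * star (b k) := by
      rw [Finset.sum_comm]
      simp only [← Finset.mul_sum, sum_inv_mul_dz_eq hG1
        (fun k l => (hG k l).differentiableAt (by norm_num)) hu hA hdiag hd hb hρ hρpos heq]
      rw [Finset.sum_comm (f := fun i k => dz k (fun v => G v i i) w₀ * star (b k))]
      push_cast
      rw [← hW]
      simp only [mul_add, Finset.sum_add_distrib, Finset.mul_sum, hX]
      refine congrArg₂ _ (congrArg₂ _ ?_ ?_) ?_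
      · exact Finset.sum_congr rfl fun k _ => by ring
      · exact Finset.sum_congr rfl fun k _ => by ring
      · exact Finset.sum_congr rfl fun k _ => Finset.sum_congr rfl fun i _ => by ring
    have h4 : ∑ i, τ i i = ∑ i, ∑ l, dz i (fun v => G v l i) w₀ * star (b l)
        - ∑ i, ∑ k, dz k (fun v => G v i i) w₀ * star (b k) := by
      simp only [hτ, torsion, christoffel_of_eq_one hG1, sub_mul, Finset.sum_sub_distrib]
    rw [Finset.sum_congr rfl fun i _ => h1 i, Finset.sum_add_distrib, Finset.sum_add_distrib, h3, h4,
      Finset.sum_neg_distrib]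
    ring
  have hprod : ∏ i, d i = ρ w₀ (u w₀) ^ n := by
    have := heq.self_of_nhds
    rw [hdiag, hG1, Matrix.det_diagonal, Matrix.det_one, mul_one] at this
    exact_mod_cast this
  have hrS := inv_le_sum_inv_div hn hρpos hd hprod
  have hr0 : 0 ≤ n * (ρ w₀ (u w₀))⁻¹ := by positivity
  have hZre := congrArg Complex.re hZc
  simp only [← Complex.ofReal_inv, Complex.re_sum, Complex.add_re, Complex.neg_re,
    Complex.re_ofReal_mul, Complex.sub_re, Complex.ofReal_re] at hZre
  have hzle : ∀ z : ℂ, -‖z‖ ≤ z.re := fun z => neg_le_of_abs_le (Complex.abs_re_le_norm z)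
  have hb1 : -(n * KT * √W) ≤ -∑ i, (τ i i).re := by
    have : ∑ i, (τ i i).re ≤ ∑ _i : Fin n, KT * √W := Finset.sum_le_sum fun i _ =>
      (Complex.re_le_norm _).trans (hτi i)
    simp only [Finset.sum_const, Finset.card_univ, Fintype.card_fin, nsmul_eq_mul] at this
    linarith
  have hb2 : -((∑ i, (d i)⁻¹) * (K₀ * KT * √W + K₁ * √W + K₂ * W))
      ≤ ∑ i, (d i)⁻¹ * (∑ k, (τ i k * A (u w₀) w₀ k i).re
          - ∑ k, (covDeriv G (A (u w₀)) w₀ k i i * star (b k)).re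
          - W * (deriv (fun s => A s w₀ i i) (u w₀)).re) := by
    rw [Finset.sum_mul, ← Finset.sum_neg_distrib]
    refine Finset.sum_le_sum fun i _ => ?_
    rw [← mul_neg]
    refine mul_le_mul_of_nonneg_left ?_ (inv_pos.2 (hd i)).le
    have h1 := (neg_le_neg (hτA i)).trans (hzle _)
    have h2 := (Complex.re_le_norm _).trans (hcov i)
    have h3 := mul_le_mul_of_nonneg_left (hχ₂ i) hWpos.le
    rw [Complex.re_sum] at h1 h2
    linarith
  -- The factor `n / ρ` is exchanged for `∑ 1 / d i`; from here on no lower bound on `ψ` is needed.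
  have hb3 : -((∑ i, (d i)⁻¹) * (Kρ * √W + Kρ * W)) ≤ n * (ρ w₀ (u w₀))⁻¹ *
      (∑ k, (X k * dz k (fun v => (ρ v (u w₀) : ℂ)) w₀).re + deriv (ρ w₀) (u w₀) * W) := by
    have h1 := (neg_le_neg (hρz X)).trans (hzle _)
    rw [Complex.re_sum, hXn] at h1
    have h2 := mul_le_mul_of_nonneg_right (neg_le_of_abs_le hρs) hWpos.le
    have h3 : 0 ≤ Kρ * √W + Kρ * W := by positivity
    calc -((∑ i, (d i)⁻¹) * (Kρ * √W + Kρ * W))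
        ≤ -(n * (ρ w₀ (u w₀))⁻¹ * (Kρ * √W + Kρ * W)) :=
          neg_le_neg (mul_le_mul_of_nonneg_right hrS h3)
      _ = n * (ρ w₀ (u w₀))⁻¹ * (-(Kρ * √W) + -Kρ * W) := by ring
      _ ≤ _ := mul_le_mul_of_nonneg_left (add_le_add h1 h2) hr0
  have hbounds := trace_bounds_of_inequalities (n := n) (t := t) (W := W) (d := d)
    (y := fun i => ‖b i‖ ^ 2) (F := fun i => (dz i (dzbar i f) w₀).re)
    (c := fun i => (c i * b i).re) (x := fun i => (A (u w₀) w₀ i i).re)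
    (R := fun i => (∑ k, ∑ l, curvature G w₀ i i k l * star (b k) * b l).re)
    hε (by linarith) htε hW1.le (by rw [div_lt_iff₀ hε] at hWK; linarith) hK₀ hK₁ hKT hKρ hd
    (fun i => sq_nonneg _) hW' (fun i => by
      -- The term `2 |∂f/∂z̄_i|²` has the favourable sign and is discarded.
      refine le_trans (le_of_eq ?_) ((sub_le_self _ (by positivity :
        0 ≤ 2 * ‖dzbar i f w₀‖ ^ 2)).trans (hineq i))
      have h1 : (dzbar i f w₀ * b i).re = ‖b i‖ ^ 2 * d i - (c i * b i).re := by
        have : dzbar i f w₀ * b i = ((‖b i‖ ^ 2 * d i : ℝ) : ℂ) - c i * b i := by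
          rw [hq]
          push_cast
          rw [← Complex.conj_mul', ← Complex.star_def]
          ring
        rw [this, Complex.sub_re, Complex.ofReal_re]
      rw [h1, hH, Complex.sub_re, Complex.ofReal_re]
      ring)
    (fun i => by
      rw [Real.sqrt_sq (norm_nonneg _)]
      exact ((Complex.abs_re_le_norm _).trans (norm_mul_le _ _)).trans
        (mul_le_mul_of_nonneg_right (hcn i) (norm_nonneg _)))
    hχε hRi hZre (by linarith)
  have := le_of_inv_sum_bounds hρpos hρK hd hprod (fun i => sq_nonneg ‖b i‖) hε rfl rfl
    hbounds.1 hbounds.2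
  rw [hW'] at this
  exact hWD.not_ge this

end LocalEstimate

variable {n : ℕ}

/-! ### Simultaneous diagonalization -/

theorem exists_conjTranspose_mul_mul_eq_diagonal {A : Matrix (Fin n) (Fin n) ℂ} (hA : A.PosDef) :
    ∃ (U : Matrix (Fin n) (Fin n) ℂ) (d : Fin n → ℝ), U.conjTranspose * U = 1 ∧ (∀ i, 0 < d i) ∧
      U.conjTranspose * A * U = Matrix.diagonal fun i => (d i : ℂ) := by
  have hU := hA.isHermitian.conjStarAlgAut_star_eigenvectorUnitary
  set V := hA.isHermitian.eigenvectorUnitary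
  have hVV : (V : Matrix (Fin n) (Fin n) ℂ).conjTranspose * (V : Matrix (Fin n) (Fin n) ℂ) = 1 :=
    Matrix.mem_unitaryGroup_iff'.1 V.2
  refine ⟨V, hA.isHermitian.eigenvalues, hVV, hA.eigenvalues_pos, ?_⟩
  simpa [Unitary.conjStarAlgAut_apply] using! hU

/-- A unitary matrix followed by a rescaling turns `G` into the identity. A second unitary matrix
diagonalizes the transformed `A` and leaves the identity unchanged. -/
theorem exists_simultaneous_diagonalization {G A : Matrix (Fin n) (Fin n) ℂ} (hG : G.PosDef)
    (hA : A.PosDef) : ∃ (Q : Matrix (Fin n) (Fin n) ℂ) (d : Fin n → ℝ), IsUnit Q ∧ (∀ i, 0 < d i) ∧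
      Q.conjTranspose * G * Q = 1 ∧
      Q.conjTranspose * A * Q = Matrix.diagonal fun i => (d i : ℂ) := by
  obtain ⟨V, l, hV, hl, hVG⟩ := exists_conjTranspose_mul_mul_eq_diagonal hG
  set D : Matrix (Fin n) (Fin n) ℂ := Matrix.diagonal fun i => (((√(l i))⁻¹ : ℝ) : ℂ) with hD
  have hDh : D.conjTranspose = D := by
    rw [hD, Matrix.diagonal_conjTranspose]
    congr 1; ext i; exact Complex.conj_ofReal _
  have hV1 : IsUnit V := IsUnit.of_mul_eq_one_right _ hV
  have hD1 : IsUnit D := by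
    rw [Matrix.isUnit_iff_isUnit_det, hD, Matrix.det_diagonal, isUnit_iff_ne_zero,
      Finset.prod_ne_zero_iff]
    intro i _
    have := Real.sqrt_pos.2 (hl i)
    exact_mod_cast (inv_pos.2 this).ne'
  have hP1 : IsUnit (V * D) := hV1.mul hD1
  have hPG : (V * D).conjTranspose * G * (V * D) = 1 := by
    rw [Matrix.conjTranspose_mul, hDh]
    have : D * V.conjTranspose * G * (V * D) = D * (V.conjTranspose * G * V) * D := by
      simp only [Matrix.mul_assoc]
    rw [this, hVG, hD, Matrix.diagonal_mul_diagonal, Matrix.diagonal_mul_diagonal,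
      ← Matrix.diagonal_one]
    congr 1; ext i
    have h1 := Real.sqrt_pos.2 (hl i)
    have h2 : (√(l i))⁻¹ * l i * (√(l i))⁻¹ = 1 := by
      nth_rewrite 2 [← Real.mul_self_sqrt (hl i).le]
      field_simp
    exact_mod_cast h2
  have hinj : Function.Injective (V * D).mulVec := Matrix.mulVec_injective_of_isUnit hP1
  obtain ⟨U, d, hU, hd, hUA⟩ :=
    exists_conjTranspose_mul_mul_eq_diagonal (hA.conjTranspose_mul_mul_same hinj)
  refine ⟨V * D * U, d, hP1.mul (IsUnit.of_mul_eq_one_right _ hU), hd, ?_, ?_⟩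
  · have : (V * D * U).conjTranspose * G * (V * D * U)
        = U.conjTranspose * ((V * D).conjTranspose * G * (V * D)) * U := by
      rw [Matrix.conjTranspose_mul (V * D)]; simp only [Matrix.mul_assoc]
    rw [this, hPG, Matrix.mul_one, hU]
  · have : (V * D * U).conjTranspose * A * (V * D * U)
        = U.conjTranspose * ((V * D).conjTranspose * A * (V * D)) * U := by
      rw [Matrix.conjTranspose_mul (V * D)]; simp only [Matrix.mul_assoc]
    rw [this, hUA]

/-! ### The complex Hessian under complex linear maps -/

theorem fderiv_comp_linear {f : (Fin n → ℂ) → ℂ} {L : (Fin n → ℂ) →L[ℂ] (Fin n → ℂ)}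
    {w : Fin n → ℂ} (hf : DifferentiableAt ℝ f (L w)) (v : Fin n → ℂ) :
    fderiv ℝ (fun x => f (L x)) w v = fderiv ℝ f (L w) (L v) := by
  have := (hf.hasFDerivAt.comp w (L.restrictScalars ℝ).hasFDerivAt).fderiv
  simp only [Function.comp_def] at this
  rw [this]; rfl

theorem dz_comp_linear {f : (Fin n → ℂ) → ℂ} {L : (Fin n → ℂ) →L[ℂ] (Fin n → ℂ)}
    {w : Fin n → ℂ} (hf : DifferentiableAt ℝ f (L w)) (j : Fin n) :
    dz j (fun x => f (L x)) w = ∑ a, L (Pi.single j 1) a * dz a f (L w) := by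
  have hI : (Pi.single j Complex.I : Fin n → ℂ) = Complex.I • (Pi.single j 1 : Fin n → ℂ) := by
    rw [← Pi.single_smul, smul_eq_mul, mul_one]
  rw [sum_mul_dz, dz, fderiv_comp_linear hf, fderiv_comp_linear hf, hI, map_smul]

theorem dzbar_comp_linear {f : (Fin n → ℂ) → ℂ} {L : (Fin n → ℂ) →L[ℂ] (Fin n → ℂ)}
    {w : Fin n → ℂ} (hf : DifferentiableAt ℝ f (L w)) (j : Fin n) :
    dzbar j (fun x => f (L x)) w = ∑ a, star (L (Pi.single j 1) a) * dzbar a f (L w) := by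
  have h := dz_comp_linear (f := fun v => star (f v)) (L := L) (w := w) hf.star j
  rw [dz_star, star_eq_iff_star_eq] at h
  rw [← h, star_sum]
  exact Finset.sum_congr rfl fun a _ => by rw [star_mul', dz_star, star_star]

/-- A complex linear map does not mix `∂` and `∂̄` and has constant coefficients, so the Hessian
transforms as a sesquilinear form without first-order terms. -/
theorem complexHessian_comp_linear {f : (Fin n → ℂ) → ℂ} {L : (Fin n → ℂ) →L[ℂ] (Fin n → ℂ)}
    {w : Fin n → ℂ} (hf : ContDiffAt ℝ 2 f (L w)) (j k : Fin n) :
    complexHessian (fun x => f (L x)) w j k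
      = ∑ a, ∑ c, complexHessian f (L w) a c * L (Pi.single j 1) a * star (L (Pi.single k 1) c) := by
  have hL : Tendsto L (𝓝 w) (𝓝 (L w)) := L.continuous.continuousAt
  have he : dzbar k (fun x => f (L x)) =ᶠ[𝓝 w]
      fun x => ∑ c, star (L (Pi.single k 1) c) * dzbar c f (L x) := by
    filter_upwards [hL.eventually (hf.eventually (by simp))] with v hv
    exact dzbar_comp_linear (hv.differentiableAt (by norm_num)) k
  have hd : ∀ c, DifferentiableAt ℝ (dzbar c f) (L w) := fun c =>
    (contDiffAt_dzbar (m := 1) hf).differentiableAt (by norm_num)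
  have hd' : ∀ c, DifferentiableAt ℝ (fun x => dzbar c f (L x)) w := fun c =>
    (hd c).comp w (L.restrictScalars ℝ).differentiableAt
  simp only [complexHessian, Matrix.of_apply]
  rw [dz_congr he, dz_sum _ fun c _ => (hd' c).const_mul _, Finset.sum_comm]
  refine Finset.sum_congr rfl fun c _ => ?_
  rw [dz_const_mul _ (hd' c), dz_comp_linear (hd c), Finset.mul_sum]
  exact Finset.sum_congr rfl fun a _ => by ring

section ManifoldPart

variable {E : Type*} [NormedAddCommGroup E] [NormedSpace ℝ E] {H : Type*} [TopologicalSpace H]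
  {I : ModelWithCorners ℝ E H} {M : Type*} [TopologicalSpace M] [ChartedSpace H M]
  {n : ℕ}

/-! ### Gradients and the dual norm -/

section GradNorm

/-- Identifies the supremum that defines `gradNorm` with a dual norm. One-sided values suffice
because the unit ball is symmetric. -/
theorem sSup_unitBall_eq_norm {V : Type*} [SeminormedAddCommGroup V] [NormedSpace ℝ V]
    (l : V →L[ℝ] ℝ) : sSup {r : ℝ | ∃ v, ‖v‖ ^ 2 ≤ 1 ∧ r = l v} = ‖l‖ := by
  have hbdd : ∀ v, ‖v‖ ^ 2 ≤ 1 → l v ≤ ‖l‖ := fun v hv => by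
    rw [sq_le_one_iff₀ (norm_nonneg v)] at hv
    calc l v ≤ ‖l v‖ := Real.le_norm_self _
      _ ≤ ‖l‖ * ‖v‖ := l.le_opNorm v
      _ ≤ ‖l‖ := mul_le_of_le_one_right (norm_nonneg _) hv
  have hB : BddAbove {r : ℝ | ∃ v, ‖v‖ ^ 2 ≤ 1 ∧ r = l v} := by
    refine ⟨‖l‖, ?_⟩
    rintro r ⟨v, hv, rfl⟩
    exact hbdd v hv
  have hunit : ∀ v, ‖v‖ ≤ 1 → l v ≤ sSup {r : ℝ | ∃ v, ‖v‖ ^ 2 ≤ 1 ∧ r = l v} := fun v hv =>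
    le_csSup hB ⟨v, pow_le_one₀ (norm_nonneg v) hv, rfl⟩
  refine le_antisymm (csSup_le ⟨0, 0, by simp, by simp⟩ ?_)
    (ContinuousLinearMap.opNorm_le_of_unit_norm ?_ fun v hv => ?_)
  · rintro r ⟨v, hv, rfl⟩
    exact hbdd v hv
  · simpa using hunit 0 (by simp)
  · rw [Real.norm_eq_abs, abs_le']
    refine ⟨hunit v hv.le, ?_⟩
    have := hunit (-v) (by simpa using hv.le)
    rwa [map_neg] at this

variable (I) in
/-- The differential of a real function. -/
def realDiff (f : M → ℝ) (p : M) : TangentSpace I p →L[ℝ] ℝ := mfderiv I 𝓘(ℝ, ℝ) f p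

variable [IsManifold I ∞ M] (S : HermitianStructure I M n)

theorem HermitianStructure.gradNorm_eq_opNorm (f : M → ℝ) (p : M) :
    letI : RiemannianBundle (fun p : M => TangentSpace I p) := ⟨S.g.toRiemannianMetric⟩
    S.gradNorm f p = (√2)⁻¹ * ‖realDiff I f p‖ := by
  let _ : RiemannianBundle (fun p : M => TangentSpace I p) := ⟨S.g.toRiemannianMetric⟩
  have hg : ∀ v : TangentSpace I p, ‖v‖ ^ 2 = S.g.inner p v v := fun v =>
    (real_inner_self_eq_norm_sq v).symm
  have := sSup_unitBall_eq_norm (realDiff I f p)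
  simp only [hg] at this
  rw [← this]
  rfl

theorem HermitianStructure.gradNorm_nonneg (f : M → ℝ) (p : M) : 0 ≤ S.gradNorm f p := by
  exact mul_nonneg (by positivity)
    (Real.sSup_nonneg' ⟨0, ⟨0, by simp, (map_zero (realDiff I f p)).symm⟩, le_rfl⟩)

theorem HermitianStructure.abs_realDiff_le (f : M → ℝ) (p : M) (v : TangentSpace I p) :
    |realDiff I f p v| ≤ √2 * S.gradNorm f p * √(S.g.inner p v v) := by
  let _ : RiemannianBundle (fun p : M => TangentSpace I p) := ⟨S.g.toRiemannianMetric⟩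
  have hg : S.g.inner p v v = ‖v‖ ^ 2 := real_inner_self_eq_norm_sq v
  rw [S.gradNorm_eq_opNorm, hg, Real.sqrt_sq (norm_nonneg v), ← mul_assoc √2,
    mul_inv_cancel₀ (by positivity), one_mul]
  exact (realDiff I f p).le_opNorm v

theorem HermitianStructure.gradNorm_le {f : M → ℝ} {p : M} {C : ℝ} (hC : 0 ≤ C)
    (h : ∀ v : TangentSpace I p, realDiff I f p v ≤ √2 * C * √(S.g.inner p v v)) :
    S.gradNorm f p ≤ C := by
  unfold HermitianStructure.gradNorm
  rw [inv_mul_le_iff₀ (by positivity)]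
  refine csSup_le ⟨0, 0, by simp, (map_zero (realDiff I f p)).symm⟩ ?_
  rintro r ⟨v, hv, rfl⟩
  exact (h v).trans (mul_le_of_le_one_right (by positivity) (Real.sqrt_le_one.2 hv))

end GradNorm

/-! ### Holomorphic charts -/

section Charts

variable (I) in
/-- The differential of an inverse chart. -/
def paramDiff (φ : (Fin n → ℂ) → M) (w : Fin n → ℂ) : (Fin n → ℂ) →L[ℝ] TangentSpace I (φ w) :=
  mfderiv 𝓘(ℝ, Fin n → ℂ) I φ w

variable (I) in
/-- The differential of a chart at the point with coordinates `w`. -/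
def coordDiff (e : OpenPartialHomeomorph M (Fin n → ℂ)) (w : Fin n → ℂ) :
    TangentSpace I (e.symm w) →L[ℝ] (Fin n → ℂ) :=
  mfderiv I 𝓘(ℝ, Fin n → ℂ) e (e.symm w)

variable {J : ∀ p : M, TangentSpace I p →L[ℝ] TangentSpace I p}
  {e : OpenPartialHomeomorph M (Fin n → ℂ)} (he : IsHolomorphicChart I J e)
include he

theorem IsHolomorphicChart.mdifferentiableAt {p : M} (hp : p ∈ e.source) :
    MDifferentiableAt I 𝓘(ℝ, Fin n → ℂ) e p :=
  (he.contMDiffOn.contMDiffAt (e.open_source.mem_nhds hp)).mdifferentiableAt (by simp)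

theorem IsHolomorphicChart.contMDiffAt_symm {w : Fin n → ℂ} (hw : w ∈ e.target) :
    ContMDiffAt 𝓘(ℝ, Fin n → ℂ) I ∞ e.symm w :=
  he.contMDiffOn_symm.contMDiffAt (e.open_target.mem_nhds hw)

theorem IsHolomorphicChart.mdifferentiableAt_symm {w : Fin n → ℂ} (hw : w ∈ e.target) :
    MDifferentiableAt 𝓘(ℝ, Fin n → ℂ) I e.symm w :=
  (he.contMDiffAt_symm hw).mdifferentiableAt (by simp)

theorem IsHolomorphicChart.paramDiff_coordDiff {w : Fin n → ℂ} (hw : w ∈ e.target)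
    (v : TangentSpace I (e.symm w)) : paramDiff I e.symm w (coordDiff I e w v) = v := by
  have hp := e.map_target hw
  have h1 : e.symm ∘ e =ᶠ[𝓝 (e.symm w)] id := e.eventually_left_inverse hp
  have h2 := HasMFDerivAt.comp (I'' := I) (e.symm w)
    (by rw [e.right_inv hw]; exact (he.mdifferentiableAt_symm hw).hasMFDerivAt)
    (he.mdifferentiableAt hp).hasMFDerivAt
  have h3 := hasMFDerivAt_unique (h2.congr_of_eventuallyEq h1.symm) (hasMFDerivAt_id _)
  exact congrArg (fun L : E →L[ℝ] E => L v) h3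

theorem IsHolomorphicChart.coordDiff_paramDiff {w : Fin n → ℂ} (hw : w ∈ e.target)
    (ξ : Fin n → ℂ) : coordDiff I e w (paramDiff I e.symm w ξ) = ξ := by
  have hp := e.map_target hw
  have h1 : e ∘ e.symm =ᶠ[𝓝 w] id := e.eventually_right_inverse hw
  have h2 := HasMFDerivAt.comp (I'' := 𝓘(ℝ, Fin n → ℂ)) w
    (he.mdifferentiableAt hp).hasMFDerivAt (he.mdifferentiableAt_symm hw).hasMFDerivAt
  have h3 := hasMFDerivAt_unique (h2.congr_of_eventuallyEq h1.symm) (hasMFDerivAt_id _)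
  exact congrArg (fun L : (Fin n → ℂ) →L[ℝ] (Fin n → ℂ) => L ξ) h3

theorem IsHolomorphicChart.paramDiff_I_smul {w : Fin n → ℂ} (hw : w ∈ e.target)
    (ξ : Fin n → ℂ) :
    paramDiff I e.symm w (Complex.I • ξ) = J (e.symm w) (paramDiff I e.symm w ξ) := by
  rw [← he.paramDiff_coordDiff hw (J (e.symm w) (paramDiff I e.symm w ξ))]
  congr 1
  ext j
  have := he.holomorphic (e.symm w) (e.map_target hw) (paramDiff I e.symm w ξ) j
  have h2 := congrFun (he.coordDiff_paramDiff hw ξ) j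
  change (Complex.I • ξ) j = _
  refine Eq.trans ?_ this.symm
  rw [Pi.smul_apply, smul_eq_mul]
  exact congrArg _ h2.symm

theorem IsHolomorphicChart.fderiv_comp_symm {f : M → ℝ} {w : Fin n → ℂ} (hw : w ∈ e.target)
    (hf : MDifferentiableAt I 𝓘(ℝ, ℝ) f (e.symm w)) (ξ : Fin n → ℂ) :
    fderiv ℝ (fun v => f (e.symm v)) w ξ = realDiff I f (e.symm w) (paramDiff I e.symm w ξ) := by
  have h2 : HasMFDerivAt 𝓘(ℝ, Fin n → ℂ) 𝓘(ℝ, ℝ) (fun v => f (e.symm v)) w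
      ((realDiff I f (e.symm w)).comp (paramDiff I e.symm w)) :=
    HasMFDerivAt.comp (I'' := 𝓘(ℝ, ℝ)) w hf.hasMFDerivAt
      (he.mdifferentiableAt_symm hw).hasMFDerivAt
  have h3 : HasFDerivAt (fun v => f (e.symm v))
      ((realDiff I f (e.symm w)).comp (paramDiff I e.symm w)) w := h2.hasFDerivAt
  rw [h3.fderiv]
  rfl

end Charts

/-! ### Components of bilinear forms -/

/-- Expansion in the real frame `X_j, Y_j`. No symmetry or `J`-invariance of `B` is used, so the
formula serves for the metric and for `χ` alike. -/
theorem sum_mixedComponent {φ : (Fin n → ℂ) → M}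
    (B : ∀ p : M, TangentSpace I p →L[ℝ] TangentSpace I p →L[ℝ] ℝ) (w ξ η : Fin n → ℂ) :
    ∑ j, ∑ k, mixedComponent I φ B w j k * ξ j * star (η k)
      = (((B (φ w) (paramDiff I φ w ξ) (paramDiff I φ w η)
          + B (φ w) (paramDiff I φ w (Complex.I • ξ)) (paramDiff I φ w (Complex.I • η)) : ℝ) : ℂ)
        + Complex.I * ((B (φ w) (paramDiff I φ w ξ) (paramDiff I φ w (Complex.I • η))
          - B (φ w) (paramDiff I φ w (Complex.I • ξ)) (paramDiff I φ w η) : ℝ) : ℂ)) / 4 := by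
  have expand : ∀ ζ : Fin n → ℂ, paramDiff I φ w ζ
      = ∑ k, ((ζ k).re • paramDiff I φ w (Pi.single k 1 : Fin n → ℂ)
      + (ζ k).im • paramDiff I φ w (Pi.single k Complex.I : Fin n → ℂ)) := fun ζ => by
    simp only [← map_smul, ← map_add, ← map_sum]
    congr 1
    ext i
    simp only [Finset.sum_apply, Pi.add_apply, Pi.smul_apply, Pi.single_apply]
    simp only [smul_ite, smul_zero, Finset.sum_add_distrib, Finset.sum_ite_eq, Finset.mem_univ,
      if_true, Complex.real_smul, mul_one, Complex.re_add_im]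
  rw [expand ξ, expand η, expand (Complex.I • ξ), expand (Complex.I • η)]
  simp only [map_sum, sum_apply]
  push_cast
  simp only [Finset.mul_sum, ← Finset.sum_add_distrib, ← Finset.sum_sub_distrib, Finset.sum_div]
  rw [Finset.sum_comm]
  refine Finset.sum_congr rfl fun k _ => Finset.sum_congr rfl fun j _ => ?_
  have hm : mixedComponent I φ B w j k
      = (((B (φ w) (paramDiff I φ w (Pi.single j 1)) (paramDiff I φ w (Pi.single k 1))
          + B (φ w) (paramDiff I φ w (Pi.single j Complex.I))
            (paramDiff I φ w (Pi.single k Complex.I)) : ℝ) : ℂ)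
        + Complex.I * ((B (φ w) (paramDiff I φ w (Pi.single j 1))
            (paramDiff I φ w (Pi.single k Complex.I))
          - B (φ w) (paramDiff I φ w (Pi.single j Complex.I))
            (paramDiff I φ w (Pi.single k 1)) : ℝ) : ℂ)) / 4 := rfl
  rw [hm]
  simp only [map_add, map_smul, add_apply, smul_apply, smul_eq_mul, Pi.smul_apply, Complex.mul_re,
    Complex.mul_im, Complex.I_re, Complex.I_im]
  generalize B (φ w) (paramDiff I φ w (Pi.single j 1)) (paramDiff I φ w (Pi.single k 1)) = b₁
  generalize B (φ w) (paramDiff I φ w (Pi.single j 1)) (paramDiff I φ w (Pi.single k Complex.I)) = b₂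
  generalize B (φ w) (paramDiff I φ w (Pi.single j Complex.I)) (paramDiff I φ w (Pi.single k 1)) = b₃
  generalize B (φ w) (paramDiff I φ w (Pi.single j Complex.I))
    (paramDiff I φ w (Pi.single k Complex.I)) = b₄
  apply Complex.ext <;> simp <;> ring

end ManifoldPart

section ManifoldPart

variable {E : Type*} [NormedAddCommGroup E] [NormedSpace ℝ E] {H : Type*} [TopologicalSpace H]
  {I : ModelWithCorners ℝ E H} {M : Type*} [TopologicalSpace M] [ChartedSpace H M]
  {n : ℕ} [IsManifold I ∞ M] (S : HermitianStructure I M n)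
  {e : OpenPartialHomeomorph M (Fin n → ℂ)} {w : Fin n → ℂ}

/-! ### The metric in a holomorphic chart -/

theorem HermitianStructure.inner_J_left (p : M) (v v' : TangentSpace I p) :
    S.g.inner p (S.J p v) v' = -S.g.inner p v (S.J p v') := by
  rw [← S.hermitian p (S.J p v) v', S.J_J, map_neg, neg_apply]

theorem HermitianStructure.inner_self_J (p : M) (v : TangentSpace I p) :
    S.g.inner p v (S.J p v) = 0 := by
  have h := S.inner_J_left p v v
  rw [S.g.symm] at h
  linarith

/-- The cross terms vanish because `g(v, Jv) = 0`, and the two diagonal terms agree because `J` is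
an isometry. The resulting factor `1 / 2` matches the normalization of `gradNorm`. -/
theorem HermitianStructure.sum_metricMatrix (he : IsHolomorphicChart I S.J e) (hw : w ∈ e.target)
    (ξ : Fin n → ℂ) : ∑ j, ∑ k, S.metricMatrix e w j k * ξ j * star (ξ k)
      = ((S.g.inner (e.symm w) (paramDiff I e.symm w ξ) (paramDiff I e.symm w ξ) / 2 : ℝ) : ℂ) := by
  have h := sum_mixedComponent (I := I) (φ := e.symm) S.g.inner w ξ ξ
  rw [he.paramDiff_I_smul hw, S.hermitian, S.inner_J_left, S.inner_self_J] at h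
  refine h.trans ?_
  push_cast
  ring

theorem HermitianStructure.star_metricMatrix (e : OpenPartialHomeomorph M (Fin n → ℂ))
    (w : Fin n → ℂ) (j k : Fin n) : star (S.metricMatrix e w j k) = S.metricMatrix e w k j := by
  simp only [metricMatrix, Matrix.of_apply, mixedComponent]
  rw [S.g.symm _ (mfderiv 𝓘(ℝ, Fin n → ℂ) I e.symm w (Pi.single j 1 : Fin n → ℂ))
      (mfderiv 𝓘(ℝ, Fin n → ℂ) I e.symm w (Pi.single k 1 : Fin n → ℂ)),
    S.g.symm _ (mfderiv 𝓘(ℝ, Fin n → ℂ) I e.symm w (Pi.single j Complex.I : Fin n → ℂ))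
      (mfderiv 𝓘(ℝ, Fin n → ℂ) I e.symm w (Pi.single k Complex.I : Fin n → ℂ)),
    S.g.symm _ (mfderiv 𝓘(ℝ, Fin n → ℂ) I e.symm w (Pi.single j Complex.I : Fin n → ℂ))
      (mfderiv 𝓘(ℝ, Fin n → ℂ) I e.symm w (Pi.single k 1 : Fin n → ℂ)),
    S.g.symm _ (mfderiv 𝓘(ℝ, Fin n → ℂ) I e.symm w (Pi.single j 1 : Fin n → ℂ))
      (mfderiv 𝓘(ℝ, Fin n → ℂ) I e.symm w (Pi.single k Complex.I : Fin n → ℂ))]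
  simp only [Complex.star_def, map_div₀, map_add, map_mul, Complex.conj_ofReal, Complex.conj_I,
    map_ofNat]
  push_cast
  ring

theorem HermitianStructure.metricMatrix_posDef (he : IsHolomorphicChart I S.J e)
    (hw : w ∈ e.target) : (S.metricMatrix e w).PosDef := by
  have hh : (S.metricMatrix e w).IsHermitian :=
    Matrix.IsHermitian.ext fun i j => S.star_metricMatrix e w j i
  -- The conjugate sits on the second index in `g_{j k̄} ξ_j ξ̄_k`, but on the first in the
  -- quadratic form that defines `PosDef`.
  rw [← Matrix.PosDef.transpose_iff]
  refine Matrix.PosDef.of_dotProduct_mulVec_pos hh.transpose fun ξ hξ => ?_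
  have h : star ξ ⬝ᵥ (S.metricMatrix e w).transpose.mulVec ξ
      = ∑ j, ∑ k, S.metricMatrix e w j k * ξ j * star (ξ k) := by
    rw [Finset.sum_comm]
    simp only [dotProduct, Matrix.mulVec, Matrix.transpose_apply, Finset.mul_sum, Pi.star_apply]
    exact Finset.sum_congr rfl fun _ _ => Finset.sum_congr rfl fun _ _ => by ring
  rw [h, S.sum_metricMatrix he hw]
  have hv : paramDiff I e.symm w ξ ≠ 0 := fun h0 => hξ <| by
    rw [← he.coordDiff_paramDiff hw ξ, h0, map_zero]
  have := S.g.pos _ _ hv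
  exact_mod_cast half_pos this

theorem HermitianStructure.vecNorm_metricMatrix (he : IsHolomorphicChart I S.J e)
    (hw : w ∈ e.target) (ξ : Fin n → ℂ) : vecNorm (S.metricMatrix e w) ξ
      = √(S.g.inner (e.symm w) (paramDiff I e.symm w ξ) (paramDiff I e.symm w ξ) / 2) := by
  rw [vecNorm, S.sum_metricMatrix he hw, Complex.ofReal_re]

/-- The left side is half the modulus of `a - i b` with `a = df(V)` and `b = df(JV)`. As `V` and
`JV` are orthogonal and of equal length, evaluating `df` on `a V + b JV` bounds this modulus by the
dual norm. -/
theorem HermitianStructure.norm_sum_mul_dz_le (he : IsHolomorphicChart I S.J e)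
    (hw : w ∈ e.target) {f : M → ℝ} (hf : MDifferentiableAt I 𝓘(ℝ, ℝ) f (e.symm w))
    (ξ : Fin n → ℂ) : ‖∑ k, ξ k * dz k (fun v => (f (e.symm v) : ℂ)) w‖
      ≤ S.gradNorm f (e.symm w) * vecNorm (S.metricMatrix e w) ξ := by
  have hd : DifferentiableAt ℝ (fun v => f (e.symm v)) w :=
    (hf.comp w (he.mdifferentiableAt_symm hw)).differentiableAt
  rw [S.vecNorm_metricMatrix he hw, sum_mul_dz, fderiv_ofReal_comp hd, fderiv_ofReal_comp hd,
    he.fderiv_comp_symm hw hf, he.fderiv_comp_symm hw hf, he.paramDiff_I_smul hw]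
  set V := paramDiff I e.symm w ξ
  set a := realDiff I f (e.symm w) V with ha
  set b := realDiff I f (e.symm w) (S.J (e.symm w) V) with hb
  set N := S.gradNorm f (e.symm w)
  set γ := S.g.inner (e.symm w) V V with hγ
  have hγ0 : 0 ≤ γ := by
    by_cases h : V = 0
    · simp [hγ, h]
    · exact (S.g.pos (e.symm w) V h).le
  have hN : 0 ≤ N := S.gradNorm_nonneg f (e.symm w)
  set r := √(a ^ 2 + b ^ 2) with hr
  have hr2 : r ^ 2 = a ^ 2 + b ^ 2 := Real.sq_sqrt (by positivity)
  have hnorm : ‖((a : ℂ) - Complex.I * b) / 2‖ = r / 2 := by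
    have h1 : ((a : ℂ) - Complex.I * b) = (a : ℂ) + ((-b : ℝ) : ℂ) * Complex.I := by
      push_cast; ring
    rw [norm_div, h1, Complex.norm_add_mul_I, neg_sq]
    simp [hr]
  have h1 := S.abs_realDiff_le f (e.symm w) (a • V + b • S.J (e.symm w) V)
  have h2 : realDiff I f (e.symm w) (a • V + b • S.J (e.symm w) V) = r ^ 2 := by
    rw [map_add, map_smul, map_smul, ← ha, ← hb, hr2, smul_eq_mul, smul_eq_mul]; ring
  have h3 : S.g.inner (e.symm w) (a • V + b • S.J (e.symm w) V) (a • V + b • S.J (e.symm w) V) = r ^ 2 * γ := by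
    simp only [map_add, map_smul, add_apply, smul_apply, smul_eq_mul, S.hermitian,
      S.inner_J_left, S.inner_self_J, ← hγ, hr2]
    ring
  rw [h2, h3, abs_of_nonneg (sq_nonneg r), Real.sqrt_mul (sq_nonneg r),
    Real.sqrt_sq (Real.sqrt_nonneg _)] at h1
  rw [hnorm]
  have h4 : r ≤ √2 * N * √γ := by
    rcases (Real.sqrt_nonneg (a ^ 2 + b ^ 2)).eq_or_lt with h | h
    · rw [hr, ← h]; positivity
    · refine le_of_mul_le_mul_right ?_ h
      rw [← hr] at h1 ⊢; linarith
  have h5 : √(γ / 2) = √2 * √γ / 2 := by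
    rw [Real.sqrt_div hγ0, div_eq_div_iff (by positivity) two_ne_zero]
    linear_combination -√γ * Real.mul_self_sqrt (zero_le_two (α := ℝ))
  rw [h5]
  linarith

/-- The converse bound, used only at the maximum point: `df(v)` is twice the real part of `∑ ζ k ∂_k
f`, to which Cauchy–Schwarz applies. -/
theorem HermitianStructure.gradNorm_le_of_metricMatrix_eq_one (he : IsHolomorphicChart I S.J e)
    (hw : w ∈ e.target) {f : M → ℝ} (hf : MDifferentiableAt I 𝓘(ℝ, ℝ) f (e.symm w))
    (h1 : S.metricMatrix e w = 1) :
    S.gradNorm f (e.symm w) ≤ √(∑ k, ‖dz k (fun v => (f (e.symm v) : ℂ)) w‖ ^ 2) := by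
  have hd : DifferentiableAt ℝ (fun v => f (e.symm v)) w :=
    (hf.comp w (he.mdifferentiableAt_symm hw)).differentiableAt
  refine S.gradNorm_le (Real.sqrt_nonneg _) fun v => ?_
  set ζ := coordDiff I e w v with hζ
  have hv : v = paramDiff I e.symm w ζ := (he.paramDiff_coordDiff hw v).symm
  have hN := S.vecNorm_metricMatrix he hw ζ
  rw [h1, vecNorm_one, ← hv] at hN
  have hN' : √(S.g.inner (e.symm w) v v) = √2 * √(∑ i, ‖ζ i‖ ^ 2) := by
    rw [hN, ← Real.sqrt_mul zero_le_two]
    congr 1; ring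
  have h2 : realDiff I f (e.symm w) v
      = 2 * (∑ k, ζ k * dz k (fun v => (f (e.symm v) : ℂ)) w).re := by
    rw [sum_mul_dz, fderiv_ofReal_comp hd, fderiv_ofReal_comp hd, he.fderiv_comp_symm hw hf, ← hv]
    simp
    ring
  rw [h2, hN']
  have h3 : (∑ k, ζ k * dz k (fun v => (f (e.symm v) : ℂ)) w).re
      ≤ √(∑ i, ‖ζ i‖ ^ 2) * √(∑ k, ‖dz k (fun v => (f (e.symm v) : ℂ)) w‖ ^ 2) := by
    refine (Complex.re_le_norm _).trans ((norm_sum_le _ _).trans ?_)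
    simp only [norm_mul]
    exact Real.sum_mul_le_sqrt_mul_sqrt _ _ _
  refine (mul_le_mul_of_nonneg_left h3 zero_le_two).trans (le_of_eq ?_)
  nth_rewrite 1 [← Real.mul_self_sqrt (zero_le_two (α := ℝ))]
  ring

/-! ### Smoothness of the components -/

theorem IsHolomorphicChart.contMDiffAt_paramDiff {J : ∀ p : M, TangentSpace I p →L[ℝ] TangentSpace I p}
    (he : IsHolomorphicChart I J e) (hw : w ∈ e.target) (a : Fin n → ℂ) :
    ContMDiffAt 𝓘(ℝ, Fin n → ℂ) I.tangent ∞
      (fun v => (⟨e.symm v, paramDiff I e.symm v a⟩ : TangentBundle I M)) w := by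
  have h1 := he.contMDiffOn_symm.contMDiffOn_tangentMapWithin (m := ∞) (by simp)
    e.open_target.uniqueMDiffOn
  have h2 : ContMDiff 𝓘(ℝ, Fin n → ℂ) 𝓘(ℝ, Fin n → ℂ).tangent ∞
      (fun v => (⟨v, a⟩ : TangentBundle 𝓘(ℝ, Fin n → ℂ) (Fin n → ℂ))) :=
    contMDiff_vectorSpace_iff_contDiff.2 contDiff_const
  have h3 := h1.comp (h2.contMDiffOn (s := e.target)) fun v hv => hv
  refine (h3.contMDiffAt (e.open_target.mem_nhds hw)).congr_of_eventuallyEq ?_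
  filter_upwards [e.open_target.mem_nhds hw] with v hv
  simp only [Function.comp_apply, tangentMapWithin, paramDiff]
  rw [mfderivWithin_of_isOpen e.open_target hv]
  rfl

theorem IsHolomorphicChart.contDiffAt_form {J : ∀ p : M, TangentSpace I p →L[ℝ] TangentSpace I p}
    (he : IsHolomorphicChart I J e) (hw : w ∈ e.target)
    {B : ℝ → ∀ p : M, TangentSpace I p →L[ℝ] TangentSpace I p →L[ℝ] ℝ}
    (hB : ContMDiff (I.prod 𝓘(ℝ, ℝ)) (I.prod 𝓘(ℝ, E →L[ℝ] E →L[ℝ] ℝ)) ∞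
      (fun q : M × ℝ => TotalSpace.mk' (E →L[ℝ] E →L[ℝ] ℝ)
        (E := fun p : M => TangentSpace I p →L[ℝ] TangentSpace I p →L[ℝ] ℝ) q.1 (B q.2 q.1)))
    (s : ℝ) (a b : Fin n → ℂ) :
    ContDiffAt ℝ ∞ (fun q : ℝ × (Fin n → ℂ) => B q.1 (e.symm q.2) (paramDiff I e.symm q.2 a)
      (paramDiff I e.symm q.2 b)) (s, w) := by
  rw [← contMDiffAt_iff_contDiffAt]
  have hsnd : ContMDiffAt 𝓘(ℝ, ℝ × (Fin n → ℂ)) 𝓘(ℝ, Fin n → ℂ) ∞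
      (fun q : ℝ × (Fin n → ℂ) => q.2) (s, w) := contDiffAt_snd.contMDiffAt
  have hfst : ContMDiffAt 𝓘(ℝ, ℝ × (Fin n → ℂ)) 𝓘(ℝ, ℝ) ∞
      (fun q : ℝ × (Fin n → ℂ) => q.1) (s, w) := contDiffAt_fst.contMDiffAt
  have hφ : ContMDiffAt 𝓘(ℝ, ℝ × (Fin n → ℂ)) I ∞
      (fun q : ℝ × (Fin n → ℂ) => e.symm q.2) (s, w) :=
    ContMDiffAt.comp (s, w) (he.contMDiffAt_symm hw) hsnd
  have hform := ContMDiffAt.comp (s, w) (hB.contMDiffAt (x := (e.symm w, s))) (hφ.prodMk hfst)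
  have hsec := fun a => ContMDiffAt.comp (s, w) (he.contMDiffAt_paramDiff hw a) hsnd
  -- The value of the form is read as a section of the trivial line bundle, so that the rule for
  -- evaluating a smooth family of bilinear maps on smooth sections applies.
  have : ContMDiffAt 𝓘(ℝ, ℝ × (Fin n → ℂ)) (I.prod 𝓘(ℝ)) ∞
      (fun q : ℝ × (Fin n → ℂ) => TotalSpace.mk' ℝ (E := Bundle.Trivial M ℝ) (e.symm q.2)
        (B q.1 (e.symm q.2) (paramDiff I e.symm q.2 a) (paramDiff I e.symm q.2 b))) (s, w) := by
    apply ContMDiffAt.clm_bundle_apply₂ (F₁ := E) (F₂ := E)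
    · exact hform
    · exact hsec a
    · exact hsec b
  simp only [contMDiffAt_totalSpace] at this
  exact this.2

theorem IsHolomorphicChart.contDiffAt_mixedComponent
    {J : ∀ p : M, TangentSpace I p →L[ℝ] TangentSpace I p}
    (he : IsHolomorphicChart I J e) (hw : w ∈ e.target)
    {B : ℝ → ∀ p : M, TangentSpace I p →L[ℝ] TangentSpace I p →L[ℝ] ℝ}
    (hB : ContMDiff (I.prod 𝓘(ℝ, ℝ)) (I.prod 𝓘(ℝ, E →L[ℝ] E →L[ℝ] ℝ)) ∞
      (fun q : M × ℝ => TotalSpace.mk' (E →L[ℝ] E →L[ℝ] ℝ)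
        (E := fun p : M => TangentSpace I p →L[ℝ] TangentSpace I p →L[ℝ] ℝ) q.1 (B q.2 q.1)))
    (s : ℝ) (j k : Fin n) :
    ContDiffAt ℝ ∞ (fun q : ℝ × (Fin n → ℂ) => mixedComponent I e.symm (B q.1) q.2 j k) (s, w) := by
  have h := he.contDiffAt_form hw hB s
  have hC : ∀ {r : ℝ × (Fin n → ℂ) → ℝ}, ContDiffAt ℝ ∞ r (s, w) →
      ContDiffAt ℝ ∞ (fun q => (r q : ℂ)) (s, w) := fun hr =>
    Complex.ofRealCLM.contDiff.contDiffAt.comp (s, w) hr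
  exact ((hC ((h _ _).add (h _ _))).add
    (contDiffAt_const.mul (hC ((h _ _).sub (h _ _))))).div_const 4

theorem HermitianStructure.contDiffAt_metricMatrix (he : IsHolomorphicChart I S.J e)
    (hw : w ∈ e.target) (j k : Fin n) : ContDiffAt ℝ ∞ (fun v => S.metricMatrix e v j k) w := by
  have h := he.contDiffAt_mixedComponent hw (B := fun _ => S.g.inner)
    (S.g.contMDiff.comp contMDiff_fst) 0 j k
  exact h.comp w (contDiffAt_const.prodMk contDiffAt_id)

theorem OneOneFormFamily.contDiffAt_matrix {S : HermitianStructure I M n} (χ : OneOneFormFamily S)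
    (he : IsHolomorphicChart I S.J e) (hw : w ∈ e.target) (s : ℝ) (j k : Fin n) :
    ContDiffAt ℝ ∞ (fun q : ℝ × (Fin n → ℂ) => χ.matrix q.1 e q.2 j k) (s, w) :=
  contDiffAt_const.mul (he.contDiffAt_mixedComponent hw χ.smooth s j k)

end ManifoldPart

section ManifoldPart

variable {E : Type*} [NormedAddCommGroup E] [NormedSpace ℝ E] {H : Type*} [TopologicalSpace H]
  {I : ModelWithCorners ℝ E H} {M : Type*} [TopologicalSpace M] [ChartedSpace H M]
  {n : ℕ}

/-! ### Linear changes of coordinates -/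

section LinearChange

variable {J : ∀ p : M, TangentSpace I p →L[ℝ] TangentSpace I p}
  {e : OpenPartialHomeomorph M (Fin n → ℂ)} {w : Fin n → ℂ}
  (L : (Fin n → ℂ) ≃L[ℂ] (Fin n → ℂ))

/-- The chart `L⁻¹ ∘ e`, whose inverse is `e⁻¹ ∘ L`. -/
def linearChange (e : OpenPartialHomeomorph M (Fin n → ℂ)) (L : (Fin n → ℂ) ≃L[ℂ] (Fin n → ℂ)) :
    OpenPartialHomeomorph M (Fin n → ℂ) :=
  e.transHomeomorph L.symm.toHomeomorph

@[simp] theorem linearChange_symm_apply (v : Fin n → ℂ) :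
    (linearChange e L).symm v = e.symm (L v) := rfl

theorem mem_linearChange_target : w ∈ (linearChange e L).target ↔ L w ∈ e.target := Iff.rfl

theorem IsHolomorphicChart.linearChange (he : IsHolomorphicChart I J e) :
    IsHolomorphicChart I J (linearChange e L) where
  source_subset := he.source_subset
  contMDiffOn := by
    have hL : ContMDiff 𝓘(ℝ, Fin n → ℂ) 𝓘(ℝ, Fin n → ℂ) ∞ L.symm :=
      ((L.symm : (Fin n → ℂ) →L[ℂ] (Fin n → ℂ)).restrictScalars ℝ).contMDiff
    exact hL.comp_contMDiffOn he.contMDiffOn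
  contMDiffOn_symm := by
    have hL : ContMDiff 𝓘(ℝ, Fin n → ℂ) 𝓘(ℝ, Fin n → ℂ) ∞ L :=
      ((L : (Fin n → ℂ) →L[ℂ] (Fin n → ℂ)).restrictScalars ℝ).contMDiff
    exact he.contMDiffOn_symm.comp hL.contMDiffOn fun v hv => hv
  holomorphic := by
    intro p hp v j
    have hp' : p ∈ e.source := hp
    have hL : HasMFDerivAt 𝓘(ℝ, Fin n → ℂ) 𝓘(ℝ, Fin n → ℂ) L.symm (e p)
        ((L.symm : (Fin n → ℂ) →L[ℂ] (Fin n → ℂ)).restrictScalars ℝ) :=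
      ((L.symm : (Fin n → ℂ) →L[ℂ] (Fin n → ℂ)).restrictScalars ℝ).hasMFDerivAt
    have hD : mfderiv I 𝓘(ℝ, Fin n → ℂ) (HermitianMA.linearChange e L) p
        = ((L.symm : (Fin n → ℂ) →L[ℂ] (Fin n → ℂ)).restrictScalars ℝ).comp
          (mfderiv I 𝓘(ℝ, Fin n → ℂ) e p) :=
      (HasMFDerivAt.comp p hL (he.mdifferentiableAt hp').hasMFDerivAt).mfderiv
    let D : TangentSpace I p →L[ℝ] (Fin n → ℂ) := mfderiv I 𝓘(ℝ, Fin n → ℂ) e p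
    have h1 : D (J p v) = Complex.I • D v := funext fun k => he.holomorphic p hp' v k
    have h2 : ∀ x : TangentSpace I p, (mfderiv I 𝓘(ℝ, Fin n → ℂ) (HermitianMA.linearChange e L) p x
        : Fin n → ℂ) = L.symm (D x) := fun x =>
      congrArg (fun T : E →L[ℝ] (Fin n → ℂ) => T x) hD
    have h3 : L.symm (D (J p v)) = Complex.I • L.symm (D v) := by rw [h1, map_smul]
    exact (congrFun (h2 (J p v)) j).trans ((congrFun h3 j).trans
      (congrArg (Complex.I * ·) (congrFun (h2 v) j).symm))

theorem paramDiff_linearChange (he : IsHolomorphicChart I J e) (hw : L w ∈ e.target)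
    (ξ : Fin n → ℂ) :
    paramDiff I (linearChange e L).symm w ξ = paramDiff I e.symm (L w) (L ξ) := by
  have hL : HasMFDerivAt 𝓘(ℝ, Fin n → ℂ) 𝓘(ℝ, Fin n → ℂ) L w
      ((L : (Fin n → ℂ) →L[ℂ] (Fin n → ℂ)).restrictScalars ℝ) :=
    ((L : (Fin n → ℂ) →L[ℂ] (Fin n → ℂ)).restrictScalars ℝ).hasMFDerivAt
  have hD : mfderiv 𝓘(ℝ, Fin n → ℂ) I (linearChange e L).symm w
      = (mfderiv 𝓘(ℝ, Fin n → ℂ) I e.symm (L w)).comp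
          ((L : (Fin n → ℂ) →L[ℂ] (Fin n → ℂ)).restrictScalars ℝ) :=
    (HasMFDerivAt.comp w (he.mdifferentiableAt_symm hw).hasMFDerivAt hL).mfderiv
  exact congrArg (fun T : (Fin n → ℂ) →L[ℝ] E => T ξ) hD

theorem mixedComponent_linearChange (he : IsHolomorphicChart I J e) (hw : L w ∈ e.target)
    (B : ∀ p : M, TangentSpace I p →L[ℝ] TangentSpace I p →L[ℝ] ℝ) (j k : Fin n) :
    mixedComponent I (linearChange e L).symm B w j k
      = ∑ a, ∑ c, mixedComponent I e.symm B (L w) a c * L (Pi.single j 1) a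
          * star (L (Pi.single k 1) c) := by
  have hI : ∀ l : Fin n, (Pi.single l Complex.I : Fin n → ℂ)
      = Complex.I • (Pi.single l 1 : Fin n → ℂ) := fun l => by
    rw [← Pi.single_smul, smul_eq_mul, mul_one]
  have h1 : ∀ l, paramDiff I (linearChange e L).symm w (Pi.single l 1)
      = paramDiff I e.symm (L w) (L (Pi.single l 1)) := fun l =>
    paramDiff_linearChange L he hw _
  have h2 : ∀ l, paramDiff I (linearChange e L).symm w (Pi.single l Complex.I)
      = paramDiff I e.symm (L w) (Complex.I • L (Pi.single l 1)) := fun l => by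
    rw [paramDiff_linearChange L he hw, hI, map_smul]
  rw [sum_mixedComponent, ← h1, ← h1, ← h2, ← h2]
  rfl

end LinearChange

/-- A sum over matrix entries as a conjugation. -/
theorem sum_mul_mul_star_eq (A : Matrix (Fin n) (Fin n) ℂ) (L : (Fin n → ℂ) → (Fin n → ℂ))
    {Q : Matrix (Fin n) (Fin n) ℂ} (hQ : ∀ a k, L (Pi.single k 1) a = star (Q a k)) (j k : Fin n) :
    ∑ a, ∑ c, A a c * L (Pi.single j 1) a * star (L (Pi.single k 1) c)
      = (Q.conjTranspose * A * Q) j k := by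
  simp only [hQ, star_star, Matrix.mul_apply, Matrix.conjTranspose_apply, Finset.sum_mul]
  rw [Finset.sum_comm]
  exact Finset.sum_congr rfl fun _ _ => Finset.sum_congr rfl fun _ _ => by ring

variable [IsManifold I ∞ M] (S : HermitianStructure I M n)

/-- Around an interior point there are holomorphic coordinates in which, at this point, the metric
is the identity and a given admissible `χ_u` is diagonal. -/
theorem HermitianStructure.exists_adapted_chart (χ : OneOneFormFamily S) {u : M → ℝ}
    (hu : ContMDiff I 𝓘(ℝ, ℝ) 4 u) {p : M} (hp : p ∈ I.interior M)
    (hpos : ∀ e : OpenPartialHomeomorph M (Fin n → ℂ), IsHolomorphicChart I S.J e →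
      ∀ w ∈ e.target, (χ.perturbedMatrix u e w).PosDef) :
    ∃ (e : OpenPartialHomeomorph M (Fin n → ℂ)) (w : Fin n → ℂ) (d : Fin n → ℝ),
      IsHolomorphicChart I S.J e ∧ w ∈ e.target ∧ e.symm w = p ∧ S.metricMatrix e w = 1 ∧
      (∀ i, 0 < d i) ∧ χ.perturbedMatrix u e w = Matrix.diagonal fun i => (d i : ℂ) := by
  obtain ⟨e, hpe, he⟩ := S.integrable p hp
  have hw : e p ∈ e.target := e.map_source hpe
  obtain ⟨Q, d, hQ, hd, hQG, hQA⟩ := exists_simultaneous_diagonalization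
    (S.metricMatrix_posDef he hw) (hpos e he _ hw)
  -- Components transform by `A_{a c̄} L_a L̄_c`, with the conjugate on the second index. The
  -- conjugation by `Q` is therefore realized by the linear map whose matrix is the entrywise
  -- conjugate of `Q`.
  have hQ' : IsUnit (Q.map star) := hQ.map (starRingEnd ℂ).mapMatrix
  let L : (Fin n → ℂ) ≃L[ℂ] (Fin n → ℂ) :=
    (Matrix.toLin'OfInv (Matrix.nonsing_inv_mul _ ((Matrix.isUnit_iff_isUnit_det _).1 hQ'))
      (Matrix.mul_nonsing_inv _ ((Matrix.isUnit_iff_isUnit_det _).1 hQ'))).toContinuousLinearEquiv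
  have hL : ∀ a k, L (Pi.single k 1) a = star (Q a k) := fun a k => by
    rw [LinearEquiv.coe_toContinuousLinearEquiv']
    simp [Matrix.toLin'OfInv]
  refine ⟨linearChange e L, L.symm (e p), d, he.linearChange L, ?_, ?_, ?_, hd, ?_⟩
  · rw [mem_linearChange_target, L.apply_symm_apply]; exact hw
  · rw [linearChange_symm_apply, L.apply_symm_apply, e.left_inv hpe]
  · have hw' : L (L.symm (e p)) ∈ e.target := by rwa [L.apply_symm_apply]
    ext j k
    have h := mixedComponent_linearChange L he hw' S.g.inner j k
    rw [L.apply_symm_apply] at h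
    rw [← hQG, ← sum_mul_mul_star_eq _ L hL]
    exact h
  · have hw' : L (L.symm (e p)) ∈ e.target := by rwa [L.apply_symm_apply]
    ext j k
    rw [← hQA, ← sum_mul_mul_star_eq _ L hL]
    have h := mixedComponent_linearChange L he hw' (χ.form (u p)) j k
    rw [L.apply_symm_apply] at h
    have hUc : ContDiffAt ℝ 2 (fun v => (u (e.symm v) : ℂ)) (L (L.symm (e p))) := by
      rw [L.apply_symm_apply]
      have h1 : ContDiffAt ℝ 2 (fun v => u (e.symm v)) (e p) :=
        (ContMDiffAt.comp (e p) (hu.contMDiffAt.of_le (by norm_num))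
          ((he.contMDiffAt_symm hw).of_le ENat.LEInfty.out)).contDiffAt
      exact Complex.ofRealCLM.contDiff.contDiffAt.comp _ h1
    have h2 := complexHessian_comp_linear (L := (L : (Fin n → ℂ) →L[ℂ] (Fin n → ℂ)))
      (w := L.symm (e p)) hUc j k
    simp only [ContinuousLinearEquiv.coe_coe, L.apply_symm_apply] at h2
    have hup : u ((linearChange e L).symm (L.symm (e p))) = u p := by
      rw [linearChange_symm_apply, L.apply_symm_apply, e.left_inv hpe]
    simp only [OneOneFormFamily.perturbedMatrix, hup]
    simp only [Matrix.add_apply, OneOneFormFamily.matrix, Matrix.of_apply, e.left_inv hpe,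
      linearChange_symm_apply]
    rw [h2, h]
    simp only [add_mul, Finset.sum_add_distrib, Finset.mul_sum, mul_assoc]

end ManifoldPart

section Semicontinuity

variable {E : Type*} [NormedAddCommGroup E] [NormedSpace ℝ E] {H : Type*} [TopologicalSpace H]
  {I : ModelWithCorners ℝ E H} {M : Type*} [TopologicalSpace M] [ChartedSpace H M]
  {n : ℕ} [IsManifold I ∞ M]

/-! ### Semicontinuity of the length of the gradient -/

/-- Transporting the differentials at nearby points to the fixed model space `E` makes them
comparable in norm. -/
theorem continuousAt_realDiff_comp_symmL {f : M → ℝ} (hf : ContMDiff I 𝓘(ℝ, ℝ) 1 f) (x : M) :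
    ContinuousAt (fun y => ((realDiff I f y).comp
      ((trivializationAt E (TangentSpace I) x).symmL ℝ y) : E →L[ℝ] ℝ)) x := by
  have : IsManifold I 1 M := IsManifold.of_le (n := ∞) ENat.LEInfty.out
  have h : ContinuousAt (inTangentCoordinates I 𝓘(ℝ, ℝ) id f (mfderiv I 𝓘(ℝ, ℝ) f) x) x :=
    ((hf.contMDiffAt (x := x)).mfderiv_const (m := 0) (by norm_num)).continuousAt
  refine h.congr (Eventually.of_forall fun y => ?_)
  ext v
  simp [inTangentCoordinates, ContinuousLinearMap.inCoordinates, realDiff,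
    TangentBundle.continuousLinearMapAt_model_space]
  rfl

/-- Upper semicontinuity is all that compactness needs to bound the gradient and to produce a
maximum of the test function. -/
theorem HermitianStructure.upperSemicontinuous_gradNorm (S : HermitianStructure I M n) {f : M → ℝ}
    (hf : ContMDiff I 𝓘(ℝ, ℝ) 1 f) : UpperSemicontinuous (S.gradNorm f) := by
  intro x c hc
  let _ : RiemannianBundle (fun p : M => TangentSpace I p) := ⟨S.g.toRiemannianMetric⟩
  have : IsContinuousRiemannianBundle E (fun p : M => TangentSpace I p) :=
    ⟨S.g.inner, S.g.contMDiff.continuous, fun _ _ _ => rfl⟩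
  have hN : ∀ y, S.gradNorm f y = (√2)⁻¹ * ‖realDiff I f y‖ := S.gradNorm_eq_opNorm f
  set T := trivializationAt E (fun p : M => TangentSpace I p) x with hT
  set φ : M → E →L[ℝ] ℝ := fun y => (realDiff I f y).comp (T.symmL ℝ y) with hφ
  have hφc : ContinuousAt φ x := continuousAt_realDiff_comp_symmL hf x
  obtain ⟨C, hC, hCy⟩ := eventually_norm_trivializationAt_lt E (fun p : M => TangentSpace I p) x
  -- The bound obtained near `x` is `(r - 1) C + r ‖df_x‖` up to normalization, so `r` is taken
  -- close enough to `1` from above.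
  have hlim : Tendsto (fun r : ℝ => (√2)⁻¹ * ((r - 1) * C + r * ‖realDiff I f x‖)) (𝓝[>] 1)
      (𝓝 ((√2)⁻¹ * ((1 - 1) * C + 1 * ‖realDiff I f x‖))) :=
    (Continuous.tendsto (by fun_prop) 1).mono_left nhdsWithin_le_nhds
  have hc' : (√2)⁻¹ * ((1 - 1) * C + 1 * ‖realDiff I f x‖) < c := by
    simpa [← hN] using hc
  obtain ⟨r, hrc, hr⟩ := ((hlim.eventually_lt_const hc').and self_mem_nhdsWithin).exists
  have hr1 : 0 < r - 1 := sub_pos.2 hr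
  filter_upwards [hCy, eventually_norm_symmL_trivializationAt_self_comp_lt E
    (fun p : M => TangentSpace I p) x hr, Metric.continuousAt_iff'.1 hφc _ hr1,
    T.open_baseSet.mem_nhds (FiberBundle.mem_baseSet_trivializationAt' x)] with y h1 h2 h3 h4
  refine lt_of_le_of_lt ?_ hrc
  rw [hN]
  refine mul_le_mul_of_nonneg_left ?_ (by positivity)
  -- The differential at `y` is split into the variation of the transported differential, which is
  -- small, and the differential at `x` composed with a nearly isometric transport.
  have hid : realDiff I f y = (φ y - φ x).comp (T.continuousLinearMapAt ℝ y)
      + (realDiff I f x).comp ((T.symmL ℝ x).comp (T.continuousLinearMapAt ℝ y)) := by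
    ext v
    have hv : T.symmL ℝ y (T.continuousLinearMapAt ℝ y v) = v := T.symmL_continuousLinearMapAt h4 v
    change _ = realDiff I f y (T.symmL ℝ y (T.continuousLinearMapAt ℝ y v))
      - realDiff I f x (T.symmL ℝ x (T.continuousLinearMapAt ℝ y v))
      + realDiff I f x (T.symmL ℝ x (T.continuousLinearMapAt ℝ y v))
    rw [hv, sub_add_cancel]
  rw [hid]
  refine (ContinuousLinearMap.opNorm_add_le _ _).trans (add_le_add ?_ ?_)
  · refine (ContinuousLinearMap.opNorm_comp_le _ _).trans ?_
    rw [← dist_eq_norm]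
    exact mul_le_mul h3.le h1.le (norm_nonneg _) hr1.le
  · refine (ContinuousLinearMap.opNorm_comp_le _ _).trans ?_
    rw [mul_comm]
    exact mul_le_mul_of_nonneg_right h2.le (norm_nonneg _)

end Semicontinuity

/-! ### Monotonicity of the bounds -/

section Monotonicity

variable {n : ℕ} {G A : (Fin n → ℂ) → Matrix (Fin n) (Fin n) ℂ} {g B : Matrix (Fin n) (Fin n) ℂ}
  {w : Fin n → ℂ} {K K' : ℝ}

theorem vecNorm_nonneg (g : Matrix (Fin n) (Fin n) ℂ) (X : Fin n → ℂ) : 0 ≤ vecNorm g X :=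
  Real.sqrt_nonneg _

theorem FormBound.mono (h : FormBound g B K) (hK : K ≤ K') : FormBound g B K' := fun X Y =>
  (h X Y).trans (mul_le_mul_of_nonneg_right
    (mul_le_mul_of_nonneg_right hK (vecNorm_nonneg _ _)) (vecNorm_nonneg _ _))

theorem CovDerivBound.mono (h : CovDerivBound G A w K) (hK : K ≤ K') : CovDerivBound G A w K' :=
  fun X Y Z => (h X Y Z).trans (mul_le_mul_of_nonneg_right (mul_le_mul_of_nonneg_right
    (mul_le_mul_of_nonneg_right hK (vecNorm_nonneg _ _)) (vecNorm_nonneg _ _)) (vecNorm_nonneg _ _))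

theorem TorsionBound.mono (h : TorsionBound G w K) (hK : K ≤ K') : TorsionBound G w K' := fun X Y =>
  (h X Y).trans (mul_le_mul_of_nonneg_right
    (mul_le_mul_of_nonneg_right hK (vecNorm_nonneg _ _)) (vecNorm_nonneg _ _))

theorem BisectionalLowerBound.mono (h : BisectionalLowerBound G w K) (hK : K ≤ K') :
    BisectionalLowerBound G w K' := fun X Y =>
  (mul_le_mul_of_nonneg_right (mul_le_mul_of_nonneg_right (neg_le_neg hK) (sq_nonneg _))
    (sq_nonneg _)).trans (h X Y)

theorem posSemidef_smul_sub_mono (hg : g.PosDef) (h : ((K : ℂ) • g - B).PosSemidef)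
    (hK : K ≤ K') : ((K' : ℂ) • g - B).PosSemidef := by
  have hK' : (0 : ℂ) ≤ ((K' - K : ℝ) : ℂ) := by exact_mod_cast sub_nonneg.2 hK
  have := (hg.posSemidef.smul hK').add h
  rwa [Complex.ofReal_sub, sub_smul, sub_add_sub_cancel] at this

end Monotonicity

section InteriorEstimate

variable {E : Type*} [NormedAddCommGroup E] [NormedSpace ℝ E] {H : Type*} [TopologicalSpace H]
  {I : ModelWithCorners ℝ E H} {M : Type*} [TopologicalSpace M] [ChartedSpace H M]
  {n : ℕ} [IsManifold I ∞ M] {S : HermitianStructure I M n}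

/-! ### The estimate at an interior maximum of the test function -/

theorem HermitianStructure.vecNorm_metricMatrix_sq {e : OpenPartialHomeomorph M (Fin n → ℂ)}
    {w : Fin n → ℂ} (he : IsHolomorphicChart I S.J e) (hw : w ∈ e.target) (ξ : Fin n → ℂ) :
    vecNorm (S.metricMatrix e w) ξ ^ 2
      = (∑ j, ∑ k, S.metricMatrix e w j k * (ξ j * star (ξ k))).re := by
  have h0 : 0 ≤ S.g.inner (e.symm w) (paramDiff I e.symm w ξ) (paramDiff I e.symm w ξ) := by
    rcases eq_or_ne (paramDiff I e.symm w ξ) 0 with h | h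
    · simp [h]
    · exact (S.g.pos _ _ h).le
  simp only [← mul_assoc]
  rw [S.vecNorm_metricMatrix he hw, S.sum_metricMatrix he hw, Real.sq_sqrt (by positivity),
    Complex.ofReal_re]

/-- Transfer to adapted coordinates: Cauchy–Schwarz at nearby points turns the maximality of the
test function into an inequality for all complex vectors `ξ`, as the local estimate requires. -/
theorem gradNorm_sq_le_interiorBound {χ : OneOneFormFamily S} {ψ : M → ℝ → ℝ} {u : M → ℝ}
    {ε Ku Kψ K₀ K₁ K₂ KT KR : ℝ} (hn : 0 < n) (hε : 0 < ε) (hK₀ : 0 ≤ K₀) (hK₁ : 0 ≤ K₁)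
    (hK₂ : 0 ≤ K₂) (hKT : 0 ≤ KT) (hKR : 0 ≤ KR)
    (hψ : ContMDiff (I.prod 𝓘(ℝ, ℝ)) 𝓘(ℝ, ℝ) ∞ (fun q : M × ℝ => ψ q.1 q.2))
    (hψpos : ∀ p s, 0 < ψ p s) (hu : ContMDiff I 𝓘(ℝ, ℝ) 4 u) (hsol : IsAdmissibleSolution χ ψ u)
    (hroot : S.RootBoundAlong ψ u Kψ) (hχ : χ.BoundAlong u ε K₀ K₁ K₂)
    (hgeo : S.GeometryBound KT KR) {p : M} (hp : p ∈ I.interior M) (hpK : u p ≤ Ku)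
    (hmax : ∀ q, S.gradNorm u q ^ 2 * weight (weightAmplitude ε Ku Kψ K₀ K₁ K₂ KT KR) (u q)
      ≤ S.gradNorm u p ^ 2 * weight (weightAmplitude ε Ku Kψ K₀ K₁ K₂ KT KR) (u p)) :
    S.gradNorm u p ^ 2 ≤ interiorBound n ε Kψ K₀ KT := by
  obtain ⟨e, w, d, he, hw, rfl, h1, hd, hdiag⟩ :=
    S.exists_adapted_chart χ hu hp fun e he w hw => (hsol e he w hw).1
  have htarget : ∀ᶠ v in 𝓝 w, v ∈ e.target := e.open_target.mem_nhds hw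
  have hud : ∀ q, MDifferentiableAt I 𝓘(ℝ, ℝ) u q := fun q =>
    (hu.contMDiffAt (x := q)).mdifferentiableAt (by norm_num)
  have huc : ContDiffAt ℝ 4 (fun v => u (e.symm v)) w :=
    (ContMDiffAt.comp w hu.contMDiffAt
      ((he.contMDiffAt_symm hw).of_le ENat.LEInfty.out)).contDiffAt
  -- With `ρ = ψ^{1/n}` the right side of the equation is `ρⁿ det g`, so only the root is ever
  -- differentiated.
  have hψn : ∀ q s, (ψ q s ^ ((1 : ℝ) / n)) ^ n = ψ q s := fun q s => by
    rw [one_div, Real.rpow_inv_natCast_pow (hψpos q s).le hn.ne']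
  have hψe : DifferentiableAt ℝ (fun q : ℝ × (Fin n → ℂ) => ψ (e.symm q.2) q.1)
      (u (e.symm w), w) := by
    have h : ContMDiffAt 𝓘(ℝ, ℝ × (Fin n → ℂ)) (I.prod 𝓘(ℝ, ℝ)) ∞
        (fun q : ℝ × (Fin n → ℂ) => (e.symm q.2, q.1)) (u (e.symm w), w) :=
      ((he.contMDiffAt_symm hw).comp (u (e.symm w), w)
        contDiffAt_snd.contMDiffAt).prodMk contDiffAt_fst.contMDiffAt
    exact ((hψ.contMDiffAt.comp (u (e.symm w), w) h).contDiffAt).differentiableAt (by simp)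
  have hψp : MDifferentiableAt I 𝓘(ℝ, ℝ) (fun q => ψ q (u (e.symm w)) ^ ((1 : ℝ) / n))
      (e.symm w) := by
    have h : ContMDiffAt I 𝓘(ℝ, ℝ) ∞ (fun q => ψ q (u (e.symm w))) (e.symm w) :=
      hψ.contMDiffAt.comp (e.symm w) (contMDiffAt_id.prodMk contMDiffAt_const)
    have h' : DifferentiableAt ℝ (fun t : ℝ => t ^ ((1 : ℝ) / n))
        (ψ (e.symm w) (u (e.symm w))) :=
      (Real.differentiableAt_rpow_const_of_ne _ (hψpos _ _).ne')
    exact h'.mdifferentiableAt.comp (e.symm w) (h.mdifferentiableAt (by simp))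
  have hroot' := hroot (e.symm w)
  have hρ0 : 0 < ψ (e.symm w) (u (e.symm w)) ^ ((1 : ℝ) / n) := Real.rpow_pos_of_pos (hψpos _ _) _
  have hgr0 := S.gradNorm_nonneg (fun q => ψ q (u (e.symm w)) ^ ((1 : ℝ) / n)) (e.symm w)
  have hder0 := abs_nonneg (deriv (fun s => ψ (e.symm w) s ^ ((1 : ℝ) / n)) (u (e.symm w)))
  obtain ⟨hε', h₀, h₁, h₂⟩ := hχ e he w hw
  obtain ⟨hT, hR⟩ := hgeo e he w hw
  have hgrad : S.gradNorm u (e.symm w) ^ 2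
      ≤ ∑ k, ‖dz k (fun v => (u (e.symm v) : ℂ)) w‖ ^ 2 := by
    rw [← Real.le_sqrt (S.gradNorm_nonneg _ _)
      (Finset.sum_nonneg fun _ _ => sq_nonneg _)]
    exact S.gradNorm_le_of_metricMatrix_eq_one he hw (hud _) h1
  refine hgrad.trans ?_
  refine sum_norm_sq_dz_le_interiorBound (G := S.metricMatrix e) (u := fun v => u (e.symm v))
    (A := fun s => χ.matrix s e) (ρ := fun v s => ψ (e.symm v) s ^ ((1 : ℝ) / n)) (Ku := Ku)
    (K₁ := K₁) (K₂ := K₂) (KR := KR) hn hε hK₀ hK₁ hK₂ hKT hKR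
    (fun k l => (S.contDiffAt_metricMatrix he hw k l).of_le ENat.LEInfty.out) h1
    (Eventually.of_forall fun v k l => S.star_metricMatrix e v k l) huc hpK
    (fun k l => (χ.contDiffAt_matrix he hw _ k l).differentiableAt (by simp)) hdiag hd
    (hψe.rpow_const (Or.inl (hψpos _ _).ne')) hρ0 ?_ (by linarith) (fun ξ => ?_)
    (by linarith) hε' h₀ h₁ h₂ hT hR ?_
  · filter_upwards [htarget] with v hv
    refine ((hsol e he v hv).2).trans ?_
    rw [← Complex.ofReal_pow, hψn]
  · exact (S.norm_sum_mul_dz_le he hw hψp ξ).trans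
      (mul_le_mul_of_nonneg_right (by linarith) (vecNorm_nonneg _ _))
  · filter_upwards [htarget] with v hv ξ
    rw [← S.vecNorm_metricMatrix_sq he hv]
    calc _ ≤ (S.gradNorm u (e.symm v) * vecNorm (S.metricMatrix e v) ξ) ^ 2
          * weight (weightAmplitude ε Ku Kψ K₀ K₁ K₂ KT KR) (u (e.symm v)) :=
        mul_le_mul_of_nonneg_right (pow_le_pow_left₀ (norm_nonneg _)
          (S.norm_sum_mul_dz_le he hv (hud _) ξ) 2) (weight_pos _ _).le
      _ = S.gradNorm u (e.symm v) ^ 2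
          * weight (weightAmplitude ε Ku Kψ K₀ K₁ K₂ KT KR) (u (e.symm v))
          * vecNorm (S.metricMatrix e v) ξ ^ 2 := by ring
      _ ≤ _ := mul_le_mul_of_nonneg_right ((hmax _).trans ((mul_comm _ _).le.trans
          (mul_le_mul_of_nonneg_left hgrad (weight_pos _ _).le))) (sq_nonneg _)

end InteriorEstimate

section Main

variable {E : Type*} [NormedAddCommGroup E] [NormedSpace ℝ E] {H : Type*} [TopologicalSpace H]
  {I : ModelWithCorners ℝ E H} {M : Type*} [TopologicalSpace M] [CompactSpace M]
  [ChartedSpace H M] {n : ℕ} [IsManifold I ∞ M] {S : HermitianStructure I M n}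

/-! ### The gradient estimate -/

theorem one_le_weight {a : ℝ} (ha : 0 ≤ a) (s : ℝ) : 1 ≤ weight a s :=
  Real.one_le_exp (mul_nonneg ha (Real.exp_pos _).le)

theorem weight_le_exp {a s K : ℝ} (ha : 0 ≤ a) (hs : -s ≤ K) :
    weight a s ≤ Real.exp (a * Real.exp K) :=
  Real.exp_le_exp.2 (mul_le_mul_of_nonneg_left (Real.exp_le_exp.2 hs) ha)

/-- A number `t` slightly above `f x` still satisfies `t ^ 2 * g x < c`; nearby, `f` stays below `t`
and `g` is controlled by continuity. -/
theorem upperSemicontinuous_sq_mul {X : Type*} [TopologicalSpace X] {f g : X → ℝ}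
    (hf : UpperSemicontinuous f) (hf0 : ∀ x, 0 ≤ f x) (hg : Continuous g) (hg0 : ∀ x, 0 ≤ g x) :
    UpperSemicontinuous fun x => f x ^ 2 * g x := by
  intro x c hc
  have hlim : Tendsto (fun t : ℝ => t ^ 2 * g x) (𝓝[>] (f x)) (𝓝 (f x ^ 2 * g x)) :=
    (Continuous.tendsto (by fun_prop) _).mono_left nhdsWithin_le_nhds
  obtain ⟨t, ht, hft⟩ := ((hlim.eventually_lt_const hc).and self_mem_nhdsWithin).exists
  filter_upwards [hf x t hft, (hg.const_mul (t ^ 2)).continuousAt.eventually_lt_const ht]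
    with y h1 h2
  exact (mul_le_mul_of_nonneg_right (pow_le_pow_left₀ (hf0 y) h1.le 2) (hg0 y)).trans_lt h2

theorem gradNorm_le_of_isAdmissibleSolution {χ : OneOneFormFamily S} {ψ : M → ℝ → ℝ} {u : M → ℝ}
    {ε Ku Kψ K₀ K₁ K₂ KT KR : ℝ} (hn : 0 < n) (hε : 0 < ε) (hKψ : 0 ≤ Kψ) (hK₀ : 0 ≤ K₀)
    (hK₁ : 0 ≤ K₁) (hK₂ : 0 ≤ K₂) (hKT : 0 ≤ KT) (hKR : 0 ≤ KR)
    (hψ : ContMDiff (I.prod 𝓘(ℝ, ℝ)) 𝓘(ℝ, ℝ) ∞ (fun q : M × ℝ => ψ q.1 q.2))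
    (hψpos : ∀ p s, 0 < ψ p s) (hu : ContMDiff I 𝓘(ℝ, ℝ) 4 u) (hsol : IsAdmissibleSolution χ ψ u)
    (huK : ∀ p, |u p| ≤ Ku)
    (hroot : S.RootBoundAlong ψ u Kψ) (hχ : χ.BoundAlong u ε K₀ K₁ K₂)
    (hgeo : S.GeometryBound KT KR) (p : M) :
    S.gradNorm u p
      ≤ Real.exp (weightAmplitude ε Ku Kψ K₀ K₁ K₂ KT KR * Real.exp Ku)
        * interiorBound n ε Kψ K₀ KT * (1 + sSup (S.gradNorm u '' I.boundary M)) := by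
  set a := weightAmplitude ε Ku Kψ K₀ K₁ K₂ KT KR with ha_def
  set B := interiorBound n ε Kψ K₀ KT with hB_def
  set m := sSup (S.gradNorm u '' I.boundary M) with hm_def
  have ha : 0 ≤ a := by rw [ha_def, weightAmplitude]; positivity
  have hB : 1 ≤ B := le_max_left _ _
  have husc : UpperSemicontinuous (S.gradNorm u) :=
    S.upperSemicontinuous_gradNorm (hu.of_le (by norm_num))
  have hbdd : BddAbove (S.gradNorm u '' Set.univ) :=
    (husc.upperSemicontinuousOn _).bddAbove_of_isCompact isCompact_univ
  have hm : ∀ q ∈ I.boundary M, S.gradNorm u q ≤ m := fun q hq =>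
    le_csSup (hbdd.mono (Set.image_mono (Set.subset_univ _))) ⟨q, hq, rfl⟩
  -- For an empty boundary the supremum is `sSup ∅ = 0`, so a closed manifold needs no separate
  -- argument.
  have hm0 : 0 ≤ m := Real.sSup_nonneg fun r ⟨q, _, hq⟩ => hq ▸ S.gradNorm_nonneg u q
  set F : ℝ := Real.exp (a * Real.exp Ku) with hF
  have hF1 : 1 ≤ F := Real.one_le_exp (by positivity)
  obtain ⟨q, -, hq⟩ : ∃ q ∈ (Set.univ : Set M),
      IsMaxOn (fun q => S.gradNorm u q ^ 2 * weight a (u q)) Set.univ q := by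
    exact UpperSemicontinuousOn.exists_isMaxOn ⟨p, trivial⟩ isCompact_univ
      ((upperSemicontinuous_sq_mul husc (S.gradNorm_nonneg u) ((contDiff_weight a (m := 0)).continuous.comp
        hu.continuous) fun _ => (weight_pos _ _).le).upperSemicontinuousOn _)
  have hqmax : ∀ x, S.gradNorm u x ^ 2 * weight a (u x) ≤ S.gradNorm u q ^ 2 * weight a (u q) :=
    fun x => hq (Set.mem_univ x)
  have hpq : S.gradNorm u p ^ 2 ≤ F * S.gradNorm u q ^ 2 :=
    calc S.gradNorm u p ^ 2 ≤ S.gradNorm u p ^ 2 * weight a (u p) :=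
          le_mul_of_one_le_right (sq_nonneg _) (one_le_weight ha _)
      _ ≤ S.gradNorm u q ^ 2 * weight a (u q) := hqmax p
      _ ≤ S.gradNorm u q ^ 2 * F := mul_le_mul_of_nonneg_left
          (weight_le_exp ha (neg_le.1 (abs_le.1 (huK q)).1)) (sq_nonneg _)
      _ = _ := mul_comm _ _
  have hqB : S.gradNorm u q ^ 2 ≤ B * (1 + m) ^ 2 := by
    by_cases hqi : q ∈ I.interior M
    · have := gradNorm_sq_le_interiorBound hn hε hK₀ hK₁ hK₂ hKT hKR hψ hψpos hu hsol hroot hχ hgeo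
        hqi (abs_le.1 (huK q)).2 hqmax
      exact this.trans (le_mul_of_one_le_right (by linarith) (one_le_pow₀ (by linarith)))
    · have hqb : q ∈ I.boundary M := by rwa [← I.compl_interior]
      calc S.gradNorm u q ^ 2 ≤ (1 + m) ^ 2 :=
            pow_le_pow_left₀ (S.gradNorm_nonneg _ _) (by linarith [hm q hqb]) 2
        _ ≤ _ := le_mul_of_one_le_left (sq_nonneg _) hB
  -- The estimate for the square of the gradient has the constant `F * B`. Since `F * B ≥ 1`, it may
  -- be replaced by its square, which avoids a square root in the final constant.
  refine le_of_sq_le_sq ?_ (by positivity)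
  calc S.gradNorm u p ^ 2 ≤ F * (B * (1 + m) ^ 2) :=
        hpq.trans (mul_le_mul_of_nonneg_left hqB (by positivity))
    _ = (F * B) * (1 + m) ^ 2 := by ring
    _ ≤ (F * B) ^ 2 * (1 + m) ^ 2 := mul_le_mul_of_nonneg_right
        (le_self_pow₀ (one_le_mul_of_one_le_of_one_le hF1 hB) two_ne_zero) (sq_nonneg _)
    _ = _ := by ring

end Main

end HermitianMA

end

theorem proposition3p1 (n : ℕ) [NeZero n] (hn : 2 ≤ n) (ε Ku Kψ K₀ K₁ K₂ KT KR : ℝ)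
    (hε : 0 < ε) :
    ∃ C₁ : ℝ, 0 < C₁ ∧
      ∀ (M : Type*) [TopologicalSpace M] [T2Space M] [CompactSpace M]
        [ChartedSpace (EuclideanHalfSpace (2 * n)) M] [IsManifold (𝓡∂ (2 * n)) ∞ M]
        (S : HermitianStructure (𝓡∂ (2 * n)) M n) (χ : OneOneFormFamily S)
        (ψ : M → ℝ → ℝ) (u : M → ℝ),
        ContMDiff ((𝓡∂ (2 * n)).prod 𝓘(ℝ, ℝ)) 𝓘(ℝ, ℝ) ∞ (fun q : M × ℝ => ψ q.1 q.2) →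
        (∀ p s, 0 < ψ p s) →
        ContMDiff (𝓡∂ (2 * n)) 𝓘(ℝ, ℝ) 4 u →
        IsAdmissibleSolution χ ψ u →
        (∀ p, |u p| ≤ Ku) →
        S.RootBoundAlong ψ u Kψ →
        χ.BoundAlong u ε K₀ K₁ K₂ →
        S.GeometryBound KT KR →
        ∀ p, S.gradNorm u p
          ≤ C₁ * (1 + sSup (S.gradNorm u '' (𝓡∂ (2 * n)).boundary M)) := by
  -- The given bounds carry no sign assumption, so the constant is built from their absolute values;
  -- each hypothesis persists when its bound is enlarged.
  refine ⟨Real.exp (weightAmplitude ε Ku |Kψ| |K₀| |K₁| |K₂| |KT| |KR| * Real.exp Ku)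
    * interiorBound n ε |Kψ| |K₀| |KT|,
    mul_pos (Real.exp_pos _) (one_pos.trans_le (le_max_left _ _)), ?_⟩
  intro M _ _ _ _ _ S χ ψ u hψ hψpos hu hsol huK hroot hχ hgeo p
  refine gradNorm_le_of_isAdmissibleSolution (by omega) hε (abs_nonneg _) (abs_nonneg _)
    (abs_nonneg _) (abs_nonneg _) (abs_nonneg _) (abs_nonneg _) hψ hψpos hu hsol huK
    (fun q => (hroot q).trans (le_abs_self _)) (fun e he w hw => ?_) (fun e he w hw => ?_) p
  · obtain ⟨h, h₀, h₁, h₂⟩ := hχ e he w hw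
    exact ⟨h, h₀.mono (le_abs_self _), h₁.mono (le_abs_self _),
      posSemidef_smul_sub_mono (S.metricMatrix_posDef he hw) h₂ (le_abs_self _)⟩
  · obtain ⟨hT, hR⟩ := hgeo e he w hw
    exact ⟨hT.mono (le_abs_self _), hR.mono (le_abs_self _)⟩
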